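/- Let $r\ge 3$, $n_r=2^r-1$, $b\ge 0$. Let $G\in\mathbb F_2^{r\times n_r}$ be a generator matrix of the classical simplex code $C(r)$ (its columns are the nonzero vectors of $\mathbb F_2^r$, each occurring once), $H$ any parity check matrix of $C(r)$ (that is, $\ker H$ is the row space of $G$), and $P\in\mathbb F_2^{r\times n_r}$ a pivot matrix, i.e. a 0/1 matrix with exactly one $1$ in each row, such that $PG^T=I_r$. Let $SHYPS(r)$ be the subsystem CSS code on $n_r^2$ physical qubits whose gauge group is generated by the phase $i$, by the operators $X^g$ for $g$ a row of $G_X=H\otimes I_{n_r}$, and by the operators $Z^g$ for $g$ a row of $G_Z=I_{n_r}\otimes H$. It has $r^2$ logical qubits, whose logical $X$- and $Z$-operators are given by the rows of $L_X=P\otimes G$ and $L_Z=G\otimes P$. A depth-1 circuit is a set of gates $S_i$ and $CZ_{i,j}$ ($i\ne j$) acting on pairwise disjoint sets of physical qubits. A unitary preserves a code if conjugation by it maps the gauge group onto itself. A physical unitary $W$ implements a logical Clifford operator $U$ modulo Paulis if $W$ preserves the code and, for every logical Pauli $Q$, conjugation by $W$ maps the encoded version of $Q$ to the encoded version of $UQU^{-1}$,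 up to phases and stabilizers (the stabilizer group together with the phases $\langle i\rangle$ being the centre of the gauge group). **Theorem.** Let $U$ be any Clifford unitary on $br^2$ qubits that is diagonal in the computational basis. Then $U$, as a logical operator on $b$ blocks of $SHYPS(r)$, is implemented modulo Paulis by a sequence of depth-1 circuits acting only on the $bn_r^2$ physical qubits of the $b$ blocks (no auxiliary qubits, hence zero space overhead), each of which preserves the code. The number of these circuits (the depth) is at most $$br^2+(b+4)r+(4b-2)\quad (r\ge 4),\qquad br^2+(b+7)r+(4b-2)=16b+19\quad (r=3)$$ if $b$ is even, and at most $$(b+1)r^2+(b+5)r+(4b+2)\quad (r\ge 4),\qquad (b+1)r^2+(b+8)r+(4b+2)=16b+35\quad (r=3)$$ if $b$ is odd. (In particular, for $r=3$ the depth is at most $16b+25$ and $16b+41$, respectively.) -/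

import Mathlib

open scoped Kronecker

/-! ### Qubit registers, Pauli and Clifford groups -/

/-- Labels of the computational basis of a register whose qubits are indexed by `ι`;
also exponent vectors of `X`- and `Z`-type Paulis. -/
abbrev Bits (ι : Type) : Type := ι → ZMod 2

section Paulis

variable {ι : Type} [Fintype ι] [DecidableEq ι]

/-- The unitary group `U(2^n)` of the register `ι`, `n = |ι|`. -/
abbrev QubitUnitary (ι : Type) [Fintype ι] [DecidableEq ι] : Type :=
  Matrix.unitaryGroup (Bits ι) ℂ

/-- The unitary that is diagonal in the computational basis with the given phases. -/
noncomputable def diagUnitary (f : Bits ι → ℂ) (hf : ∀ x, f x * star (f x) = 1) :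
    QubitUnitary ι :=
  ⟨Matrix.diagonal f, by
    rw [Matrix.mem_unitaryGroup_iff, Matrix.star_eq_conjTranspose,
      Matrix.diagonal_conjTranspose, Matrix.diagonal_mul_diagonal, ← Matrix.diagonal_one]
    congr 1
    funext x
    exact hf x⟩

/-- `X^u = ∏ X_i^{u_i}`, that is `X^u |y⟩ = |y + u⟩`. -/
noncomputable def pauliX (u : Bits ι) : QubitUnitary ι :=
  ⟨Matrix.of fun x y => if x = y + u then 1 else 0, by
    rw [Matrix.mem_unitaryGroup_iff]
    ext x z
    rw [Matrix.mul_apply, Matrix.one_apply, Finset.sum_eq_single (x - u)]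
    · by_cases h : x = z
      · simp [Matrix.star_apply, h]
      · have h' : ¬ z = x := fun e => h e.symm
        simp [Matrix.star_apply, h, h']
    · intro y _ hy
      have : ¬ x = y + u := fun e => hy (by rw [e]; simp)
      simp [this]
    · simp⟩

/-- `Z^v = ∏ Z_i^{v_i}`, that is `Z^v |x⟩ = (-1)^{v·x} |x⟩`. -/
noncomputable def pauliZ (v : Bits ι) : QubitUnitary ι :=
  diagUnitary (fun x => (-1 : ℂ) ^ (v ⬝ᵥ x).val) (fun x => by
    simp [← mul_pow])

/-- The scalar unitary `i·I`. -/
noncomputable def phaseI (ι : Type) [Fintype ι] [DecidableEq ι] : QubitUnitary ι :=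
  diagUnitary (fun _ => Complex.I) (fun _ => by simp)

/-- The group `⟨i⟩` of scalar phases. -/
noncomputable def phaseGroup (ι : Type) [Fintype ι] [DecidableEq ι] :
    Subgroup (QubitUnitary ι) :=
  Subgroup.zpowers (phaseI ι)

/-- The Pauli group `⟨i, X_j, Z_j⟩`. -/
noncomputable def pauliGroup (ι : Type) [Fintype ι] [DecidableEq ι] :
    Subgroup (QubitUnitary ι) :=
  Subgroup.closure ({phaseI ι} ∪ Set.range (fun j : ι => pauliX (Pi.single j 1)) ∪
    Set.range (fun j : ι => pauliZ (Pi.single j 1)))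

/-- Clifford unitaries: the normalizer of the Pauli group in the unitary group. -/
noncomputable def cliffordGroup (ι : Type) [Fintype ι] [DecidableEq ι] :
    Subgroup (QubitUnitary ι) :=
  Subgroup.normalizer (pauliGroup ι : Set (QubitUnitary ι))

/-- A diagonal Clifford operator: a Clifford unitary which is diagonal in the
computational basis. -/
def IsDiagonalClifford (U : QubitUnitary ι) : Prop :=
  U ∈ cliffordGroup ι ∧ (U : Matrix (Bits ι) (Bits ι) ℂ).IsDiag

/-! ### Circuits of diagonal gates and their depth -/

/-- The phase gate on one qubit, and the controlled-`Z` gate on two distinct qubits. -/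
inductive DiagGate (ι : Type) : Type
  | S (i : ι) : DiagGate ι
  | CZ (i j : ι) (h : i ≠ j) : DiagGate ι

/-- The qubits a gate acts on. -/
def DiagGate.support : DiagGate ι → Finset ι
  | .S i => {i}
  | .CZ i j _ => {i, j}

/-- `S_i |x⟩ = i^{x_i} |x⟩` and `CZ_{i,j} |x⟩ = (-1)^{x_i x_j} |x⟩`. -/
noncomputable def DiagGate.toUnitary : DiagGate ι → QubitUnitary ι
  | .S i => diagUnitary (fun x => Complex.I ^ (x i).val) (fun x => by
      simp [← mul_pow])
  | .CZ i j _ => diagUnitary (fun x => (-1 : ℂ) ^ (x i * x j).val) (fun x => by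
      simp [← mul_pow])

/-- A depth-1 circuit: gates acting on pairwise disjoint sets of qubits. -/
structure Layer (ι : Type) [Fintype ι] [DecidableEq ι] : Type where
  gates : List (DiagGate ι)
  disjoint : gates.Pairwise (fun g h => Disjoint g.support h.support)

/-- The unitary performed by a depth-1 circuit. -/
noncomputable def Layer.toUnitary (L : Layer ι) : QubitUnitary ι :=
  (L.gates.map DiagGate.toUnitary).prod

/-- The unitary performed by a sequence of layers; the head of the list is executed first.
The depth of the circuit is the length of the list. -/
noncomputable def circuitUnitary : List (Layer ι) → QubitUnitary ι
  | [] => 1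
  | L :: C => circuitUnitary C * L.toUnitary

end Paulis

/-! ### Subsystem CSS codes and logical operators -/

/-- A subsystem CSS code on the qubits `ι`, given by the `X`- and `Z`-type gauge generators
(the rows of `GX` and `GZ`), together with bare logical `X`- and `Z`-operators for logical
qubits `κ` (the rows of `LX` and `LZ`). -/
structure CSSSubsystemCode (ρX ρZ ι κ : Type) : Type where
  GX : Matrix ρX ι (ZMod 2)
  GZ : Matrix ρZ ι (ZMod 2)
  LX : Matrix κ ι (ZMod 2)
  LZ : Matrix κ ι (ZMod 2)

namespace CSSSubsystemCode

variable {ρX ρZ ι κ : Type} [Fintype ι] [DecidableEq ι] [Fintype κ] [DecidableEq κ]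

/-- `b` independent blocks of a code. -/
def blocks (b : ℕ) (Q : CSSSubsystemCode ρX ρZ ι κ) :
    CSSSubsystemCode (Fin b × ρX) (Fin b × ρZ) (Fin b × ι) (Fin b × κ) where
  GX := (1 : Matrix (Fin b) (Fin b) (ZMod 2)) ⊗ₖ Q.GX
  GZ := (1 : Matrix (Fin b) (Fin b) (ZMod 2)) ⊗ₖ Q.GZ
  LX := (1 : Matrix (Fin b) (Fin b) (ZMod 2)) ⊗ₖ Q.LX
  LZ := (1 : Matrix (Fin b) (Fin b) (ZMod 2)) ⊗ₖ Q.LZ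

/-- The gauge group, phases included. -/
noncomputable def gaugeGroup (Q : CSSSubsystemCode ρX ρZ ι κ) : Subgroup (QubitUnitary ι) :=
  Subgroup.closure ({phaseI ι} ∪ Set.range (fun a : ρX => pauliX (Q.GX a)) ∪
    Set.range (fun a : ρZ => pauliZ (Q.GZ a)))

/-- The stabilizer group together with the phases, `⟨S, i⟩`: the centre of the gauge group. -/
noncomputable def stabilizerGroup (Q : CSSSubsystemCode ρX ρZ ι κ) :
    Subgroup (QubitUnitary ι) :=
  Subgroup.centralizer (Q.gaugeGroup : Set (QubitUnitary ι)) ⊓ Q.gaugeGroup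

/-- The encoded version of the logical Pauli `X^u Z^v`. -/
noncomputable def encodedPauli (Q : CSSSubsystemCode ρX ρZ ι κ) (u v : Bits κ) :
    QubitUnitary ι :=
  pauliX (Matrix.vecMul u Q.LX) * pauliZ (Matrix.vecMul v Q.LZ)

/-- A physical unitary preserves the code if conjugation by it maps the gauge group onto
itself. -/
def Preserves (Q : CSSSubsystemCode ρX ρZ ι κ) (W : QubitUnitary ι) : Prop :=
  W ∈ Subgroup.normalizer (Q.gaugeGroup : Set (QubitUnitary ι))

/-- The physical unitary `W` implements, modulo Paulis, the logical operator `U`: it preserves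
the code, and whenever `U` conjugates the logical Pauli `X^u Z^v` to `X^{u'} Z^{v'}` (up to a
phase), `W` conjugates the encoded `X^u Z^v` to the encoded `X^{u'} Z^{v'}` (up to a phase and
a stabilizer). Ignoring the phases amounts to working modulo Paulis. -/
def ImplementsModPauli (Q : CSSSubsystemCode ρX ρZ ι κ) (W : QubitUnitary ι)
    (U : QubitUnitary κ) : Prop :=
  Q.Preserves W ∧ ∀ u v : Bits κ, ∃ u' v' : Bits κ,
    (pauliX u' * pauliZ v')⁻¹ * (U * (pauliX u * pauliZ v) * U⁻¹) ∈ phaseGroup κ ∧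
    (Q.encodedPauli u' v')⁻¹ * (W * Q.encodedPauli u v * W⁻¹) ∈ Q.stabilizerGroup

end CSSSubsystemCode

/-! ### Simplex codes and SHYPS codes -/

/-- `G` is a generator matrix of a classical simplex code `C(r)` of length `2^r - 1`: its
columns are pairwise distinct and nonzero, hence run through all nonzero vectors of `𝔽₂^r`
(equivalently, `G` is a parity check matrix of a Hamming code). -/
def IsSimplexGenerator (r : ℕ) (G : Matrix (Fin r) (Fin (2 ^ r - 1)) (ZMod 2)) : Prop :=
  Function.Injective G.transpose ∧ ∀ j, G.transpose j ≠ 0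

/-- `H` is a (possibly redundant) parity check matrix of the code generated by `G`: the kernel
of `H` is the row space of `G`. -/
def IsParityCheck {m n r : ℕ} (H : Matrix (Fin m) (Fin n) (ZMod 2))
    (G : Matrix (Fin r) (Fin n) (ZMod 2)) : Prop :=
  ∀ c : Fin n → ZMod 2, H.mulVec c = 0 ↔ ∃ a : Fin r → ZMod 2, c = Matrix.vecMul a G

/-- The matrix of a list of pivots: `P i j = 1` if and only if the `i`-th pivot is `j`. -/
def pivotMatrix {n r : ℕ} (p : Fin r → Fin n) : Matrix (Fin r) (Fin n) (ZMod 2) :=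
  Matrix.of fun i j => if p i = j then 1 else 0

/-- The subsystem hypergraph product code of two copies of `H`, with the logical operators
`L_X = P ⊗ G` and `L_Z = G ⊗ P` for a generator matrix `G` of `ker H` and a pivot matrix `P`.
Physical and logical qubits form an `n × n` and an `r × r` array. -/
def shypsCode {m n r : ℕ} (H : Matrix (Fin m) (Fin n) (ZMod 2))
    (G : Matrix (Fin r) (Fin n) (ZMod 2)) (p : Fin r → Fin n) :
    CSSSubsystemCode (Fin m × Fin n) (Fin n × Fin m) (Fin n × Fin n) (Fin r × Fin r) where
  GX := H ⊗ₖ (1 : Matrix (Fin n) (Fin n) (ZMod 2))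
  GZ := (1 : Matrix (Fin n) (Fin n) (ZMod 2)) ⊗ₖ H
  LX := pivotMatrix p ⊗ₖ G
  LZ := G ⊗ₖ pivotMatrix p

/-!
Modulo Paulis, a diagonal unitary is determined by its action `X^a ↦ X^a Z^(a B)`, where `B` is a
matrix over `𝔽₂`, and composition of unitaries is addition of these matrices (`ActsBy.mul`). For
a diagonal Clifford unitary `B` is symmetric (`IsDiagonalClifford.exists_actsBy`). The theorem is
thus about writing a symmetric matrix as a short sum of actions of code-preserving layers.

*The available layers.* An invertible matrix `N` permutes the columns of the simplex generator
matrix. For an involution `μ` of the blocks and invertible matrices `N β`, the map that exchanges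
block `β` with block `μ β`, transposes the qubit array and permutes its rows and columns according
to the `N β` is an involution of the qubits, hence is realized by one layer: `CZ` on each swapped
pair and `S` on each fixed point. This layer preserves the code, and after a rearrangement of
indices its logical action between blocks `β` and `μ β` is the tensor `N β ⊗ N (μ β)`
(`hasCircuit_pairAction`). The layer may also leave out some pairs of blocks.

*Reduction to tensors.* The block of `B` between two different blocks of qubits is an arbitrary
tensor, and has to be a sum of few tensors `A ⊗ A'` with `A`, `A'` invertible. A diagonal block is
a symmetric tensor, and has to be a sum of few squares `N ⊗ N` with `N` invertible. All diagonal
blocks are treated at the same time, with `μ = id`, and so are the blocks of one colour of an edge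
colouring of the complete graph on the `b` blocks of qubits, which needs `b - 1` colours for even
`b ≥ 2` and `b` colours otherwise (`hasCircuit_of_isSymm`).

*The algebra.* The field `K` with `2 ^ r` elements sits inside the `r × r` matrices, and every
coset `B + K` contains an invertible matrix (`exists_isUnit_add_map`), as a nonzero vector
is killed by exactly one member of the coset.

- An arbitrary tensor is `∑ A i ⊗ B i` with an invertible basis `A i`. Moving the `B i` inside
  their cosets makes them invertible; what remains is a tensor in `Mat ⊗ K`, of the form
  `∑ C l ⊗ k l` with `r` summands. Averaging arguments give four invertible matrices whose span
  moves enough combinations of the `C l` into the invertible matrices, so `r + 4` further terms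
  suffice, and `r ^ 2 + r + 4` altogether (`isSumOfAtMost_unitTensors_of_two_le`).
- A symmetric tensor is a sum of `r ^ 2 + 1` squares of matrices. Moving each of them inside its
  coset leaves `r` symmetric products `C ⊗ k + k ⊗ C` with `k` in `K`, and squares of elements of
  `K`, which take `r + 1` terms altogether. If `N` and `N + 1` are invertible then
  `N ⊗ 1 + 1 ⊗ N` takes two terms up to a square in `K`; corrections of rank one
  (`exists_rank_one_correction`) write every matrix, up to `K`, as a sum of two such `N` for
  `r ≥ 4` and of three for `r = 3`. The total is `r ^ 2 + 5 r + 2` for `r ≥ 4`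
  (`isSumOfAtMost_unitSquares_of_four_le`), and `32` for `r = 3`
  (`isSumOfAtMost_unitSquares_of_three_le`).

With `D` terms for the squares, the depth is `D + (b - 1) (r ^ 2 + r + 4)` for even `b ≥ 2` and
`D + b (r ^ 2 + r + 4)` for odd `b`. For `r ≥ 4` these are the claimed numbers; for `r = 3` the
claim leaves room for `D = 35`.
-/

/-! ### A copy of the field with `2 ^ r` elements inside the matrix algebra -/

section FieldOfMatrices

open Matrix

theorem isUnit_iff_forall_mulVec {r : ℕ} {M : Matrix (Fin r) (Fin r) (ZMod 2)} :
    IsUnit M ↔ ∀ v, M *ᵥ v = 0 → v = 0 := by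
  rw [← Matrix.mulVec_injective_iff_isUnit]
  constructor
  · intro h v hv
    exact h (by simpa using hv)
  · intro h v w hvw
    have : M *ᵥ (v - w) = 0 := by
      rw [Matrix.mulVec_sub, sub_eq_zero]
      exact hvw
    exact sub_eq_zero.1 (h _ this)

theorem exists_mulVec_eq_zero_of_not_isUnit {r : ℕ} {M : Matrix (Fin r) (Fin r) (ZMod 2)}
    (h : ¬ IsUnit M) : ∃ v, v ≠ 0 ∧ M *ᵥ v = 0 := by
  rw [isUnit_iff_forall_mulVec] at h
  push Not at h
  obtain ⟨v, h1, h2⟩ := h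
  exact ⟨v, h2, h1⟩

theorem zmod_two_cases (c : ZMod 2) : c = 0 ∨ c = 1 := by
  revert c; decide

theorem add_self_of_zmod_two {V : Type*} [AddCommGroup V] [Module (ZMod 2) V] (v : V) :
    v + v = 0 := by
  rw [← two_smul (ZMod 2) v, show (2 : ZMod 2) = 0 from rfl, zero_smul]

theorem neg_eq_of_zmod_two {V : Type*} [AddCommGroup V] [Module (ZMod 2) V] (v : V) :
    -v = v :=
  neg_eq_of_add_eq_zero_left (add_self_of_zmod_two v)

theorem add_add_cancel_zmod_two {V : Type*} [AddCommGroup V] [Module (ZMod 2) V] (v w : V) :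
    v + w + w = v := by
  rw [add_assoc, add_self_of_zmod_two, add_zero]

theorem eq_of_add_eq_zero_zmod_two {V : Type*} [AddCommGroup V] [Module (ZMod 2) V] {v w : V}
    (h : v + w = 0) : v = w := by
  rw [eq_neg_of_add_eq_zero_left h, neg_eq_of_zmod_two]

theorem exists_ne_zero_ne_one {r : ℕ} {K : Type} [Field K] [Fintype K]
    (hK : Fintype.card K = 2 ^ r) (hr : 2 ≤ r) : ∃ θ : K, θ ≠ 0 ∧ θ ≠ 1 := by
  classical
  by_contra hcon
  push Not at hcon
  have : (Finset.univ : Finset K) ⊆ {0, 1} := by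
    intro z _
    by_cases h : z = 0
    · simp [h]
    · simp [hcon z h]
  have h1 := (Finset.card_le_card this).trans Finset.card_le_two
  rw [Finset.card_univ, hK] at h1
  have : 2 ^ 2 ≤ 2 ^ r := Nat.pow_le_pow_right (by norm_num) hr
  omega

variable {r : ℕ} {K : Type} [Field K] [Algebra (ZMod 2) K]
  (φ : K →ₐ[ZMod 2] Matrix (Fin r) (Fin r) (ZMod 2))

theorem isUnit_map_of_ne_zero {z : K} (hz : z ≠ 0) : IsUnit (φ z) :=
  (IsUnit.mk0 z hz).map φ

theorem map_mulVec_injective {u : Fin r → ZMod 2} (hu : u ≠ 0) {z z' : K}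
    (h : φ z *ᵥ u = φ z' *ᵥ u) : z = z' := by
  by_contra hne
  have h1 := isUnit_map_of_ne_zero φ (sub_ne_zero.2 hne)
  apply hu
  apply isUnit_iff_forall_mulVec.1 h1
  rw [map_sub, Matrix.sub_mulVec, h, sub_self]

variable [Fintype K]

/-- The field acts transitively on the nonzero vectors, by counting. -/
theorem exists_map_mulVec_eq (hK : Fintype.card K = 2 ^ r) {u : Fin r → ZMod 2} (hu : u ≠ 0)
    (w : Fin r → ZMod 2) :
    ∃ z : K, φ z *ᵥ u = w := by
  have hinj : Function.Injective (fun z : K => φ z *ᵥ u) :=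
    fun z z' h => map_mulVec_injective φ hu h
  have hbij := (Fintype.bijective_iff_injective_and_card (fun z : K => φ z *ᵥ u)).2
    ⟨hinj, by simp [hK]⟩
  exact hbij.2 w

/-- Every coset of the field contains an invertible matrix: the `2 ^ r` members of the coset
cannot all be singular, since no nonzero vector is killed by two of them. -/
theorem exists_isUnit_add_map (hK : Fintype.card K = 2 ^ r) (B : Matrix (Fin r) (Fin r) (ZMod 2)) :
    ∃ y : K, IsUnit (B + φ y) := by
  by_contra hcon
  push Not at hcon
  choose v hv0 hv using fun y => exists_mulVec_eq_zero_of_not_isUnit (hcon y)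
  have hinj : Function.Injective v := by
    intro y y' h
    apply map_mulVec_injective φ (hv0 y)
    have h1 := hv y
    have h2 := hv y'
    rw [← h, ← h1, Matrix.add_mulVec, Matrix.add_mulVec] at h2
    exact (add_left_cancel h2).symm
  have hsurj := ((Fintype.bijective_iff_injective_and_card v).2
    ⟨hinj, by simp [hK]⟩).2
  obtain ⟨y, hy⟩ := hsurj 0
  exact hv0 y hy

theorem exists_eq_add_isUnit (φ : K →ₐ[ZMod 2] Matrix (Fin r) (Fin r) (ZMod 2))
    (hK : Fintype.card K = 2 ^ r) (hr : 2 ≤ r) (B : Matrix (Fin r) (Fin r) (ZMod 2)) :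
    ∃ A A' : Matrix (Fin r) (Fin r) (ZMod 2), IsUnit A ∧ IsUnit A' ∧ B = A + A' := by
  obtain ⟨y, hy⟩ := exists_isUnit_add_map φ hK B
  -- if `B` itself is invertible, it is split as `B θ + B (1 - θ)`
  by_cases h0 : y = 0
  · obtain ⟨θ, h1, h2⟩ := exists_ne_zero_ne_one hK hr
    have h3 : θ - 1 ≠ 0 := sub_ne_zero.2 h2
    refine ⟨B * φ θ, B * φ (1 - θ), ?_, ?_, ?_⟩
    · rw [h0, map_zero, add_zero] at hy
      exact hy.mul (isUnit_map_of_ne_zero φ h1)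
    · rw [h0, map_zero, add_zero] at hy
      exact hy.mul (isUnit_map_of_ne_zero φ (sub_ne_zero.2 (Ne.symm h2)))
    · rw [← mul_add, ← map_add, add_sub_cancel, map_one, mul_one]
  · exact ⟨B + φ y, φ y, hy, isUnit_map_of_ne_zero φ h0, (add_add_cancel_zmod_two _ _).symm⟩

/-- Among the cosets `{C + y, C + y + 1}` there is one both of whose members have corank at most
one: a pair which violates this has at least three nonzero kernel vectors, while every nonzero
vector is killed by exactly one `C + y`. -/
theorem exists_corank_le_one_pair (hK : Fintype.card K = 2 ^ r)
    (C : Matrix (Fin r) (Fin r) (ZMod 2)) :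
    ∃ y : K, (∀ v w, v ≠ 0 → w ≠ 0 → (C + φ y) *ᵥ v = 0 → (C + φ y) *ᵥ w = 0 → v = w) ∧
      (∀ v w, v ≠ 0 → w ≠ 0 → (C + φ y + 1) *ᵥ v = 0 → (C + φ y + 1) *ᵥ w = 0 → v = w) := by
  classical
  by_contra hcon
  push Not at hcon
  let k : K → ℕ := fun y =>
    (Finset.univ.filter fun v : Fin r → ZMod 2 => v ≠ 0 ∧ (C + φ y) *ᵥ v = 0).card
  have hsum : ∑ y, k y = 2 ^ r - 1 := by
    have h1 : ∑ y, k y = (Finset.univ.filter fun v : Fin r → ZMod 2 => v ≠ 0).card := by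
      rw [← Finset.card_biUnion]
      · congr 1
        ext v
        simp only [Finset.mem_biUnion, Finset.mem_univ, true_and, Finset.mem_filter]
        constructor
        · rintro ⟨y, h, _⟩
          exact h
        · intro hv
          obtain ⟨z, hz⟩ := exists_map_mulVec_eq φ hK hv (C *ᵥ v)
          refine ⟨z, hv, ?_⟩
          rw [Matrix.add_mulVec, hz, add_self_of_zmod_two]
      · intro y _ y' _ hne
        rw [Function.onFun, Finset.disjoint_left]
        intro v hv hv'
        simp only [Finset.mem_filter, Finset.mem_univ, true_and] at hv hv'
        apply hne
        apply map_mulVec_injective φ hv.1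
        have h2 := hv.2.trans hv'.2.symm
        rw [Matrix.add_mulVec, Matrix.add_mulVec] at h2
        exact add_left_cancel h2
    rw [h1, Finset.filter_ne' Finset.univ (0 : Fin r → ZMod 2),
      Finset.card_erase_of_mem (Finset.mem_univ _), Finset.card_univ]
    simp
  have hthree : ∀ y v w, v ≠ w → v ≠ 0 → w ≠ 0 → (C + φ y) *ᵥ v = 0 → (C + φ y) *ᵥ w = 0 →
      3 ≤ k y := by
    intro y v w hvw hv hw h1 h2
    have hvw' : v + w ≠ 0 := fun h => hvw (eq_of_add_eq_zero_zmod_two h)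
    have hsub : ({v, w, v + w} : Finset (Fin r → ZMod 2)) ⊆
        Finset.univ.filter fun v : Fin r → ZMod 2 => v ≠ 0 ∧ (C + φ y) *ᵥ v = 0 := by
      intro x hx
      simp only [Finset.mem_insert, Finset.mem_singleton] at hx
      simp only [Finset.mem_filter, Finset.mem_univ, true_and]
      rcases hx with rfl | rfl | rfl
      · exact ⟨hv, h1⟩
      · exact ⟨hw, h2⟩
      · exact ⟨hvw', by rw [Matrix.mulVec_add, h1, h2, add_zero]⟩
    have hcard : ({v, w, v + w} : Finset (Fin r → ZMod 2)).card = 3 := by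
      rw [Finset.card_eq_three]
      refine ⟨v, w, v + w, hvw, ?_, ?_, rfl⟩
      · intro h
        exact hw (by simpa using h)
      · intro h
        exact hv (by simpa using h)
    rw [← hcard]
    exact Finset.card_le_card hsub
  have hpair : ∀ y, 3 ≤ k y + k (y + 1) := by
    intro y
    by_cases h : ∀ v w, v ≠ 0 → w ≠ 0 → (C + φ y) *ᵥ v = 0 → (C + φ y) *ᵥ w = 0 → v = w
    · obtain ⟨v, w, h1, h2, h3, h4, h5⟩ := hcon y h
      have := hthree (y + 1) v w h5 h1 h2 (by rwa [map_add, map_one, ← add_assoc])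
        (by rwa [map_add, map_one, ← add_assoc])
      omega
    · push Not at h
      obtain ⟨v, w, h1, h2, h3, h4, h5⟩ := h
      have := hthree y v w h5 h1 h2 h3 h4
      omega
  have h1 : ∑ y : K, 3 ≤ ∑ y, (k y + k (y + 1)) := Finset.sum_le_sum fun y _ => hpair y
  have h2 : ∑ y, k (y + 1) = ∑ y, k y := Equiv.sum_comp (Equiv.addRight (1 : K)) k
  rw [Finset.sum_add_distrib, h2, hsum] at h1
  simp only [Finset.sum_const, Finset.card_univ, hK, smul_eq_mul] at h1
  have : 0 < 2 ^ r := by positivity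
  omega

end FieldOfMatrices

/-- The field with `2 ^ r` elements embeds into the `r × r` matrices, by its regular
representation. -/
theorem exists_field_of_matrices (r : ℕ) (hr : r ≠ 0) :
    ∃ (K : Type) (_ : Field K) (_ : Fintype K) (_ : Algebra (ZMod 2) K)
      (_ : K →ₐ[ZMod 2] Matrix (Fin r) (Fin r) (ZMod 2)), Fintype.card K = 2 ^ r := by
  classical
  have : Fact (Nat.Prime 2) := ⟨Nat.prime_two⟩
  let b : Module.Basis (Fin r) (ZMod 2) (GaloisField 2 r) :=
    Module.finBasisOfFinrankEq (ZMod 2) (GaloisField 2 r) (GaloisField.finrank 2 hr)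
  let _ : Fintype (GaloisField 2 r) := Fintype.ofFinite _
  refine ⟨GaloisField 2 r, inferInstance, inferInstance, inferInstance,
    Algebra.leftMulMatrix b, ?_⟩
  rw [← Nat.card_eq_fintype_card, GaloisField.card 2 r hr]

/-! ### Sums of boundedly many terms -/

section BoundedSums

variable {M : Type*} [AddCommMonoid M]

/-- `x` is a sum of at most `k` members of `S`. -/
def IsSumOfAtMost (S : Set M) (k : ℕ) (x : M) : Prop :=
  ∃ l : List M, l.length ≤ k ∧ (∀ a ∈ l, a ∈ S) ∧ l.sum = x

theorem IsSumOfAtMost.zero (S : Set M) (k : ℕ) : IsSumOfAtMost S k 0 :=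
  ⟨[], by simp, by simp, by simp⟩

theorem IsSumOfAtMost.of_mem {S : Set M} {x : M} (hx : x ∈ S) : IsSumOfAtMost S 1 x :=
  ⟨[x], by simp, by simpa using hx, by simp⟩

theorem IsSumOfAtMost.mono {S : Set M} {k k' : ℕ} {x : M} (h : IsSumOfAtMost S k x)
    (hk : k ≤ k') : IsSumOfAtMost S k' x := by
  obtain ⟨l, h1, h2, h3⟩ := h
  exact ⟨l, h1.trans hk, h2, h3⟩

theorem IsSumOfAtMost.add {S : Set M} {k k' : ℕ} {x x' : M} (h : IsSumOfAtMost S k x)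
    (h' : IsSumOfAtMost S k' x') : IsSumOfAtMost S (k + k') (x + x') := by
  obtain ⟨l, h1, h2, h3⟩ := h
  obtain ⟨l', h1', h2', h3'⟩ := h'
  refine ⟨l ++ l', by simp; omega, ?_, by simp [h3, h3']⟩
  intro a ha
  rcases List.mem_append.1 ha with ha | ha
  · exact h2 a ha
  · exact h2' a ha

theorem IsSumOfAtMost.sum {S : Set M} {ι : Type*} (s : Finset ι) (k : ι → ℕ) (x : ι → M)
    (h : ∀ i ∈ s, IsSumOfAtMost S (k i) (x i)) :
    IsSumOfAtMost S (∑ i ∈ s, k i) (∑ i ∈ s, x i) := by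
  classical
  induction s using Finset.induction_on with
  | empty => simpa using IsSumOfAtMost.zero S 0
  | insert i s hi ih =>
    rw [Finset.sum_insert hi, Finset.sum_insert hi]
    exact (h i (Finset.mem_insert_self _ _)).add
      (ih fun j hj => h j (Finset.mem_insert_of_mem hj))

theorem IsSumOfAtMost.sum_univ_const {S : Set M} {ι : Type*} [Fintype ι] {k : ℕ} {x : ι → M}
    (h : ∀ i, IsSumOfAtMost S k (x i)) :
    IsSumOfAtMost S (Fintype.card ι * k) (∑ i, x i) := by
  have := IsSumOfAtMost.sum Finset.univ (fun _ => k) x fun i _ => h i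
  simpa using this

/-- A sum of at most `k` members, padded with zeros to exactly `k` summands. -/
theorem IsSumOfAtMost.exists_fin {S : Set M} {k : ℕ} {x : M} (h : IsSumOfAtMost S k x) :
    ∃ f : Fin k → M, (∀ t, f t ∈ S ∨ f t = 0) ∧ ∑ t, f t = x := by
  obtain ⟨l, h1, h2, h3⟩ := h
  refine ⟨fun t => l.getD t 0, ?_, ?_⟩
  · intro t
    by_cases ht : (t : ℕ) < l.length
    · left
      simp only [List.getD_eq_getElem _ _ ht]
      exact h2 _ (List.getElem_mem ht)
    · right
      exact List.getD_eq_default _ _ (not_lt.1 ht)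
  · obtain ⟨d, rfl⟩ := Nat.exists_eq_add_of_le h1
    rw [Fin.sum_univ_add]
    simp [← h3, ← Fin.sum_univ_getElem]

end BoundedSums

/-! ### Sums of tensor products of two invertible matrices -/

/-- The tensor `A ⊗ B`, as the rank-one matrix with entries `A p * B q`. -/
def outer (r : ℕ) : Matrix (Fin r) (Fin r) (ZMod 2) →ₗ[ZMod 2]
    Matrix (Fin r) (Fin r) (ZMod 2) →ₗ[ZMod 2]
      Matrix (Fin r × Fin r) (Fin r × Fin r) (ZMod 2) :=
  LinearMap.mk₂ (ZMod 2)
    (fun A B => Matrix.of fun p q => A p.1 p.2 * B q.1 q.2)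
    (fun A A' B => by ext p q; simp [add_mul])
    (fun c A B => by ext p q; simp [mul_assoc])
    (fun A B B' => by ext p q; simp [mul_add])
    (fun c A B => by ext p q; simp [mul_left_comm])

@[simp]
theorem outer_apply {r : ℕ} (A B : Matrix (Fin r) (Fin r) (ZMod 2)) (p q : Fin r × Fin r) :
    outer r A B p q = A p.1 p.2 * B q.1 q.2 := rfl

/-- The tensors `A ⊗ B` with `A` and `B` invertible. -/
def unitTensors (r : ℕ) : Set (Matrix (Fin r × Fin r) (Fin r × Fin r) (ZMod 2)) :=
  {W | ∃ A B, IsUnit A ∧ IsUnit B ∧ outer r A B = W}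

section Covering

/-- Averaging over all translates. -/
theorem exists_card_filter_add_mem_le {V : Type*} [AddCommGroup V] [Fintype V] [DecidableEq V]
    (U : Finset V) :
    ∃ x, (U.filter fun v => v + x ∈ U).card * Fintype.card V ≤ U.card ^ 2 := by
  by_contra hcon
  push Not at hcon
  have h1 : ∑ x, (U.filter fun v => v + x ∈ U).card = U.card ^ 2 := by
    simp_rw [Finset.card_filter]
    rw [Finset.sum_comm]
    have : ∀ v ∈ U, (∑ x, if v + x ∈ U then 1 else 0) = U.card := by
      intro v _
      have := Equiv.sum_comp (Equiv.addLeft v) fun x => if x ∈ U then (1 : ℕ) else 0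
      exact this.trans (by simp)
    rw [Finset.sum_congr rfl this]
    simp [sq]
  have hne : (Finset.univ : Finset V).Nonempty := ⟨0, Finset.mem_univ _⟩
  have h2 := Finset.sum_lt_sum_of_nonempty hne fun x _ => hcon x
  rw [← Finset.sum_mul, h1] at h2
  simp [mul_comm] at h2

/-- Translating by a suitable invertible matrix makes a set smaller: a generic translation by `x`
does, and if `x = c + c'` with `c` and `c'` invertible then one of these two does at least half
as well. -/
theorem exists_isUnit_card_filter_add_mem_le {r : ℕ}
    (hsum : ∀ B : Matrix (Fin r) (Fin r) (ZMod 2), ∃ A A', IsUnit A ∧ IsUnit A' ∧ B = A + A')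
    (U : Finset (Matrix (Fin r) (Fin r) (ZMod 2))) :
    ∃ c, IsUnit c ∧ 2 * Fintype.card (Matrix (Fin r) (Fin r) (ZMod 2)) *
      (U.filter fun v => v + c ∈ U).card ≤
        U.card * (Fintype.card (Matrix (Fin r) (Fin r) (ZMod 2)) + U.card) := by
  obtain ⟨x, hx⟩ := exists_card_filter_add_mem_le U
  obtain ⟨c, c', hc, hc', rfl⟩ := hsum x
  set N := Fintype.card (Matrix (Fin r) (Fin r) (ZMod 2))
  have hsplit : ∀ x, (U.filter fun v => v + x ∈ U).card + (U.filter fun v => v + x ∉ U).card =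
      U.card := fun x => Finset.card_filter_add_card_filter_not _
  have hdrop : (U.filter fun v => v + (c + c') ∉ U).card ≤
      (U.filter fun v => v + c ∉ U).card + (U.filter fun v => v + c' ∉ U).card := by
    rw [← Finset.card_filter_add_card_filter_not (s := U.filter fun v => v + (c + c') ∉ U)
      (fun v => v + c ∉ U)]
    apply Nat.add_le_add
    · apply Finset.card_le_card
      intro v hv
      simp only [Finset.mem_filter] at hv ⊢
      exact ⟨hv.1.1, hv.2⟩
    · apply Finset.card_le_card_of_injOn (fun v => v + c)
      · intro v hv
        simp only [Finset.coe_filter, Finset.mem_filter, Set.mem_ofPred_eq, not_not] at hv ⊢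
        exact ⟨hv.2, by rw [add_assoc]; exact hv.1.2⟩
      · intro v _ w _ h
        simpa using h
  have h1 := hsplit c
  have h2 := hsplit c'
  have h3 := hsplit (c + c')
  rcases le_total (U.filter fun v => v + c' ∉ U).card (U.filter fun v => v + c ∉ U).card
    with h | h
  · refine ⟨c, hc, ?_⟩
    nlinarith
  · refine ⟨c', hc', ?_⟩
    nlinarith

/-- The fraction of invertible matrices of size `n + 1` over `𝔽₂` is more than a quarter. The
surplus `(1 / 2) ^ (n + 2)` is what makes the induction work. -/
theorem quarter_le_prod_one_sub (n : ℕ) :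
    (1 / 4 + (1 / 2) ^ (n + 2) : ℝ) ≤ ∏ i ∈ Finset.range (n + 1), (1 - (1 / 2) ^ (i + 1)) := by
  induction n with
  | zero => norm_num
  | succ n ih =>
    rw [Finset.prod_range_succ]
    have hε : (1 / 2 : ℝ) ^ (n + 2) ≤ 1 / 4 := by
      calc (1 / 2 : ℝ) ^ (n + 2) ≤ (1 / 2) ^ 2 :=
            pow_le_pow_of_le_one (by norm_num) (by norm_num) (by omega)
        _ = 1 / 4 := by norm_num
    have hpos : (0 : ℝ) < (1 / 2) ^ (n + 2) := by positivity
    have h1 : (1 / 2 : ℝ) ^ (n + 1 + 2) = (1 / 2) ^ (n + 2) / 2 := by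
      rw [show n + 1 + 2 = (n + 2) + 1 by ring, pow_succ]; ring
    rw [h1, show n + 1 + 1 = n + 2 by ring]
    set ε := (1 / 2 : ℝ) ^ (n + 2)
    have h2 : (0 : ℝ) ≤ 1 - ε := by linarith
    calc 1 / 4 + ε / 2 ≤ (1 / 4 + ε) * (1 - ε) := by nlinarith
      _ ≤ _ := mul_le_mul_of_nonneg_right ih h2

/-- At most three quarters of all square matrices are singular. -/
theorem card_filter_not_isUnit_le {r : ℕ} (hr : 1 ≤ r) [DecidablePred
    fun A : Matrix (Fin r) (Fin r) (ZMod 2) => ¬ IsUnit A] :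
    4 * (Finset.univ.filter fun A : Matrix (Fin r) (Fin r) (ZMod 2) => ¬ IsUnit A).card ≤
      3 * Fintype.card (Matrix (Fin r) (Fin r) (ZMod 2)) := by
  classical
  have hunits : (Finset.univ.filter fun A : Matrix (Fin r) (Fin r) (ZMod 2) => IsUnit A).card =
      ∏ i : Fin r, (2 ^ r - 2 ^ (i : ℕ)) := by
    have h := Matrix.card_GL_field (𝔽 := ZMod 2) r
    rw [ZMod.card] at h
    rw [← h, Nat.card_eq_fintype_card, ← Fintype.card_subtype]
    exact Fintype.card_congr
      (Equiv.ofBijective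
        (fun A : {A : Matrix (Fin r) (Fin r) (ZMod 2) // IsUnit A} => A.2.unit)
        ⟨fun A B h => Subtype.ext (by
            have := congrArg Units.val h
            simpa using this),
          fun u => ⟨⟨u, u.isUnit⟩, Units.ext (by simp)⟩⟩)
  have hcard : Fintype.card (Matrix (Fin r) (Fin r) (ZMod 2)) = ∏ _i : Fin r, 2 ^ r := by
    rw [show Fintype.card (Matrix (Fin r) (Fin r) (ZMod 2)) =
      Fintype.card (Fin r → Fin r → ZMod 2) from Fintype.card_congr Matrix.of.symm]
    simp
  have hq : Fintype.card (Matrix (Fin r) (Fin r) (ZMod 2)) ≤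
      4 * ∏ i : Fin r, (2 ^ r - 2 ^ (i : ℕ)) := by
    rw [hcard]
    obtain ⟨n, rfl⟩ : ∃ n, r = n + 1 := ⟨r - 1, by omega⟩
    have h1 := quarter_le_prod_one_sub n
    have h2 : (∏ i : Fin (n + 1), ((2 : ℝ) ^ (n + 1) - 2 ^ (i : ℕ))) =
        (∏ _i : Fin (n + 1), (2 : ℝ) ^ (n + 1)) *
          ∏ i ∈ Finset.range (n + 1), (1 - (1 / 2 : ℝ) ^ (i + 1)) := by
      rw [← Finset.prod_range_reflect, ← Fin.prod_univ_eq_prod_range (fun j =>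
        (1 - (1 / 2 : ℝ) ^ (n + 1 - 1 - j + 1))), ← Finset.prod_mul_distrib]
      apply Finset.prod_congr rfl
      intro i _
      have hi : (i : ℕ) < n + 1 := i.2
      have h4 : (2 : ℝ) ^ (n + 1) * (1 / 2) ^ (n + 1 - 1 - (i : ℕ) + 1) = 2 ^ (i : ℕ) := by
        rw [show n + 1 - 1 - (i : ℕ) + 1 = n + 1 - i by omega, one_div, inv_pow,
          ← pow_sub₀ (2 : ℝ) (by norm_num) (Nat.sub_le _ _), Nat.sub_sub_self hi.le]
      rw [mul_sub, h4, mul_one]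
    have h3 : ((∏ _i : Fin (n + 1), 2 ^ (n + 1) : ℕ) : ℝ) ≤
        ((4 * ∏ i : Fin (n + 1), (2 ^ (n + 1) - 2 ^ (i : ℕ)) : ℕ) : ℝ) := by
      have h4 : ∀ i : Fin (n + 1), ((2 ^ (n + 1) - 2 ^ (i : ℕ) : ℕ) : ℝ) =
          (2 : ℝ) ^ (n + 1) - 2 ^ (i : ℕ) := by
        intro i
        rw [Nat.cast_sub (Nat.pow_le_pow_right (by norm_num) i.2.le)]
        push_cast
        rfl
      rw [Nat.cast_mul, Nat.cast_prod, Nat.cast_prod, Finset.prod_congr rfl fun i _ => h4 i, h2]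
      push_cast
      have hpos : (0 : ℝ) < ∏ _i : Fin (n + 1), (2 : ℝ) ^ (n + 1) :=
        Finset.prod_pos fun _ _ => by positivity
      have h5 : (1 / 4 : ℝ) ≤ ∏ i ∈ Finset.range (n + 1), (1 - (1 / 2 : ℝ) ^ (i + 1)) :=
        le_trans (by linarith [show (0 : ℝ) < (1 / 2) ^ (n + 2) by positivity]) h1
      nlinarith
    exact_mod_cast h3
  have h := Finset.card_filter_add_card_filter_not (s := Finset.univ)
    (fun A : Matrix (Fin r) (Fin r) (ZMod 2) => IsUnit A)
  rw [Finset.card_univ, hunits] at h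
  have h' : (Finset.univ.filter fun A : Matrix (Fin r) (Fin r) (ZMod 2) => ¬ IsUnit A).card +
      ∏ i : Fin r, (2 ^ r - 2 ^ (i : ℕ)) = Fintype.card (Matrix (Fin r) (Fin r) (ZMod 2)) := by
    rw [← h, add_comm]
  omega

end Covering

section UnitTensors

/-- Three invertible matrices whose span meets more than half of all translates of the set of
invertible matrices. -/
theorem exists_three_isUnit_covering {r : ℕ} (hr : 1 ≤ r)
    (hsum : ∀ B : Matrix (Fin r) (Fin r) (ZMod 2), ∃ A A', IsUnit A ∧ IsUnit A' ∧ B = A + A') :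
    ∃ (c : Fin 3 → Matrix (Fin r) (Fin r) (ZMod 2))
      (U : Finset (Matrix (Fin r) (Fin r) (ZMod 2))), (∀ j, IsUnit (c j)) ∧
      2 * U.card < Fintype.card (Matrix (Fin r) (Fin r) (ZMod 2)) ∧
      ∀ v, v ∉ U → ∃ a : Fin 3 → ZMod 2, IsUnit (v + ∑ j, a j • c j) := by
  classical
  set N := Fintype.card (Matrix (Fin r) (Fin r) (ZMod 2)) with hN
  have hNpos : 0 < N := Fintype.card_pos
  obtain ⟨U₀, hU₀⟩ : ∃ U₀ : Finset (Matrix (Fin r) (Fin r) (ZMod 2)),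
      U₀ = Finset.univ.filter fun A : Matrix (Fin r) (Fin r) (ZMod 2) => ¬ IsUnit A := ⟨_, rfl⟩
  have h0 : 4 * U₀.card ≤ 3 * N := by
    rw [hU₀]
    exact card_filter_not_isUnit_le hr
  obtain ⟨c₁, hc₁, h1⟩ := exists_isUnit_card_filter_add_mem_le hsum U₀
  obtain ⟨U₁, hU₁⟩ : ∃ U₁, U₁ = U₀.filter fun v => v + c₁ ∈ U₀ := ⟨_, rfl⟩
  rw [← hU₁, ← hN] at h1
  obtain ⟨c₂, hc₂, h2⟩ := exists_isUnit_card_filter_add_mem_le hsum U₁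
  obtain ⟨U₂, hU₂⟩ : ∃ U₂, U₂ = U₁.filter fun v => v + c₂ ∈ U₁ := ⟨_, rfl⟩
  rw [← hU₂, ← hN] at h2
  obtain ⟨c₃, hc₃, h3⟩ := exists_isUnit_card_filter_add_mem_le hsum U₂
  obtain ⟨U₃, hU₃⟩ : ∃ U₃, U₃ = U₂.filter fun v => v + c₃ ∈ U₂ := ⟨_, rfl⟩
  rw [← hU₃, ← hN] at h3
  refine ⟨![c₁, c₂, c₃], U₃, ?_, ?_, ?_⟩
  · intro j
    fin_cases j
    · exact hc₁
    · exact hc₂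
    · exact hc₃
  · -- the density bound `u ↦ u (1 + u) / 2`, applied three times to `3 / 4`
    have k1 : 32 * U₁.card ≤ 21 * N := by
      have : 2 * N * (32 * U₁.card) ≤ 2 * N * (21 * N) := by nlinarith
      exact Nat.le_of_mul_le_mul_left this (by positivity)
    have k2 : 9 * U₂.card ≤ 5 * N := by
      have : 2 * N * (9 * U₂.card) ≤ 2 * N * (5 * N) := by nlinarith
      exact Nat.le_of_mul_le_mul_left this (by positivity)
    have : 2 * N * (9 * U₃.card) ≤ 2 * N * (4 * N) := by nlinarith
    have := Nat.le_of_mul_le_mul_left this (by positivity)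
    omega
  · have step0 : ∀ v, v ∉ U₀ → IsUnit v := by
      intro v hv
      rw [hU₀] at hv
      simpa using hv
    have step1 : ∀ v, v ∉ U₁ → ∃ a : ZMod 2, IsUnit (v + a • c₁) := by
      intro v hv
      rw [hU₁, Finset.mem_filter, not_and_or] at hv
      rcases hv with hv | hv
      · exact ⟨0, by simpa using step0 v hv⟩
      · exact ⟨1, by simpa using step0 _ hv⟩
    have step2 : ∀ v, v ∉ U₂ → ∃ a a' : ZMod 2, IsUnit (v + a' • c₂ + a • c₁) := by
      intro v hv
      rw [hU₂, Finset.mem_filter, not_and_or] at hv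
      rcases hv with hv | hv
      · obtain ⟨a, ha⟩ := step1 v hv
        exact ⟨a, 0, by simpa using ha⟩
      · obtain ⟨a, ha⟩ := step1 _ hv
        exact ⟨a, 1, by simpa using ha⟩
    have step3 : ∀ v, v ∉ U₃ → ∃ a a' a'' : ZMod 2,
        IsUnit (v + a'' • c₃ + a' • c₂ + a • c₁) := by
      intro v hv
      rw [hU₃, Finset.mem_filter, not_and_or] at hv
      rcases hv with hv | hv
      · obtain ⟨a, a', ha⟩ := step2 v hv
        exact ⟨a, a', 0, by simpa using ha⟩
      · obtain ⟨a, a', ha⟩ := step2 _ hv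
        exact ⟨a, a', 1, by simpa using ha⟩
    intro v hv
    obtain ⟨a, a', a'', ha⟩ := step3 v hv
    refine ⟨![a, a', a''], ?_⟩
    rw [Fin.sum_univ_three]
    convert ha using 1
    simp only [Matrix.cons_val_zero, Matrix.cons_val_one, Matrix.cons_val]
    abel

theorem span_eq_top_of_card_lt {r : ℕ} (Γ : Finset (Fin r → ZMod 2))
    (h : 2 ^ r < 2 * Γ.card) : Submodule.span (ZMod 2) (Γ : Set (Fin r → ZMod 2)) = ⊤ := by
  by_contra hne
  obtain ⟨v, hv⟩ : ∃ v, v ∉ Submodule.span (ZMod 2) (Γ : Set (Fin r → ZMod 2)) := by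
    by_contra hcon
    push Not at hcon
    exact hne (eq_top_iff.2 fun v _ => hcon v)
  classical
  have hdisj : Disjoint Γ (Γ.image fun w => w + v) := by
    rw [Finset.disjoint_left]
    intro w hw hw'
    obtain ⟨w', hw₂, rfl⟩ := Finset.mem_image.1 hw'
    apply hv
    have := Submodule.sub_mem _ (Submodule.subset_span (R := ZMod 2) hw)
      (Submodule.subset_span (R := ZMod 2) hw₂)
    rwa [add_sub_cancel_left] at this
  have h1 := Finset.card_le_univ (Γ ∪ Γ.image fun w => w + v)
  rw [Finset.card_union_of_disjoint hdisj,
    Finset.card_image_of_injective _ (add_left_injective v)] at h1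
  simp at h1
  omega

/-- Four invertible matrices such that `T e` can be shifted by their span to an invertible
matrix for enough vectors `e` to span the domain of `T`. -/
theorem exists_four_isUnit_shifts {r : ℕ} (hr : 1 ≤ r)
    (hsum : ∀ B : Matrix (Fin r) (Fin r) (ZMod 2), ∃ A A', IsUnit A ∧ IsUnit A' ∧ B = A + A')
    (T : (Fin r → ZMod 2) →ₗ[ZMod 2] Matrix (Fin r) (Fin r) (ZMod 2)) :
    ∃ X : Fin 4 → Matrix (Fin r) (Fin r) (ZMod 2), (∀ j, IsUnit (X j)) ∧
      Submodule.span (ZMod 2)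
        {e | ∃ a : Fin 4 → ZMod 2, IsUnit (T e + ∑ j, a j • X j)} = ⊤ := by
  classical
  obtain ⟨c, U, hc, hU, hcov⟩ := exists_three_isUnit_covering hr hsum
  -- a translation `Y` that is at least as good as the average
  obtain ⟨Y, hY⟩ : ∃ Y, 2 * (Finset.univ.filter fun e => T e + Y ∈ U).card < 2 ^ r := by
    by_contra hcon
    push Not at hcon
    have h1 : ∑ Y, (Finset.univ.filter fun e => T e + Y ∈ U).card = 2 ^ r * U.card := by
      simp_rw [Finset.card_filter]
      rw [Finset.sum_comm]
      have : ∀ e ∈ (Finset.univ : Finset (Fin r → ZMod 2)),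
          (∑ Y, if T e + Y ∈ U then 1 else 0) = U.card := by
        intro e _
        have := Equiv.sum_comp (Equiv.addLeft (T e)) fun x => if x ∈ U then (1 : ℕ) else 0
        exact this.trans (by simp)
      rw [Finset.sum_congr rfl this]
      simp
    have h2 := Finset.sum_le_sum fun Y (_ : Y ∈ Finset.univ) => hcon Y
    rw [← Finset.mul_sum, h1, Finset.sum_const, Finset.card_univ, smul_eq_mul] at h2
    have h3 : 0 < 2 ^ r := by positivity
    nlinarith
  have hcompl := Finset.card_filter_add_card_filter_not (s := Finset.univ)
    (fun e : Fin r → ZMod 2 => T e + Y ∈ U)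
  rw [Finset.card_univ] at hcompl
  have hpow : Fintype.card (Fin r → ZMod 2) = 2 ^ r := by simp
  set Γ := Finset.univ.filter fun e : Fin r → ZMod 2 => T e + Y ∉ U with hΓ
  have hΓcard : 2 ^ r < 2 * Γ.card := by omega
  obtain ⟨e₀, he₀⟩ : Γ.Nonempty := Finset.card_pos.1 (by omega)
  obtain ⟨a₀, ha₀⟩ := hcov _ (Finset.mem_filter.1 he₀).2
  -- moving the origin to a good vector makes the translation itself invertible
  refine ⟨Fin.cons (T e₀ + Y + ∑ j, a₀ j • c j) c, ?_, ?_⟩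
  · intro j
    refine Fin.cases ?_ (fun j => ?_) j
    · simpa using ha₀
    · simpa using hc j
  · rw [eq_top_iff, ← span_eq_top_of_card_lt (Γ.image fun w => w + e₀) (by
      rwa [Finset.card_image_of_injective _ (add_left_injective e₀)])]
    apply Submodule.span_mono
    intro e he
    obtain ⟨e₁, he₁, rfl⟩ := Finset.mem_image.1 (Finset.mem_coe.1 he)
    obtain ⟨a, ha⟩ := hcov _ (Finset.mem_filter.1 he₁).2
    refine ⟨Fin.cons 1 (a + a₀), ?_⟩
    rw [Fin.sum_univ_succ]
    simp only [Fin.cons_zero, Fin.cons_succ, one_smul, Pi.add_apply, add_smul,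
      Finset.sum_add_distrib, map_add]
    convert ha using 1
    have h1 := add_self_of_zmod_two (T e₀)
    have h2 := add_self_of_zmod_two (∑ j, a₀ j • c j)
    calc T e₁ + T e₀ + (T e₀ + Y + ∑ j, a₀ j • c j +
          (∑ j, a j • c j + ∑ j, a₀ j • c j))
        = T e₁ + Y + ∑ j, a j • c j + (T e₀ + T e₀) +
          (∑ j, a₀ j • c j + ∑ j, a₀ j • c j) := by abel
      _ = _ := by rw [h1, h2, add_zero, add_zero]

variable {r : ℕ} {K : Type} [Field K] [Algebra (ZMod 2) K]
  (φ : K →ₐ[ZMod 2] Matrix (Fin r) (Fin r) (ZMod 2))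

theorem isSumOfAtMost_outer_map {A : Matrix (Fin r) (Fin r) (ZMod 2)} (hA : IsUnit A) (z : K) :
    IsSumOfAtMost (unitTensors r) 1 (outer r A (φ z)) := by
  by_cases hz : z = 0
  · rw [hz, map_zero, map_zero]
    exact IsSumOfAtMost.zero _ _
  · exact IsSumOfAtMost.of_mem ⟨A, φ z, hA, isUnit_map_of_ne_zero φ hz, rfl⟩

/-- A tensor whose right-hand factors lie in the field, where invertibility is automatic: by a
change of basis and four shifts its left-hand factors become invertible too. -/
theorem isSumOfAtMost_sum_outer_map [Fintype K] (hK : Fintype.card K = 2 ^ r) (hr : 2 ≤ r)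
    (C : Fin r → Matrix (Fin r) (Fin r) (ZMod 2)) (z : Fin r → K) :
    IsSumOfAtMost (unitTensors r) (r + 4) (∑ l, outer r (C l) (φ (z l))) := by
  classical
  obtain ⟨X, hX, hspan⟩ := exists_four_isUnit_shifts (by omega)
    (exists_eq_add_isUnit φ hK hr) (Fintype.linearCombination (ZMod 2) C)
  set T := Fintype.linearCombination (ZMod 2) C with hT
  set Γ := {e | ∃ a : Fin 4 → ZMod 2, IsUnit (T e + ∑ j, a j • X j)} with hΓ
  obtain ⟨t, ht, hbt, hli⟩ := exists_linearIndependent (ZMod 2) Γ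
  let P₀ : Module.Basis t (ZMod 2) (Fin r → ZMod 2) :=
    Module.Basis.mk hli (by rw [Subtype.range_coe, hbt, hspan])
  let P : Module.Basis (Fin r) (ZMod 2) (Fin r → ZMod 2) :=
    P₀.reindex (P₀.indexEquiv (Pi.basisFun (ZMod 2) (Fin r)))
  have hP : ∀ m, P m ∈ Γ := by
    intro m
    apply ht
    simp [P, P₀]
  choose a ha using hP
  have hC : ∀ l, C l = ∑ m, P.repr (Pi.single l 1) m • T (P m) := by
    intro l
    have h := congrArg T (P.sum_repr (Pi.single l 1))
    rw [hT, Fintype.linearCombination_apply_single, one_smul, ← hT, map_sum] at h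
    simpa only [map_smul] using h.symm
  let z' : Fin r → K := fun m => ∑ l, P.repr (Pi.single l 1) m • z l
  have key : ∑ l, outer r (C l) (φ (z l)) =
      ∑ m, outer r (T (P m) + ∑ j, a m j • X j) (φ (z' m)) +
        ∑ j, outer r (X j) (φ (∑ m, a m j • z' m)) := by
    have h1 : ∑ l, outer r (C l) (φ (z l)) = ∑ m, outer r (T (P m)) (φ (z' m)) := by
      simp only [z', map_sum, map_smul]
      rw [Finset.sum_comm]
      apply Finset.sum_congr rfl
      intro l _
      conv_lhs => rw [hC l]
      simp only [map_sum, map_smul, LinearMap.sum_apply, LinearMap.smul_apply]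
    have h2 : ∑ j, outer r (X j) (φ (∑ m, a m j • z' m)) =
        ∑ m, outer r (∑ j, a m j • X j) (φ (z' m)) := by
      simp only [map_sum, map_smul, LinearMap.sum_apply, LinearMap.smul_apply]
      rw [Finset.sum_comm]
    rw [h1, h2, ← Finset.sum_add_distrib]
    apply Finset.sum_congr rfl
    intro m _
    rw [map_add, LinearMap.add_apply, add_add_cancel_zmod_two]
  rw [key]
  have h1 := IsSumOfAtMost.sum_univ_const fun m =>
    isSumOfAtMost_outer_map φ (ha m) (z' m)
  have h2 := IsSumOfAtMost.sum_univ_const fun j =>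
    isSumOfAtMost_outer_map φ (hX j) (∑ m, a m j • z' m)
  simpa using h1.add h2

/-- Every tensor is `∑ A i ⊗ B i` with the `A i` an invertible basis. Shifting each `B i` by a
field element to an invertible matrix leaves a tensor with right-hand factors in the field. -/
theorem isSumOfAtMost_unitTensors [Fintype K]
    (φ : K →ₐ[ZMod 2] Matrix (Fin r) (Fin r) (ZMod 2)) (hK : Fintype.card K = 2 ^ r) (hr : 2 ≤ r)
    (W : Matrix (Fin r × Fin r) (Fin r × Fin r) (ZMod 2)) :
    IsSumOfAtMost (unitTensors r) (r ^ 2 + r + 4) W := by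
  classical
  have hspan : Submodule.span (ZMod 2)
      {A : Matrix (Fin r) (Fin r) (ZMod 2) | IsUnit A} = ⊤ := by
    rw [eq_top_iff]
    intro B _
    obtain ⟨A, A', hA, hA', rfl⟩ := exists_eq_add_isUnit φ hK hr B
    exact Submodule.add_mem _ (Submodule.subset_span hA) (Submodule.subset_span hA')
  obtain ⟨t, ht, hbt, hli⟩ := exists_linearIndependent (ZMod 2)
    {A : Matrix (Fin r) (Fin r) (ZMod 2) | IsUnit A}
  let P₀ : Module.Basis t (ZMod 2) (Matrix (Fin r) (Fin r) (ZMod 2)) :=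
    Module.Basis.mk hli (by rw [Subtype.range_coe, hbt, hspan])
  let P : Module.Basis (Fin r × Fin r) (ZMod 2) (Matrix (Fin r) (Fin r) (ZMod 2)) :=
    P₀.reindex (P₀.indexEquiv (Matrix.stdBasis (ZMod 2) (Fin r) (Fin r)))
  have hP : ∀ m, IsUnit (P m) := by
    intro m
    apply ht
    simp [P, P₀]
  obtain ⟨B, hB⟩ : ∃ B : Fin r × Fin r → Matrix (Fin r) (Fin r) (ZMod 2),
      W = ∑ m, outer r (P m) (B m) := by
    let R : Fin r × Fin r → Matrix (Fin r) (Fin r) (ZMod 2) :=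
      fun p => Matrix.of fun i j => W p (i, j)
    have h1 : W = ∑ p : Fin r × Fin r, outer r (Matrix.single p.1 p.2 1) (R p) := by
      ext p q
      rw [Matrix.sum_apply, Finset.sum_eq_single p]
      · simp [R]
      · intro p' _ hne
        have : ¬ (p'.1 = p.1 ∧ p'.2 = p.2) := fun h => hne (Prod.ext h.1 h.2)
        simp [Matrix.single_apply_of_ne (h := this)]
      · simp
    refine ⟨fun m => ∑ p : Fin r × Fin r, P.repr (Matrix.single p.1 p.2 1) m • R p, ?_⟩
    simp only [map_sum, map_smul]
    rw [Finset.sum_comm, h1]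
    apply Finset.sum_congr rfl
    intro p _
    have h := congrArg (fun A => outer r A (R p)) (P.sum_repr (Matrix.single p.1 p.2 1))
    simpa only [map_sum, map_smul, LinearMap.sum_apply, LinearMap.smul_apply] using h.symm
  choose y hy using fun m => exists_isUnit_add_map φ hK (B m)
  let k : Module.Basis (Fin r) (ZMod 2) K := Module.finBasisOfFinrankEq (ZMod 2) K (by
    have h := Module.card_eq_pow_finrank (K := ZMod 2) (V := K)
    rw [hK, ZMod.card] at h
    exact (Nat.pow_right_injective le_rfl h).symm)
  have key : W = ∑ m, outer r (P m) (B m + φ (y m)) +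
      ∑ l, outer r (∑ m, k.repr (y m) l • P m) (φ (k l)) := by
    have h1 : ∑ l, outer r (∑ m, k.repr (y m) l • P m) (φ (k l)) =
        ∑ m, outer r (P m) (φ (y m)) := by
      simp only [map_sum, map_smul, LinearMap.sum_apply, LinearMap.smul_apply]
      rw [Finset.sum_comm]
      apply Finset.sum_congr rfl
      intro m _
      have h := congrArg (fun x => outer r (P m) (φ x)) (k.sum_repr (y m))
      simpa only [map_sum, map_smul] using h
    rw [h1, hB, ← Finset.sum_add_distrib]
    apply Finset.sum_congr rfl
    intro m _
    rw [map_add, add_add_cancel_zmod_two]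
  rw [key]
  have h1 := IsSumOfAtMost.sum_univ_const (S := unitTensors r) (k := 1) fun m =>
    IsSumOfAtMost.of_mem ⟨P m, B m + φ (y m), hP m, hy m, rfl⟩
  have h2 := isSumOfAtMost_sum_outer_map φ hK hr
    (fun l => ∑ m, k.repr (y m) l • P m) (fun l => k l)
  refine (h1.add h2).mono (le_of_eq ?_)
  simp
  ring

end UnitTensors

/-! ### Sums of squares of invertible matrices -/

section SymmetricSquares

open Matrix

/-- A symmetric matrix over `𝔽₂` supported on `s`, plus a further square, is a sum of `|s| + 1`
squares. A nonzero diagonal entry splits off one square; in the alternating case a hyperbolic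
pair is absorbed by `a² + (x y + y x) = (a + x)² + (a + y)² + (a + x + y)²`. -/
theorem isSumOfAtMost_vecMulVec_add_of_isSymm {ι : Type} [Fintype ι] [DecidableEq ι] (n : ℕ) :
    ∀ (s : Finset ι) (W : Matrix ι ι (ZMod 2)) (a : ι → ZMod 2), s.card = n → W.IsSymm →
      (∀ p q, W p q ≠ 0 → p ∈ s) →
      IsSumOfAtMost {X | ∃ v : ι → ZMod 2, vecMulVec v v = X} (n + 1) (vecMulVec a a + W) := by
  induction n using Nat.strong_induction_on with
  | _ n ih =>
    intro s W a hs hW hsupp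
    have hsq : ∀ v : ι → ZMod 2, IsSumOfAtMost {X | ∃ v : ι → ZMod 2, vecMulVec v v = X} 1
        (vecMulVec v v) := fun v => IsSumOfAtMost.of_mem ⟨v, rfl⟩
    have hsymm : ∀ p q, W q p = W p q := fun p q => hW.apply p q
    by_cases hdiag : ∃ p, W p p ≠ 0
    · obtain ⟨p, hp⟩ := hdiag
      have hp1 : W p p = 1 := (zmod_two_cases _).resolve_left hp
      have hps : p ∈ s := hsupp p p hp
      have hcard : (s.erase p).card = n - 1 := by rw [Finset.card_erase_of_mem hps, hs]
      have hn : 1 ≤ n := by rw [← hs]; exact Finset.card_pos.2 ⟨p, hps⟩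
      have h1 := ih (n - 1) (by omega) (s.erase p) (W + vecMulVec (W p) (W p)) (W p) hcard
        (by
          ext i j
          simp only [Matrix.transpose_apply, Matrix.add_apply, vecMulVec_apply, hsymm i j]
          ring)
        (by
          intro i j hij
          rw [Finset.mem_erase]
          constructor
          · rintro rfl
            apply hij
            rw [Matrix.add_apply, vecMulVec_apply, hp1, one_mul]
            exact add_self_of_zmod_two _
          · by_contra hi
            apply hij
            have h2 : ∀ j, W i j = 0 := fun j => by
              by_contra h
              exact hi (hsupp i j h)
            rw [Matrix.add_apply, vecMulVec_apply, h2 j, ← hsymm, h2]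
            simp)
      have h2 : vecMulVec (W p) (W p) + (W + vecMulVec (W p) (W p)) = W := by
        rw [add_comm, add_add_cancel_zmod_two]
      rw [h2, Nat.sub_add_cancel hn] at h1
      rw [add_comm n]
      exact (hsq a).add h1
    · push Not at hdiag
      by_cases hoff : ∃ p q, W p q ≠ 0
      · obtain ⟨p, q, hpq⟩ := hoff
        have hpq1 : W p q = 1 := (zmod_two_cases _).resolve_left hpq
        have hqp1 : W q p = 1 := by rw [hsymm, hpq1]
        have hne : p ≠ q := by
          rintro rfl
          exact hpq (hdiag p)
        have hps : p ∈ s := hsupp p q hpq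
        have hqs : q ∈ s := hsupp q p (by rw [hqp1]; exact one_ne_zero)
        have hqs' : q ∈ s.erase p := Finset.mem_erase.2 ⟨hne.symm, hqs⟩
        have hcard : ((s.erase p).erase q).card = n - 2 := by
          rw [Finset.card_erase_of_mem hqs', Finset.card_erase_of_mem hps, hs]
          omega
        have hn : 2 ≤ n := by
          rw [← hs]
          exact Finset.one_lt_card.2 ⟨p, hps, q, hqs, hne⟩
        have h1 := ih (n - 2) (by omega) ((s.erase p).erase q)
          (W + (vecMulVec (W p) (W q) + vecMulVec (W q) (W p))) (a + W p + W q) hcard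
          (by
            ext i j
            simp only [Matrix.transpose_apply, Matrix.add_apply, vecMulVec_apply, hsymm i j]
            ring)
          (by
            intro i j hij
            rw [Finset.mem_erase, Finset.mem_erase]
            refine ⟨?_, ?_, ?_⟩
            · rintro rfl
              apply hij
              simp only [Matrix.add_apply, vecMulVec_apply, hpq1, hdiag, one_mul, zero_mul,
                add_zero]
              exact add_self_of_zmod_two _
            · rintro rfl
              apply hij
              simp only [Matrix.add_apply, vecMulVec_apply, hqp1, hdiag, one_mul, zero_mul,
                zero_add]
              exact add_self_of_zmod_two _
            · by_contra hi
              apply hij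
              have h2 : ∀ j, W i j = 0 := fun j => by
                by_contra h
                exact hi (hsupp i j h)
              simp only [Matrix.add_apply, vecMulVec_apply]
              have e₁ : W p i = 0 := (hsymm i p).trans (h2 p)
              have e₂ : W q i = 0 := (hsymm i q).trans (h2 q)
              simp [h2 j, e₁, e₂])
        have h2 : vecMulVec a a + W = vecMulVec (a + W p) (a + W p) +
            vecMulVec (a + W q) (a + W q) + (vecMulVec (a + W p + W q) (a + W p + W q) +
              (W + (vecMulVec (W p) (W q) + vecMulVec (W q) (W p)))) := by
          ext i j
          simp only [Matrix.add_apply, vecMulVec_apply, Pi.add_apply]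
          generalize a i = a₁, a j = a₂, W p i = b₁, W p j = b₂, W q i = c₁, W q j = c₂,
            W i j = d
          revert a₁ a₂ b₁ b₂ c₁ c₂ d
          decide
        rw [h2]
        refine (((hsq (a + W p)).add
          (hsq (a + W q))).add h1).mono ?_
        omega
      · push Not at hoff
        have h0 : W = 0 := by
          ext p q
          exact hoff p q
        rw [h0, add_zero]
        exact (hsq a).mono (by omega)

theorem isSumOfAtMost_vecMulVec_of_isSymm {ι : Type} [Fintype ι] [DecidableEq ι]
    {W : Matrix ι ι (ZMod 2)} (hW : W.IsSymm) :
    IsSumOfAtMost {X | ∃ v : ι → ZMod 2, vecMulVec v v = X} (Fintype.card ι + 1) W := by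
  have h := isSumOfAtMost_vecMulVec_add_of_isSymm _ Finset.univ W 0 rfl hW fun p _ _ =>
    Finset.mem_univ p
  rwa [vecMulVec_zero, zero_add, Finset.card_univ] at h

/-- The squares `N ⊗ N` of invertible matrices. -/
def unitSquares (r : ℕ) : Set (Matrix (Fin r × Fin r) (Fin r × Fin r) (ZMod 2)) :=
  {W | ∃ N, IsUnit N ∧ outer r N N = W}

/-- The symmetric product `A ⊗ B + B ⊗ A`. -/
def symOuter {r : ℕ} (A B : Matrix (Fin r) (Fin r) (ZMod 2)) :
    Matrix (Fin r × Fin r) (Fin r × Fin r) (ZMod 2) :=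
  outer r A B + outer r B A

theorem symOuter_add_left {r : ℕ} (A A' B : Matrix (Fin r) (Fin r) (ZMod 2)) :
    symOuter (A + A') B = symOuter A B + symOuter A' B := by
  simp only [symOuter, map_add, LinearMap.add_apply]
  abel

theorem outer_add_self {r : ℕ} (A B : Matrix (Fin r) (Fin r) (ZMod 2)) :
    outer r (A + B) (A + B) = outer r A A + outer r B B + symOuter A B := by
  simp only [symOuter, map_add, LinearMap.add_apply]
  abel

theorem symOuter_eq {r : ℕ} (A B : Matrix (Fin r) (Fin r) (ZMod 2)) :
    symOuter A B = outer r (A + B) (A + B) + outer r A A + outer r B B := by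
  rw [outer_add_self]
  have h1 := add_self_of_zmod_two (outer r A A)
  have h2 := add_self_of_zmod_two (outer r B B)
  calc symOuter A B = (outer r A A + outer r A A) + (outer r B B + outer r B B) +
        symOuter A B := by rw [h1, h2, zero_add, zero_add]
    _ = _ := by abel

variable {r : ℕ} {K : Type} [Field K] [Algebra (ZMod 2) K]
  (φ : K →ₐ[ZMod 2] Matrix (Fin r) (Fin r) (ZMod 2))

/-- The symmetric tensors spanned by the squares of field elements. -/
def fieldSquares : AddSubmonoid (Matrix (Fin r × Fin r) (Fin r × Fin r) (ZMod 2)) :=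
  AddSubmonoid.closure {W | ∃ z : K, outer r (φ z) (φ z) = W}

theorem outer_map_mem_fieldSquares (z : K) : outer r (φ z) (φ z) ∈ fieldSquares φ :=
  AddSubmonoid.subset_closure ⟨z, rfl⟩

theorem symOuter_map_mem_fieldSquares (z z' : K) :
    symOuter (φ z) (φ z') ∈ fieldSquares φ := by
  rw [symOuter_eq, ← map_add]
  exact add_mem (add_mem (outer_map_mem_fieldSquares φ _) (outer_map_mem_fieldSquares φ _))
    (outer_map_mem_fieldSquares φ _)

/-- Any sum of squares of field elements is a sum of `r + 1` of them, since the field has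
dimension `r`. -/
theorem isSumOfAtMost_of_mem_fieldSquares [Fintype K] (hK : Fintype.card K = 2 ^ r)
    {W : Matrix (Fin r × Fin r) (Fin r × Fin r) (ZMod 2)} (hW : W ∈ fieldSquares φ) :
    IsSumOfAtMost (unitSquares r) (r + 1) W := by
  classical
  let k : Module.Basis (Fin r) (ZMod 2) K := Module.finBasisOfFinrankEq (ZMod 2) K (by
    have h := Module.card_eq_pow_finrank (K := ZMod 2) (V := K)
    rw [hK, ZMod.card] at h
    exact (Nat.pow_right_injective le_rfl h).symm)
  let Φ : Matrix (Fin r) (Fin r) (ZMod 2) →+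
      Matrix (Fin r × Fin r) (Fin r × Fin r) (ZMod 2) :=
    { toFun := fun σ => ∑ l, ∑ m, σ l m • outer r (φ (k l)) (φ (k m))
      map_zero' := by simp
      map_add' := by
        intro σ σ'
        simp only [Matrix.add_apply, add_smul, Finset.sum_add_distrib] }
  have hΦ : ∀ v : Fin r → ZMod 2, Φ (vecMulVec v v) =
      outer r (φ (∑ l, v l • k l)) (φ (∑ l, v l • k l)) := by
    intro v
    simp only [Φ, AddMonoidHom.coe_mk, ZeroHom.coe_mk, vecMulVec_apply, map_sum, map_smul,
      LinearMap.sum_apply, LinearMap.smul_apply, Finset.smul_sum, smul_smul]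
    rw [Finset.sum_comm]
    apply Finset.sum_congr rfl
    intro l _
    apply Finset.sum_congr rfl
    intro m _
    rw [mul_comm]
  obtain ⟨σ, hσ, rfl⟩ : ∃ σ : Matrix (Fin r) (Fin r) (ZMod 2), σ.IsSymm ∧ Φ σ = W := by
    induction hW using AddSubmonoid.closure_induction with
    | mem x hx =>
      obtain ⟨z, rfl⟩ := hx
      refine ⟨vecMulVec (k.repr z) (k.repr z), ?_, ?_⟩
      · ext i j
        simp [vecMulVec_apply, mul_comm]
      · rw [hΦ, k.sum_repr]
    | zero => exact ⟨0, Matrix.isSymm_zero, map_zero _⟩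
    | add x y _ _ hx hy =>
      obtain ⟨σ, h1, rfl⟩ := hx
      obtain ⟨σ', h2, rfl⟩ := hy
      exact ⟨σ + σ', h1.add h2, map_add _ _ _⟩
  obtain ⟨l, h1, h2, rfl⟩ := isSumOfAtMost_vecMulVec_of_isSymm hσ
  rw [Fintype.card_fin] at h1
  rw [map_list_sum]
  refine IsSumOfAtMost.mono ?_ h1
  clear h1 hσ hW
  induction l with
  | nil => exact IsSumOfAtMost.zero _ _
  | cons x l ih =>
    obtain ⟨v, rfl⟩ := h2 x (by simp)
    rw [List.map_cons, List.sum_cons, List.length_cons, add_comm l.length]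
    refine IsSumOfAtMost.add ?_ (ih fun a ha => h2 a (by simp [ha]))
    rw [hΦ]
    by_cases hz : ∑ l, v l • k l = 0
    · rw [hz, map_zero, map_zero]
      exact IsSumOfAtMost.zero _ _
    · exact IsSumOfAtMost.of_mem ⟨_, isUnit_map_of_ne_zero φ hz, rfl⟩

end SymmetricSquares

/-! ### Rank-one corrections of pairs `{N, N + 1}` -/

section RankOne

open Matrix

variable {r : ℕ}

theorem exists_dotProduct_of_notMem {p : Submodule (ZMod 2) (Fin r → ZMod 2)}
    {v : Fin r → ZMod 2} (hv : v ∉ p) :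
    ∃ w : Fin r → ZMod 2, w ⬝ᵥ v = 1 ∧ ∀ x ∈ p, w ⬝ᵥ x = 0 := by
  obtain ⟨f, hf, hp⟩ := Submodule.exists_le_ker_of_notMem hv
  have hrep : ∀ x, (fun i => f (Pi.single i 1)) ⬝ᵥ x = f x := by
    intro x
    conv_rhs => rw [LinearMap.pi_apply_eq_sum_univ f x]
    simp only [dotProduct, smul_eq_mul, mul_comm]
    apply Finset.sum_congr rfl
    intro i _
    congr 2
    ext j
    simp [Pi.single_apply, eq_comm]
  refine ⟨fun i => f (Pi.single i 1), ?_, ?_⟩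
  · rw [hrep]
    exact (zmod_two_cases _).resolve_left hf
  · intro x hx
    rw [hrep]
    exact hp hx

theorem vecMulVec_mulVec_eq (u w x : Fin r → ZMod 2) :
    vecMulVec u w *ᵥ x = (w ⬝ᵥ x) • u := by
  rw [Matrix.vecMulVec_mulVec]
  ext i
  simp [mul_comm]

theorem isUnit_add_vecMulVec_of_isUnit {N : Matrix (Fin r) (Fin r) (ZMod 2)} (hN : IsUnit N)
    {u w γ : Fin r → ZMod 2} (hγ : N *ᵥ γ = u) (hw : w ⬝ᵥ γ = 0) :
    IsUnit (N + vecMulVec u w) := by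
  rw [isUnit_iff_forall_mulVec] at hN ⊢
  intro x hx
  rw [Matrix.add_mulVec, vecMulVec_mulVec_eq, ← hγ, ← Matrix.mulVec_smul,
    ← Matrix.mulVec_add] at hx
  have h1 := eq_of_add_eq_zero_zmod_two (hN _ hx)
  have h2 : w ⬝ᵥ x = 0 := by rw [h1, dotProduct_smul, hw, smul_zero]
  rwa [h2, zero_smul] at h1

/-- A rank-one correction of a matrix of corank one is invertible if it is nonzero on the right
kernel `β` and has its image outside the image of `N`, the annihilator of the left kernel `α`. -/
theorem isUnit_add_vecMulVec_of_corank_one {N : Matrix (Fin r) (Fin r) (ZMod 2)}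
    {α β u w : Fin r → ZMod 2} (hα : α ᵥ* N = 0) (hβ : ∀ v, v ≠ 0 → N *ᵥ v = 0 → v = β)
    (hu : α ⬝ᵥ u = 1) (hw : w ⬝ᵥ β = 1) : IsUnit (N + vecMulVec u w) := by
  rw [isUnit_iff_forall_mulVec]
  intro x hx
  rw [Matrix.add_mulVec, vecMulVec_mulVec_eq] at hx
  have h1 := congrArg (fun y => α ⬝ᵥ y) hx
  simp only [dotProduct_add, dotProduct_smul, hu, dotProduct_mulVec, hα, zero_dotProduct,
    zero_add, dotProduct_zero, smul_eq_mul, mul_one] at h1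
  rw [h1, zero_smul, add_zero] at hx
  by_contra hx0
  rw [hβ x hx0 hx, hw] at h1
  exact one_ne_zero h1

/-- For singular `N` of corank one: generators of the left and of the right kernel. -/
theorem exists_kernel_generators {N : Matrix (Fin r) (Fin r) (ZMod 2)} (hN : ¬ IsUnit N)
    (h1 : ∀ v w, v ≠ 0 → w ≠ 0 → N *ᵥ v = 0 → N *ᵥ w = 0 → v = w) :
    ∃ α β : Fin r → ZMod 2, α ≠ 0 ∧ α ᵥ* N = 0 ∧ β ≠ 0 ∧ N *ᵥ β = 0 ∧
      ∀ v, v ≠ 0 → N *ᵥ v = 0 → v = β := by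
  obtain ⟨β, hβ0, hβ⟩ := exists_mulVec_eq_zero_of_not_isUnit hN
  have hdet : N.det = 0 := Matrix.exists_mulVec_eq_zero_iff.1 ⟨β, hβ0, hβ⟩
  obtain ⟨α, hα0, hα⟩ := Matrix.exists_vecMul_eq_zero_iff.2 hdet
  exact ⟨α, β, hα0, hα, hβ0, hβ, fun v hv hNv => h1 v β hv hβ0 hNv hβ⟩

theorem exists_dotProduct_eq_one_ne (hr : 2 ≤ r) {α : Fin r → ZMod 2} (hα : α ≠ 0)
    (s : Fin r → ZMod 2) : ∃ u, α ⬝ᵥ u = 1 ∧ u ≠ s := by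
  obtain ⟨u, hu, -⟩ := exists_dotProduct_of_notMem (p := ⊥) (v := α) (by simpa using hα)
  rw [dotProduct_comm] at hu
  obtain ⟨t, ht0, ht⟩ : ∃ t : Fin r → ZMod 2, t ≠ 0 ∧ α ⬝ᵥ t = 0 := by
    have hne : (⟨0, by omega⟩ : Fin r) ≠ ⟨1, by omega⟩ := by simp
    rcases zmod_two_cases (α ⟨0, by omega⟩) with h0 | h0
    · exact ⟨Pi.single ⟨0, by omega⟩ 1, by simp, by simp [h0]⟩
    rcases zmod_two_cases (α ⟨1, by omega⟩) with h1 | h1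
    · exact ⟨Pi.single ⟨1, by omega⟩ 1, by simp, by simp [h1]⟩
    refine ⟨Pi.single ⟨0, by omega⟩ 1 + Pi.single ⟨1, by omega⟩ 1, ?_, ?_⟩
    · intro h
      have := congrFun h ⟨0, by omega⟩
      simp at this
    · rw [dotProduct_add]
      simp only [dotProduct_single, h0, h1, mul_one]
      rfl
  by_cases h : u = s
  · refine ⟨u + t, by rw [dotProduct_add, hu, ht, add_zero], ?_⟩
    rw [← h]
    simpa using ht0
  · exact ⟨u, hu, h⟩

/-- If `N` and `N + 1` both have corank at most one, then either both are invertible, or adding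
`vecMulVec u w` makes both invertible for a suitable `u` and every `w` that satisfies two linear
conditions. -/
theorem exists_rank_one_correction (hr : 2 ≤ r) (N : Matrix (Fin r) (Fin r) (ZMod 2))
    (h0 : ∀ v w, v ≠ 0 → w ≠ 0 → N *ᵥ v = 0 → N *ᵥ w = 0 → v = w)
    (h1 : ∀ v w, v ≠ 0 → w ≠ 0 → (N + 1) *ᵥ v = 0 → (N + 1) *ᵥ w = 0 → v = w) :
    (IsUnit N ∧ IsUnit (N + 1)) ∨
    ∃ u β δ : Fin r → ZMod 2, u ≠ 0 ∧ β ≠ 0 ∧ β + δ ≠ 0 ∧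
      ∀ w : Fin r → ZMod 2, w ⬝ᵥ β = 1 → w ⬝ᵥ δ = 0 →
        IsUnit (N + vecMulVec u w) ∧ IsUnit (N + 1 + vecMulVec u w) := by
  -- the case of one invertible and one singular matrix, in either order
  have mixed : ∀ N N' : Matrix (Fin r) (Fin r) (ZMod 2), IsUnit N → ¬ IsUnit N' →
      (∀ v w, v ≠ 0 → w ≠ 0 → N' *ᵥ v = 0 → N' *ᵥ w = 0 → v = w) →
      ∃ u β δ : Fin r → ZMod 2, u ≠ 0 ∧ β ≠ 0 ∧ β + δ ≠ 0 ∧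
        ∀ w : Fin r → ZMod 2, w ⬝ᵥ β = 1 → w ⬝ᵥ δ = 0 →
          IsUnit (N + vecMulVec u w) ∧ IsUnit (N' + vecMulVec u w) := by
    intro N N' hN hN' h
    obtain ⟨α, β, hα0, hα, hβ0, hβ, hβ'⟩ := exists_kernel_generators hN' h
    obtain ⟨u, hu, hus⟩ := exists_dotProduct_eq_one_ne hr hα0 (N *ᵥ β)
    obtain ⟨γ, hγ⟩ := (Matrix.mulVec_surjective_iff_isUnit.2 hN) u
    refine ⟨u, β, γ, ?_, hβ0, ?_, ?_⟩
    · rintro rfl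
      simp at hu
    · intro hβγ
      apply hus
      rw [eq_of_add_eq_zero_zmod_two hβγ]
      exact hγ.symm
    · intro w hw hw'
      exact ⟨isUnit_add_vecMulVec_of_isUnit hN hγ hw',
        isUnit_add_vecMulVec_of_corank_one hα hβ' hu hw⟩
  by_cases hN : IsUnit N
  · by_cases hN' : IsUnit (N + 1)
    · exact Or.inl ⟨hN, hN'⟩
    · exact Or.inr (mixed N (N + 1) hN hN' h1)
  · right
    by_cases hN' : IsUnit (N + 1)
    · obtain ⟨u, β, δ, hu, hβ, hδ, h⟩ := mixed (N + 1) N hN' hN h0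
      exact ⟨u, β, δ, hu, hβ, hδ, fun w hw hw' => (h w hw hw').symm⟩
    · obtain ⟨α, β, hα0, hα, hβ0, hβ, hβ'⟩ := exists_kernel_generators hN h0
      obtain ⟨α', β', hα0', hα', hβ0', hβN', hβ''⟩ := exists_kernel_generators hN' h1
      have hαα : α ∉ Submodule.span (ZMod 2) {α + α'} := by
        rw [Submodule.mem_span_singleton]
        rintro ⟨c, hc⟩
        rcases zmod_two_cases c with rfl | rfl
        · rw [zero_smul] at hc
          exact hα0 hc.symm
        · rw [one_smul] at hc
          exact hα0' (by simpa using hc)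
      obtain ⟨u, hu, hu'⟩ := exists_dotProduct_of_notMem hαα
      have hu'' := hu' _ (Submodule.mem_span_singleton_self _)
      rw [dotProduct_add, hu] at hu''
      have hα'u : α' ⬝ᵥ u = 1 := by
        rw [dotProduct_comm]
        exact (eq_of_add_eq_zero_zmod_two hu'').symm
      rw [dotProduct_comm] at hu
      refine ⟨u, β, β + β', ?_, hβ0, ?_, ?_⟩
      · rintro rfl
        simp at hu
      · rwa [← add_assoc, add_self_of_zmod_two, zero_add]
      · intro w hw hw'
        rw [dotProduct_add, hw] at hw'
        exact ⟨isUnit_add_vecMulVec_of_corank_one hα hβ' hu hw,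
          isUnit_add_vecMulVec_of_corank_one hα' hβ'' hα'u
            (eq_of_add_eq_zero_zmod_two hw').symm⟩

variable {K : Type} [Field K] [Algebra (ZMod 2) K]
  (φ : K →ₐ[ZMod 2] Matrix (Fin r) (Fin r) (ZMod 2))

/-- The vectors that `w` has to be orthogonal to for `φ y + vecMulVec u w` and
`φ y + 1 + vecMulVec u w` to be invertible. -/
def inversePlane (u : Fin r → ZMod 2) (y : K) : Submodule (ZMod 2) (Fin r → ZMod 2) :=
  Submodule.span (ZMod 2) {φ y⁻¹ *ᵥ u, φ (y + 1)⁻¹ *ᵥ u}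

/-- `X` is good if some coset member `X + φ y` and its translate by `1` are both invertible. -/
def IsGood (X : Matrix (Fin r) (Fin r) (ZMod 2)) : Prop :=
  ∃ y : K, IsUnit (X + φ y) ∧ IsUnit (X + φ y + 1)

theorem isGood_vecMulVec {u w : Fin r → ZMod 2} {y : K} (hy0 : y ≠ 0) (hy1 : y ≠ 1)
    (hw : ∀ x ∈ inversePlane φ u y, w ⬝ᵥ x = 0) : IsGood φ (vecMulVec u w) := by
  have hmul : ∀ z : K, z ≠ 0 → φ z *ᵥ (φ z⁻¹ *ᵥ u) = u := by
    intro z hz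
    rw [Matrix.mulVec_mulVec, ← map_mul, mul_inv_cancel₀ hz, map_one, Matrix.one_mulVec]
  have hy1' : y + 1 ≠ 0 := fun h => hy1 (eq_of_add_eq_zero_zmod_two h)
  refine ⟨y, ?_, ?_⟩
  · rw [add_comm]
    exact isUnit_add_vecMulVec_of_isUnit (isUnit_map_of_ne_zero φ hy0) (hmul y hy0)
      (hw _ (Submodule.subset_span (by simp)))
  · rw [add_assoc, ← map_one φ, ← map_add, add_comm]
    exact isUnit_add_vecMulVec_of_isUnit (isUnit_map_of_ne_zero φ hy1') (hmul _ hy1')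
      (hw _ (Submodule.subset_span (by simp)))

/-- A given nonzero vector lies on `inversePlane φ u y` for at most four values of `y`. -/
theorem exists_finset_inversePlane [Fintype K] (hK : Fintype.card K = 2 ^ r)
    {u : Fin r → ZMod 2} (hu : u ≠ 0) {x : Fin r → ZMod 2} (hx : x ≠ 0) :
    ∃ F : Finset K, F.card ≤ 4 ∧ ∀ y, y ∉ F → y ≠ 0 → y ≠ 1 → x ∉ inversePlane φ u y := by
  classical
  obtain ⟨z, rfl⟩ := exists_map_mulVec_eq φ hK hu x
  have hz : z ≠ 0 := by
    rintro rfl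
    simp at hx
  -- with `x = φ z u`, the excluded `y` have `z` equal to `1 / y`, to `1 / (y + 1)` or to their
  -- sum `1 / (y (y + 1))`; `R` holds the roots of the quadratic equation in the last case
  obtain ⟨R, hR, hR'⟩ : ∃ R : Finset K, R.card ≤ 2 ∧ ∀ y, y * (y + 1) = z⁻¹ → y ∈ R := by
    by_cases h : ∃ y₀, y₀ * (y₀ + 1) = z⁻¹
    · obtain ⟨y₀, hy₀⟩ := h
      refine ⟨{y₀, y₀ + 1}, Finset.card_le_two, ?_⟩
      intro y hy
      have h2 : (2 : K) = 0 := by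
        have := add_self_of_zmod_two (1 : K)
        rwa [one_add_one_eq_two] at this
      have h3 : (y - y₀) * (y - (y₀ + 1)) = 0 := by
        linear_combination hy - hy₀ + (y₀ * y₀ + y₀ - y - y * y₀) * h2
      rcases mul_eq_zero.1 h3 with h | h
      · simp [sub_eq_zero.1 h]
      · simp [sub_eq_zero.1 h]
    · exact ⟨∅, by simp, fun y hy => absurd ⟨y, hy⟩ h⟩
  refine ⟨{z⁻¹, z⁻¹ + 1} ∪ R, ?_, ?_⟩
  · refine (Finset.card_union_le _ _).trans ?_
    have : ({z⁻¹, z⁻¹ + 1} : Finset K).card ≤ 2 := Finset.card_le_two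
    omega
  · intro y hyF hy0 hy1 hmem
    have hy1' : y + 1 ≠ 0 := fun h => hy1 (eq_of_add_eq_zero_zmod_two h)
    rw [inversePlane, Submodule.mem_span_pair] at hmem
    obtain ⟨a, a', haa⟩ := hmem
    simp only [Finset.mem_union, Finset.mem_insert, Finset.mem_singleton, not_or] at hyF
    obtain ⟨⟨n1, n2⟩, n3⟩ := hyF
    have h1 : z = a • y⁻¹ + a' • (y + 1)⁻¹ := by
      apply map_mulVec_injective φ hu
      rw [← haa, map_add, map_smul, map_smul, Matrix.add_mulVec, Matrix.smul_mulVec,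
        Matrix.smul_mulVec]
    rcases zmod_two_cases a with rfl | rfl <;> rcases zmod_two_cases a' with rfl | rfl
    · exact hz (by simpa using h1)
    · apply n2
      have : z⁻¹ = y + 1 := by simp [h1]
      rw [this, add_add_cancel_zmod_two]
    · exact n1 (by simp [h1])
    · apply n3
      apply hR'
      rw [h1, one_smul, one_smul]
      have h2 : y⁻¹ + (y + 1)⁻¹ = (y * (y + 1))⁻¹ := by
        have h3 : y + 1 + y = 1 := by
          rw [add_right_comm, add_self_of_zmod_two, zero_add]
        field_simp
        exact h3
      rw [h2, inv_inv]

theorem isGood_zero [Fintype K] (hK : Fintype.card K = 2 ^ r) (hr : 2 ≤ r) :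
    IsGood φ (0 : Matrix (Fin r) (Fin r) (ZMod 2)) := by
  obtain ⟨θ, h0, h1⟩ := exists_ne_zero_ne_one hK hr
  refine ⟨θ, ?_, ?_⟩
  · rw [zero_add]
    exact isUnit_map_of_ne_zero φ h0
  · rw [zero_add, ← map_one φ, ← map_add]
    exact isUnit_map_of_ne_zero φ fun h => h1 (eq_of_add_eq_zero_zmod_two h)

theorem isGood_add_of_forall {N c : Matrix (Fin r) (Fin r) (ZMod 2)} {y : K}
    (h : IsUnit (N + φ y + c) ∧ IsUnit (N + φ y + 1 + c)) : IsGood φ (N + c) :=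
  ⟨y, by rw [add_right_comm]; exact h.1, by rw [add_right_comm N, add_right_comm]; exact h.2⟩

theorem notMem_span_singleton_sup {p : Submodule (ZMod 2) (Fin r → ZMod 2)}
    {β δ : Fin r → ZMod 2} (h0 : β ∉ p) (h1 : β + δ ∉ p) :
    β ∉ Submodule.span (ZMod 2) {δ} ⊔ p := by
  intro h
  obtain ⟨d, hd, x, hx, hc⟩ := Submodule.mem_sup.1 h
  obtain ⟨c, rfl⟩ := Submodule.mem_span_singleton.1 hd
  rcases zmod_two_cases c with rfl | rfl
  · rw [zero_smul, zero_add] at hc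
    exact h0 (hc ▸ hx)
  · rw [one_smul] at hc
    apply h1
    rw [← hc, add_right_comm, add_self_of_zmod_two, zero_add]
    exact hx

/-- For `r ≥ 4` every matrix is a sum of two good ones: at most ten values of `y` are excluded
for a rank-one summand orthogonal to `inversePlane φ u y`. -/
theorem exists_isGood_add_isGood [Fintype K] (hK : Fintype.card K = 2 ^ r) (hr : 4 ≤ r)
    (C : Matrix (Fin r) (Fin r) (ZMod 2)) : ∃ c, IsGood φ c ∧ IsGood φ (C + c) := by
  classical
  obtain ⟨y, hy0, hy1⟩ := exists_corank_le_one_pair φ hK C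
  rcases exists_rank_one_correction (by omega) _ hy0 hy1 with h | ⟨u, β, δ, hu, hβ, hβδ, h⟩
  · exact ⟨0, isGood_zero φ hK (by omega), by rw [add_zero]; exact ⟨y, h⟩⟩
  obtain ⟨F, hF, hF'⟩ := exists_finset_inversePlane φ hK hu hβ
  obtain ⟨F₂, hF₂, hF₂'⟩ := exists_finset_inversePlane φ hK hu hβδ
  obtain ⟨y', hy'⟩ : ∃ y', y' ∉ F ∪ F₂ ∪ {0, 1} := by
    by_contra hcon
    push Not at hcon
    have h1 := Finset.card_le_card (fun x _ => hcon x : (Finset.univ : Finset K) ⊆ _)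
    rw [Finset.card_univ, hK] at h1
    have h2 := Finset.card_union_le (F ∪ F₂) ({0, 1} : Finset K)
    have h3 := Finset.card_union_le F F₂
    have h4 : ({0, 1} : Finset K).card ≤ 2 := Finset.card_le_two
    have h5 : 2 ^ 4 ≤ 2 ^ r := Nat.pow_le_pow_right (by norm_num) hr
    omega
  simp only [Finset.mem_union, Finset.mem_insert, Finset.mem_singleton, not_or] at hy'
  obtain ⟨⟨n1, n2⟩, n3, n4⟩ := hy'
  obtain ⟨w, hw, hw'⟩ := exists_dotProduct_of_notMem
    (notMem_span_singleton_sup (hF' y' n1 n3 n4) (hF₂' y' n2 n3 n4))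
  refine ⟨vecMulVec u w, isGood_vecMulVec φ n3 n4 fun x hx => hw' x ?_, ?_⟩
  · exact Submodule.mem_sup_right hx
  · exact isGood_add_of_forall φ (h w hw (hw' δ (Submodule.mem_sup_left
      (Submodule.mem_span_singleton_self _))))

/-- For `r = 3` one `y` cannot always avoid both excluded vectors, but two rank-one summands with
different `y` can, as `(A ∩ B)ᗮ = Aᗮ + Bᗮ`. -/
theorem exists_isGood_add_isGood_add_isGood [Fintype K] (hK : Fintype.card K = 2 ^ r)
    (hr : 3 ≤ r) (C : Matrix (Fin r) (Fin r) (ZMod 2)) :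
    ∃ c c', IsGood φ c ∧ IsGood φ c' ∧ IsGood φ (C + (c + c')) := by
  classical
  obtain ⟨y, hy0, hy1⟩ := exists_corank_le_one_pair φ hK C
  rcases exists_rank_one_correction (by omega) _ hy0 hy1 with h | ⟨u, β, δ, hu, hβ, hβδ, h⟩
  · exact ⟨0, 0, isGood_zero φ hK (by omega), isGood_zero φ hK (by omega), by
      rw [add_zero, add_zero]; exact ⟨y, h⟩⟩
  have avoid : ∀ x : Fin r → ZMod 2, x ≠ 0 →
      ∃ y' : K, y' ≠ 0 ∧ y' ≠ 1 ∧ x ∉ inversePlane φ u y' := by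
    intro x hx
    obtain ⟨F, hF, hF'⟩ := exists_finset_inversePlane φ hK hu hx
    obtain ⟨y', hy'⟩ : ∃ y', y' ∉ F ∪ {0, 1} := by
      by_contra hcon
      push Not at hcon
      have h1 := Finset.card_le_card (fun x _ => hcon x : (Finset.univ : Finset K) ⊆ _)
      rw [Finset.card_univ, hK] at h1
      have h2 := Finset.card_union_le F ({0, 1} : Finset K)
      have h4 : ({0, 1} : Finset K).card ≤ 2 := Finset.card_le_two
      have h5 : 2 ^ 3 ≤ 2 ^ r := Nat.pow_le_pow_right (by norm_num) hr
      omega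
    simp only [Finset.mem_union, Finset.mem_insert, Finset.mem_singleton, not_or] at hy'
    exact ⟨y', hy'.2.1, hy'.2.2, hF' y' hy'.1 hy'.2.1 hy'.2.2⟩
  obtain ⟨y₁, h10, h11, h1⟩ := avoid β hβ
  obtain ⟨y₂, h20, h21, h2⟩ := avoid (β + δ) hβδ
  obtain ⟨w, hw, hw'⟩ := exists_dotProduct_of_notMem
    (notMem_span_singleton_sup (p := inversePlane φ u y₁ ⊓ inversePlane φ u y₂)
      (fun h => h1 h.1) (fun h => h2 h.2))
  have hann : (dotProductEquiv (ZMod 2) (Fin r) w) ∈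
      (inversePlane φ u y₁ ⊓ inversePlane φ u y₂).dualAnnihilator := by
    rw [Submodule.mem_dualAnnihilator]
    intro x hx
    exact hw' x (Submodule.mem_sup_right hx)
  rw [Subspace.dualAnnihilator_inf_eq, Submodule.mem_sup] at hann
  obtain ⟨f₁, hf₁, f₂, hf₂, hsum⟩ := hann
  obtain ⟨w₁, rfl⟩ := (dotProductEquiv (ZMod 2) (Fin r)).surjective f₁
  obtain ⟨w₂, rfl⟩ := (dotProductEquiv (ZMod 2) (Fin r)).surjective f₂
  rw [← map_add] at hsum
  have hw12 := (dotProductEquiv (ZMod 2) (Fin r)).injective hsum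
  rw [Submodule.mem_dualAnnihilator] at hf₁ hf₂
  refine ⟨vecMulVec u w₁, vecMulVec u w₂, isGood_vecMulVec φ h10 h11 fun x hx => hf₁ x hx,
    isGood_vecMulVec φ h20 h21 fun x hx => hf₂ x hx, ?_⟩
  rw [← Matrix.vecMulVec_add, hw12]
  exact isGood_add_of_forall φ (h w hw (hw' δ (Submodule.mem_sup_left
      (Submodule.mem_span_singleton_self _))))

end RankOne

/-! ### Decomposition of symmetric tensors -/

section SymmetricDecomposition

variable {r : ℕ} {K : Type} [Field K] [Algebra (ZMod 2) K]
  (φ : K →ₐ[ZMod 2] Matrix (Fin r) (Fin r) (ZMod 2))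

/-- `W` is a sum of at most `k` squares of invertible matrices, up to squares of field
elements. -/
def IsSumOfUnitSquaresMod (k : ℕ) (W : Matrix (Fin r × Fin r) (Fin r × Fin r) (ZMod 2)) :
    Prop :=
  ∃ x ∈ fieldSquares φ, IsSumOfAtMost (unitSquares r) k (W + x)

theorem IsSumOfUnitSquaresMod.add {k k' : ℕ}
    {W W' : Matrix (Fin r × Fin r) (Fin r × Fin r) (ZMod 2)}
    (h : IsSumOfUnitSquaresMod φ k W) (h' : IsSumOfUnitSquaresMod φ k' W') :
    IsSumOfUnitSquaresMod φ (k + k') (W + W') := by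
  obtain ⟨x, hx, h⟩ := h
  obtain ⟨x', hx', h'⟩ := h'
  refine ⟨x + x', add_mem hx hx', ?_⟩
  rw [add_add_add_comm]
  exact h.add h'

theorem IsSumOfUnitSquaresMod.sum_univ_const {ι : Type} [Fintype ι] {k : ℕ}
    {W : ι → Matrix (Fin r × Fin r) (Fin r × Fin r) (ZMod 2)}
    (h : ∀ i, IsSumOfUnitSquaresMod φ k (W i)) :
    IsSumOfUnitSquaresMod φ (Fintype.card ι * k) (∑ i, W i) := by
  choose x hx h using h
  refine ⟨∑ i, x i, sum_mem fun i _ => hx i, ?_⟩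
  rw [← Finset.sum_add_distrib]
  exact IsSumOfAtMost.sum_univ_const h

theorem IsSumOfUnitSquaresMod.of_mem {W : Matrix (Fin r × Fin r) (Fin r × Fin r) (ZMod 2)}
    (h : W ∈ fieldSquares φ) : IsSumOfUnitSquaresMod φ 0 W :=
  ⟨W, h, by rw [add_self_of_zmod_two]; exact IsSumOfAtMost.zero _ _⟩

theorem IsSumOfUnitSquaresMod.isSumOfAtMost [Fintype K] (hK : Fintype.card K = 2 ^ r) {k : ℕ}
    {W : Matrix (Fin r × Fin r) (Fin r × Fin r) (ZMod 2)}
    (h : IsSumOfUnitSquaresMod φ k W) : IsSumOfAtMost (unitSquares r) (k + (r + 1)) W := by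
  obtain ⟨x, hx, h⟩ := h
  have := h.add (isSumOfAtMost_of_mem_fieldSquares φ hK hx)
  rwa [add_add_cancel_zmod_two] at this

/-- For a good matrix `X`, with `N = X + φ y` and `N + 1` invertible, the symmetric product of
`f X` and `f` is `(f N)² + (f N + f)²` up to squares of field elements. -/
theorem IsGood.isSumOfUnitSquaresMod {X : Matrix (Fin r) (Fin r) (ZMod 2)} (hX : IsGood φ X)
    {f : K} (hf : f ≠ 0) : IsSumOfUnitSquaresMod φ 2 (symOuter (φ f * X) (φ f)) := by
  obtain ⟨y, h0, h1⟩ := hX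
  have hfu := isUnit_map_of_ne_zero φ hf
  set N := φ f * (X + φ y) with hN
  have hN0 : IsUnit N := hfu.mul h0
  have hN1 : IsUnit (N + φ f) := by
    have : N + φ f = φ f * (X + φ y + 1) := by rw [hN, mul_add _ (X + φ y), mul_one]
    rw [this]
    exact hfu.mul h1
  have hX' : φ f * X = N + φ (f * y) := by
    rw [hN, mul_add, map_mul, add_add_cancel_zmod_two]
  have h2 : IsSumOfUnitSquaresMod φ 2 (symOuter N (φ f)) := by
    refine ⟨outer r (φ f) (φ f), outer_map_mem_fieldSquares φ f, ?_⟩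
    rw [symOuter_eq, add_add_cancel_zmod_two]
    exact (IsSumOfAtMost.of_mem (S := unitSquares r) ⟨_, hN1, rfl⟩).add
      (IsSumOfAtMost.of_mem (S := unitSquares r) ⟨_, hN0, rfl⟩)
  rw [hX', symOuter_add_left]
  exact h2.add φ (IsSumOfUnitSquaresMod.of_mem φ (symOuter_map_mem_fieldSquares φ _ _))

theorem isSumOfUnitSquaresMod_symOuter_four [Fintype K] (hK : Fintype.card K = 2 ^ r)
    (hr : 4 ≤ r) (C : Matrix (Fin r) (Fin r) (ZMod 2)) {f : K} (hf : f ≠ 0) :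
    IsSumOfUnitSquaresMod φ 4 (symOuter C (φ f)) := by
  obtain ⟨c, h1, h2⟩ := exists_isGood_add_isGood φ hK hr (φ f⁻¹ * C)
  have hC : C = φ f * (φ f⁻¹ * C + c) + φ f * c := by
    rw [← mul_add, add_add_cancel_zmod_two, ← mul_assoc, ← map_mul, mul_inv_cancel₀ hf,
      map_one, one_mul]
  rw [hC, symOuter_add_left]
  exact (h2.isSumOfUnitSquaresMod φ hf).add φ (h1.isSumOfUnitSquaresMod φ hf)

theorem isSumOfUnitSquaresMod_symOuter_six [Fintype K] (hK : Fintype.card K = 2 ^ r)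
    (hr : 3 ≤ r) (C : Matrix (Fin r) (Fin r) (ZMod 2)) {f : K} (hf : f ≠ 0) :
    IsSumOfUnitSquaresMod φ 6 (symOuter C (φ f)) := by
  obtain ⟨c, c', h1, h1', h2⟩ := exists_isGood_add_isGood_add_isGood φ hK hr (φ f⁻¹ * C)
  have hC : C = φ f * (φ f⁻¹ * C + (c + c')) + φ f * c + φ f * c' := by
    rw [← mul_add, ← mul_add, add_assoc, add_add_cancel_zmod_two, ← mul_assoc, ← map_mul,
      mul_inv_cancel₀ hf, map_one, one_mul]
  rw [hC, symOuter_add_left, symOuter_add_left]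
  exact ((h2.isSumOfUnitSquaresMod φ hf).add φ (h1.isSumOfUnitSquaresMod φ hf)).add φ
    (h1'.isSumOfUnitSquaresMod φ hf)

/-- A symmetric tensor is a sum of `r ^ 2 + 1` squares of arbitrary matrices. Shifting each of
them by a field element to an invertible matrix leaves `r` symmetric products with field
elements, of cost `k` each, and squares of field elements. -/
theorem isSumOfAtMost_unitSquares_of_symOuter [Fintype K] (hK : Fintype.card K = 2 ^ r) {k : ℕ}
    (hk : ∀ (C : Matrix (Fin r) (Fin r) (ZMod 2)) (f : K), f ≠ 0 →
      IsSumOfUnitSquaresMod φ k (symOuter C (φ f)))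
    {W : Matrix (Fin r × Fin r) (Fin r × Fin r) (ZMod 2)} (hW : W.IsSymm) :
    IsSumOfAtMost (unitSquares r) ((r ^ 2 + 1) + r * k + (r + 1)) W := by
  classical
  obtain ⟨l, hl, hl', rfl⟩ := isSumOfAtMost_vecMulVec_of_isSymm hW
  let b : Module.Basis (Fin r) (ZMod 2) K := Module.finBasisOfFinrankEq (ZMod 2) K (by
    have h := Module.card_eq_pow_finrank (K := ZMod 2) (V := K)
    rw [hK, ZMod.card] at h
    exact (Nat.pow_right_injective le_rfl h).symm)
  -- the coefficients of `b` in the remainder are accumulated along the list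
  have key : ∀ l : List (Matrix (Fin r × Fin r) (Fin r × Fin r) (ZMod 2)),
      (∀ a ∈ l, a ∈ {X | ∃ v : Fin r × Fin r → ZMod 2, Matrix.vecMulVec v v = X}) →
      ∃ (C : Fin r → Matrix (Fin r) (Fin r) (ZMod 2)),
        IsSumOfUnitSquaresMod φ l.length (l.sum + ∑ i, symOuter (C i) (φ (b i))) := by
    intro l
    induction l with
    | nil =>
      intro _
      refine ⟨0, IsSumOfUnitSquaresMod.of_mem φ ?_⟩
      simp [symOuter]
    | cons a l ih =>
      intro h
      obtain ⟨C, hC⟩ := ih fun x hx => h x (by simp [hx])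
      obtain ⟨v, rfl⟩ := h a (by simp)
      let A : Matrix (Fin r) (Fin r) (ZMod 2) := Matrix.of fun i j => v (i, j)
      have hA : Matrix.vecMulVec v v = outer r A A := by
        ext p q
        simp [A, Matrix.vecMulVec_apply]
      obtain ⟨y, hy⟩ := exists_isUnit_add_map φ hK A
      refine ⟨fun i => C i + b.repr y i • A, ?_⟩
      have hsum : ∑ i, symOuter (C i + b.repr y i • A) (φ (b i)) =
          ∑ i, symOuter (C i) (φ (b i)) + symOuter A (φ y) := by
        have hy' : φ y = ∑ i, b.repr y i • φ (b i) := by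
          have h := congrArg φ (b.sum_repr y)
          simpa only [map_sum, map_smul] using h.symm
        rw [hy']
        simp only [symOuter, map_add, map_sum, map_smul, LinearMap.add_apply,
          LinearMap.sum_apply, LinearMap.smul_apply, Finset.sum_add_distrib]
        abel
      have h1 : IsSumOfUnitSquaresMod φ 1 (outer r A A + symOuter A (φ y)) := by
        refine ⟨outer r (φ y) (φ y), outer_map_mem_fieldSquares φ y, ?_⟩
        rw [add_right_comm, ← outer_add_self]
        exact IsSumOfAtMost.of_mem ⟨_, hy, rfl⟩
      have h2 := hC.add φ h1
      rw [List.length_cons, List.sum_cons, hA, hsum]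
      convert h2 using 1
      abel
  obtain ⟨C, hC⟩ := key l hl'
  have h2 : IsSumOfUnitSquaresMod φ (r * k) (∑ i, symOuter (C i) (φ (b i))) := by
    have := IsSumOfUnitSquaresMod.sum_univ_const φ fun i => hk (C i) (b i) (b.ne_zero i)
    rwa [Fintype.card_fin] at this
  have h3 := (hC.add φ h2).isSumOfAtMost φ hK
  rw [add_add_cancel_zmod_two] at h3
  refine h3.mono ?_
  have : Fintype.card (Fin r × Fin r) = r ^ 2 := by simp [sq]
  omega

end SymmetricDecomposition

theorem isSumOfAtMost_unitTensors_of_two_le {r : ℕ} (hr : 2 ≤ r)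
    (W : Matrix (Fin r × Fin r) (Fin r × Fin r) (ZMod 2)) :
    IsSumOfAtMost (unitTensors r) (r ^ 2 + r + 4) W := by
  obtain ⟨K, _, _, _, φ, hK⟩ := exists_field_of_matrices r (by omega)
  exact isSumOfAtMost_unitTensors φ hK hr W

theorem isSumOfAtMost_unitSquares_of_four_le {r : ℕ} (hr : 4 ≤ r)
    {W : Matrix (Fin r × Fin r) (Fin r × Fin r) (ZMod 2)} (hW : W.IsSymm) :
    IsSumOfAtMost (unitSquares r) (r ^ 2 + 5 * r + 2) W := by
  obtain ⟨K, _, _, _, φ, hK⟩ := exists_field_of_matrices r (by omega)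
  refine (isSumOfAtMost_unitSquares_of_symOuter φ hK
    (fun C f hf => isSumOfUnitSquaresMod_symOuter_four φ hK hr C hf) hW).mono (le_of_eq ?_)
  ring

theorem isSumOfAtMost_unitSquares_of_three_le {r : ℕ} (hr : 3 ≤ r)
    {W : Matrix (Fin r × Fin r) (Fin r × Fin r) (ZMod 2)} (hW : W.IsSymm) :
    IsSumOfAtMost (unitSquares r) (r ^ 2 + 7 * r + 2) W := by
  obtain ⟨K, _, _, _, φ, hK⟩ := exists_field_of_matrices r (by omega)
  refine (isSumOfAtMost_unitSquares_of_symOuter φ hK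
    (fun C f hf => isSumOfUnitSquaresMod_symOuter_six φ hK hr C hf) hW).mono (le_of_eq ?_)
  ring

/-! ### Diagonal unitaries and their action on the Pauli operators -/

section Action

open scoped Matrix

variable {ι : Type} [Fintype ι] [DecidableEq ι]

theorem coe_pauliX (u : Bits ι) :
    (pauliX u : Matrix (Bits ι) (Bits ι) ℂ) = Matrix.of fun x y => if x = y + u then 1 else 0 :=
  rfl

theorem neg_one_pow_val_add (a b : ZMod 2) :
    (-1 : ℂ) ^ (a + b).val = (-1) ^ a.val * (-1) ^ b.val := by
  rcases zmod_two_cases a with rfl | rfl <;> rcases zmod_two_cases b with rfl | rfl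
  · simp
  · simp
  · simp
  · rw [show (1 + 1 : ZMod 2) = 0 from rfl, show (1 : ZMod 2).val = 1 from rfl]
    simp

theorem commute_diagUnitary (f g : Bits ι → ℂ) (hf : ∀ x, f x * star (f x) = 1)
    (hg : ∀ x, g x * star (g x) = 1) : Commute (diagUnitary f hf) (diagUnitary g hg) := by
  apply Subtype.ext
  change Matrix.diagonal f * Matrix.diagonal g = Matrix.diagonal g * Matrix.diagonal f
  simp only [Matrix.diagonal_mul_diagonal, mul_comm]

theorem pauliX_zero : pauliX (0 : Bits ι) = 1 := by
  apply Subtype.ext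
  rw [coe_pauliX]
  ext x y
  simp [Matrix.one_apply]

theorem pauliX_add (u u' : Bits ι) : pauliX (u + u') = pauliX u * pauliX u' := by
  apply Subtype.ext
  rw [Submonoid.coe_mul, coe_pauliX, coe_pauliX, coe_pauliX]
  ext x y
  rw [Matrix.mul_apply, Finset.sum_eq_single (y + u')]
  · simp [add_assoc, add_comm u u']
  · intro z _ hz
    simp [hz]
  · simp

theorem pauliZ_zero : pauliZ (0 : Bits ι) = 1 := by
  apply Subtype.ext
  change Matrix.diagonal _ = 1
  rw [← Matrix.diagonal_one]
  congr 1
  funext x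
  simp

theorem pauliZ_add (v v' : Bits ι) : pauliZ (v + v') = pauliZ v * pauliZ v' := by
  apply Subtype.ext
  change Matrix.diagonal _ = Matrix.diagonal _ * Matrix.diagonal _
  rw [Matrix.diagonal_mul_diagonal]
  congr 1
  funext x
  rw [add_dotProduct, neg_one_pow_val_add]

theorem commute_pauliZ (v v' : Bits ι) : Commute (pauliZ v) (pauliZ v') :=
  commute_diagUnitary _ _ _ _

theorem pauliX_mul_self (u : Bits ι) : pauliX u * pauliX u = 1 := by
  rw [← pauliX_add, add_self_of_zmod_two, pauliX_zero]

theorem pauliZ_mul_self (v : Bits ι) : pauliZ v * pauliZ v = 1 := by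
  rw [← pauliZ_add, add_self_of_zmod_two, pauliZ_zero]

theorem pauliZ_inv (v : Bits ι) : (pauliZ v)⁻¹ = pauliZ v :=
  inv_eq_of_mul_eq_one_left (pauliZ_mul_self v)

theorem pauliX_inv (u : Bits ι) : (pauliX u)⁻¹ = pauliX u :=
  inv_eq_of_mul_eq_one_left (pauliX_mul_self u)

theorem coe_phaseI_pow (k : ℕ) :
    ((phaseI ι ^ k : QubitUnitary ι) : Matrix (Bits ι) (Bits ι) ℂ) =
      Matrix.diagonal fun _ => Complex.I ^ k := by
  rw [SubmonoidClass.coe_pow]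
  change Matrix.diagonal _ ^ k = _
  rw [Matrix.diagonal_pow]
  rfl

theorem phaseI_mul_comm (W : QubitUnitary ι) : phaseI ι * W = W * phaseI ι := by
  apply Subtype.ext
  change Matrix.diagonal (fun _ => Complex.I) * (W : Matrix (Bits ι) (Bits ι) ℂ) =
    (W : Matrix (Bits ι) (Bits ι) ℂ) * Matrix.diagonal (fun _ => Complex.I)
  ext x y
  rw [Matrix.diagonal_mul, Matrix.mul_diagonal, mul_comm]

theorem phase_mul_comm {z : QubitUnitary ι} (hz : z ∈ phaseGroup ι) (W : QubitUnitary ι) :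
    z * W = W * z := by
  obtain ⟨k, rfl⟩ := Subgroup.mem_zpowers_iff.1 hz
  exact (Commute.zpow_left (phaseI_mul_comm W : Commute _ _) k).eq

theorem phaseI_pow_mem (k : ℕ) : phaseI ι ^ k ∈ phaseGroup ι :=
  Subgroup.pow_mem _ (Subgroup.mem_zpowers _) k

theorem phaseI_pow_four : phaseI ι ^ 4 = 1 := by
  apply Subtype.ext
  rw [coe_phaseI_pow, Complex.I_pow_four]
  exact Matrix.diagonal_one

theorem exists_phaseI_pow {z : QubitUnitary ι} (hz : z ∈ phaseGroup ι) :
    ∃ k : ℕ, z = phaseI ι ^ k := by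
  obtain ⟨k, rfl⟩ := Subgroup.mem_zpowers_iff.1 hz
  refine ⟨(k % 4).toNat, ?_⟩
  have h1 : ((k % 4).toNat : ℤ) = k % 4 := Int.toNat_of_nonneg (Int.emod_nonneg _ (by norm_num))
  rw [← zpow_natCast, h1]
  conv_lhs => rw [← Int.emod_add_mul_ediv k 4]
  rw [zpow_add, zpow_mul, show (phaseI ι) ^ (4 : ℤ) = 1 from by
    exact_mod_cast phaseI_pow_four, one_zpow, mul_one]

/-- Moving a diagonal unitary past `X^a`. -/
theorem diagUnitary_mul_pauliX (f : Bits ι → ℂ) (hf : ∀ x, f x * star (f x) = 1) (k : ℕ)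
    (a b : Bits ι)
    (h : ∀ y, f (y + a) = Complex.I ^ k * (-1) ^ (b ⬝ᵥ y).val * f y) :
    diagUnitary f hf * pauliX a =
      phaseI ι ^ k * (pauliX a * pauliZ b) * diagUnitary f hf := by
  apply Subtype.ext
  rw [Submonoid.coe_mul, Submonoid.coe_mul, Submonoid.coe_mul, Submonoid.coe_mul,
    coe_phaseI_pow]
  change Matrix.diagonal f * _ = Matrix.diagonal _ * (_ * Matrix.diagonal _) * Matrix.diagonal f
  ext x y
  rw [Matrix.diagonal_mul, Matrix.mul_diagonal, Matrix.diagonal_mul, Matrix.mul_diagonal,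
    coe_pauliX, Matrix.of_apply]
  split_ifs with hxy
  · rw [hxy, h y]
    ring
  · simp

theorem exists_phase_pauliZ_mul_pauliX (v u : Bits ι) :
    ∃ z ∈ phaseGroup ι, pauliZ v * pauliX u = z * (pauliX u * pauliZ v) := by
  refine ⟨phaseI ι ^ (2 * (v ⬝ᵥ u).val), phaseI_pow_mem _, ?_⟩
  have h : pauliZ v * pauliX u = phaseI ι ^ (2 * (v ⬝ᵥ u).val) * (pauliX u * pauliZ 0) *
      pauliZ v := diagUnitary_mul_pauliX (fun x => (-1 : ℂ) ^ (v ⬝ᵥ x).val)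
    (fun x => by simp [← mul_pow]) (2 * (v ⬝ᵥ u).val) u 0 (by
      intro y
      rw [dotProduct_add, neg_one_pow_val_add, zero_dotProduct, pow_mul, Complex.I_sq]
      simp [mul_comm])
  rw [pauliZ_zero, mul_one, mul_assoc] at h
  exact h

theorem pauliZ_mul_pauliX_of_dotProduct_eq_zero {v u : Bits ι} (h : u ⬝ᵥ v = 0) :
    pauliZ v * pauliX u = pauliX u * pauliZ v := by
  have h : pauliZ v * pauliX u = phaseI ι ^ 0 * (pauliX u * pauliZ 0) *
      pauliZ v := diagUnitary_mul_pauliX (fun x => (-1 : ℂ) ^ (v ⬝ᵥ x).val)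
    (fun x => by simp [← mul_pow]) 0 u 0 (by
      intro y
      rw [dotProduct_add, dotProduct_comm v u, h]
      simp)
  rw [pauliZ_zero, mul_one, pow_zero, one_mul] at h
  exact h

/-- `W` commutes with the `Z`-type Paulis and conjugates `X^a` to `X^a Z^(a B)`, up to a phase. -/
structure ActsBy (W : QubitUnitary ι) (B : Matrix ι ι (ZMod 2)) : Prop where
  commute_pauliZ : ∀ v, W * pauliZ v = pauliZ v * W
  mul_pauliX : ∀ a, ∃ z ∈ phaseGroup ι, W * pauliX a = z * (pauliX a * pauliZ (a ᵥ* B)) * W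

theorem ActsBy.one : ActsBy (1 : QubitUnitary ι) 0 where
  commute_pauliZ v := by rw [one_mul, mul_one]
  mul_pauliX a := ⟨1, one_mem _, by
    rw [Matrix.vecMul_zero, pauliZ_zero, one_mul, one_mul, mul_one, mul_one]⟩

theorem ActsBy.mul {W W' : QubitUnitary ι} {B B' : Matrix ι ι (ZMod 2)} (h : ActsBy W B)
    (h' : ActsBy W' B') : ActsBy (W * W') (B + B') where
  commute_pauliZ v := by
    rw [mul_assoc, h'.commute_pauliZ, ← mul_assoc, h.commute_pauliZ, mul_assoc]
  mul_pauliX a := by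
    obtain ⟨z, hz, e⟩ := h.mul_pauliX a
    obtain ⟨z', hz', e'⟩ := h'.mul_pauliX a
    refine ⟨z' * z, mul_mem hz' hz, ?_⟩
    calc W * W' * pauliX a = W * (z' * (pauliX a * pauliZ (a ᵥ* B')) * W') := by
          rw [mul_assoc, e']
      _ = z' * (W * pauliX a) * pauliZ (a ᵥ* B') * W' := by
          simp only [← mul_assoc]
          rw [← phase_mul_comm hz' W]
      _ = z' * z * (pauliX a * pauliZ (a ᵥ* B)) * (W * pauliZ (a ᵥ* B')) * W' := by
          rw [e]
          simp only [mul_assoc]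
      _ = _ := by
          rw [h.commute_pauliZ, Matrix.vecMul_add, pauliZ_add]
          simp only [mul_assoc]

theorem ActsBy.inv {W : QubitUnitary ι} {B : Matrix ι ι (ZMod 2)} (h : ActsBy W B) :
    ActsBy W⁻¹ B where
  commute_pauliZ v := (Commute.inv_left (h.commute_pauliZ v)).eq
  mul_pauliX a := by
    obtain ⟨z, hz, e⟩ := h.mul_pauliX a
    have hZ : W⁻¹ * pauliZ (a ᵥ* B) = pauliZ (a ᵥ* B) * W⁻¹ :=
      (Commute.inv_left (h.commute_pauliZ _)).eq
    refine ⟨z⁻¹, inv_mem hz, ?_⟩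
    calc W⁻¹ * pauliX a
        = z⁻¹ * W⁻¹ * (z * (pauliX a * pauliZ (a ᵥ* B)) * W) * W⁻¹ * pauliZ (a ᵥ* B) := by
          simp only [mul_assoc]
          rw [mul_inv_cancel_left, pauliZ_mul_self, mul_one, ← mul_assoc W⁻¹ z,
            ← phase_mul_comm hz, mul_assoc, inv_mul_cancel_left]
      _ = z⁻¹ * pauliX a * (W⁻¹ * pauliZ (a ᵥ* B)) := by
          rw [← e]
          simp only [mul_assoc, inv_mul_cancel_left]
      _ = _ := by
          rw [hZ]
          simp only [mul_assoc]

/-- It suffices to know the action on a single `X_i`. -/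
theorem ActsBy.of_single {W : QubitUnitary ι} {B : Matrix ι ι (ZMod 2)}
    (hZ : ∀ v, W * pauliZ v = pauliZ v * W)
    (hX : ∀ i, ∃ z ∈ phaseGroup ι,
      W * pauliX (Pi.single i 1) = z * (pauliX (Pi.single i 1) * pauliZ (B i)) * W) :
    ActsBy W B where
  commute_pauliZ := hZ
  mul_pauliX a := by
    have hadd : ∀ a a' : Bits ι,
        (∃ z ∈ phaseGroup ι, W * pauliX a = z * (pauliX a * pauliZ (a ᵥ* B)) * W) →
        (∃ z ∈ phaseGroup ι, W * pauliX a' = z * (pauliX a' * pauliZ (a' ᵥ* B)) * W) →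
        ∃ z ∈ phaseGroup ι, W * pauliX (a + a') =
          z * (pauliX (a + a') * pauliZ ((a + a') ᵥ* B)) * W := by
      rintro a a' ⟨z, hz, e⟩ ⟨z', hz', e'⟩
      obtain ⟨z'', hz'', e''⟩ := exists_phase_pauliZ_mul_pauliX (a ᵥ* B) a'
      refine ⟨z * z' * z'', mul_mem (mul_mem hz hz') hz'', ?_⟩
      calc W * pauliX (a + a')
          = z * (pauliX a * pauliZ (a ᵥ* B)) * (W * pauliX a') := by
            rw [pauliX_add, ← mul_assoc, e]
            simp only [mul_assoc]
        _ = z * pauliX a * (pauliZ (a ᵥ* B) * z') * pauliX a' * pauliZ (a' ᵥ* B) * W := by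
            rw [e']
            simp only [mul_assoc]
        _ = z * (pauliX a * z') * (pauliZ (a ᵥ* B) * pauliX a') * pauliZ (a' ᵥ* B) * W := by
            rw [← phase_mul_comm hz']
            simp only [mul_assoc]
        _ = z * z' * (pauliX a * z'') * pauliX a' * pauliZ (a ᵥ* B) * pauliZ (a' ᵥ* B) * W := by
            rw [← phase_mul_comm hz' (pauliX a), e'']
            simp only [mul_assoc]
        _ = _ := by
            rw [← phase_mul_comm hz'' (pauliX a), pauliX_add, Matrix.add_vecMul, pauliZ_add]
            simp only [mul_assoc]
    have hsum : ∀ s : Finset ι, ∃ z ∈ phaseGroup ι,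
        W * pauliX (∑ i ∈ s, Pi.single i (a i)) = z * (pauliX (∑ i ∈ s, Pi.single i (a i)) *
          pauliZ ((∑ i ∈ s, Pi.single i (a i)) ᵥ* B)) * W := by
      intro s
      induction s using Finset.induction_on with
      | empty =>
        refine ⟨1, one_mem _, ?_⟩
        rw [Finset.sum_empty, Matrix.zero_vecMul, pauliX_zero, pauliZ_zero]
        simp
      | insert i s hi ih =>
        rw [Finset.sum_insert hi]
        refine hadd _ _ ?_ ih
        rcases zmod_two_cases (a i) with h | h
        · refine ⟨1, one_mem _, ?_⟩
          rw [h, Pi.single_zero, Matrix.zero_vecMul, pauliX_zero, pauliZ_zero]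
          simp
        · rw [h, Matrix.single_one_vecMul]
          exact hX i
    have := hsum Finset.univ
    rwa [Finset.univ_sum_single] at this

/-- The action of a gate on the Paulis, as a symmetric matrix. -/
def DiagGate.actionMatrix : DiagGate ι → Matrix ι ι (ZMod 2)
  | .S i => Matrix.single i i 1
  | .CZ i j _ => Matrix.single i j 1 + Matrix.single j i 1

theorem vecMul_single_one (a : Bits ι) (i j : ι) :
    a ᵥ* Matrix.single i j 1 = Pi.single j (a i) := by
  ext k
  rw [Matrix.vecMul, dotProduct, Finset.sum_eq_single i]
  · by_cases h : j = k
    · subst h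
      simp
    · simp [h, Ne.symm h]
  · intro l _ hl
    simp [hl.symm]
  · simp

theorem DiagGate.actsBy (g : DiagGate ι) : ActsBy g.toUnitary g.actionMatrix := by
  cases g with
  | S i =>
    refine ⟨fun v => (commute_diagUnitary _ _ (fun x => by simp [← mul_pow]) _).eq, fun a => ?_⟩
    refine ⟨phaseI ι ^ (a i).val, phaseI_pow_mem _, ?_⟩
    refine diagUnitary_mul_pauliX _ (fun x => by simp [← mul_pow]) _ _ _ fun y => ?_
    have h1 : (a ᵥ* (DiagGate.S i).actionMatrix) ⬝ᵥ y = a i * y i := by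
      rw [DiagGate.actionMatrix, vecMul_single_one, single_dotProduct]
    rw [h1, Pi.add_apply]
    rcases zmod_two_cases (a i) with h | h <;> rcases zmod_two_cases (y i) with h' | h'
    · simp [h, h']
    · simp [h, h']
    · simp [h, h']
    · rw [h, h', show (1 + 1 : ZMod 2) = 0 from rfl, show (1 * 1 : ZMod 2) = 1 from rfl,
        show (1 : ZMod 2).val = 1 from rfl]
      simp
  | CZ i j hij =>
    refine ⟨fun v => (commute_diagUnitary _ _ (fun x => by simp [← mul_pow]) _).eq, fun a => ?_⟩
    refine ⟨phaseI ι ^ (2 * (a i * a j).val), phaseI_pow_mem _, ?_⟩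
    refine diagUnitary_mul_pauliX _ (fun x => by simp [← mul_pow]) _ _ _ fun y => ?_
    have h1 : (a ᵥ* (DiagGate.CZ i j hij).actionMatrix) ⬝ᵥ y = a i * y j + a j * y i := by
      rw [DiagGate.actionMatrix, Matrix.vecMul_add, vecMul_single_one, vecMul_single_one,
        add_dotProduct, single_dotProduct, single_dotProduct]
    rw [h1, pow_mul, Complex.I_sq, ← neg_one_pow_val_add, ← neg_one_pow_val_add, Pi.add_apply,
      Pi.add_apply]
    congr 2
    ring

theorem actsBy_map_toUnitary_prod (l : List (DiagGate ι)) :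
    ActsBy (l.map DiagGate.toUnitary).prod (l.map DiagGate.actionMatrix).sum := by
  induction l with
  | nil => exact ActsBy.one
  | cons g l ih =>
    rw [List.map_cons, List.map_cons, List.prod_cons, List.sum_cons]
    exact g.actsBy.mul ih

/-- The sum of the actions of the gates of a layer. -/
def Layer.actionMatrix (L : Layer ι) : Matrix ι ι (ZMod 2) :=
  (L.gates.map DiagGate.actionMatrix).sum

theorem Layer.actsBy (L : Layer ι) : ActsBy L.toUnitary L.actionMatrix :=
  actsBy_map_toUnitary_prod L.gates

theorem actsBy_circuitUnitary (C : List (Layer ι)) :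
    ActsBy (circuitUnitary C) (C.map Layer.actionMatrix).sum := by
  induction C with
  | nil => exact ActsBy.one
  | cons L C ih =>
    rw [List.map_cons, List.sum_cons, add_comm]
    exact ih.mul L.actsBy

/-! ### Diagonal Clifford unitaries -/

/-- Every element of the Pauli group is a phase times some `X^a Z^b`. -/
theorem exists_eq_of_mem_pauliGroup {P : QubitUnitary ι} (hP : P ∈ pauliGroup ι) :
    ∃ z ∈ phaseGroup ι, ∃ a b : Bits ι, P = z * (pauliX a * pauliZ b) := by
  induction hP using Subgroup.closure_induction with
  | mem x hx =>
    rcases hx with (rfl | ⟨j, rfl⟩) | ⟨j, rfl⟩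
    · exact ⟨phaseI ι, Subgroup.mem_zpowers _, 0, 0, by
        rw [pauliX_zero, pauliZ_zero, mul_one, mul_one]⟩
    · exact ⟨1, one_mem _, Pi.single j 1, 0, by rw [pauliZ_zero, mul_one, one_mul]⟩
    · exact ⟨1, one_mem _, 0, Pi.single j 1, by rw [pauliX_zero, one_mul, one_mul]⟩
  | one => exact ⟨1, one_mem _, 0, 0, by rw [pauliX_zero, pauliZ_zero, mul_one, mul_one]⟩
  | mul x y _ _ hx hy =>
    obtain ⟨z, hz, a, b, rfl⟩ := hx
    obtain ⟨z', hz', a', b', rfl⟩ := hy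
    obtain ⟨z'', hz'', e⟩ := exists_phase_pauliZ_mul_pauliX b a'
    refine ⟨z * z' * z'', mul_mem (mul_mem hz hz') hz'', a + a', b + b', ?_⟩
    calc z * (pauliX a * pauliZ b) * (z' * (pauliX a' * pauliZ b'))
        = z * ((pauliX a * pauliZ b) * z') * (pauliX a' * pauliZ b') := by
          simp only [mul_assoc]
      _ = z * z' * pauliX a * (pauliZ b * pauliX a') * pauliZ b' := by
          rw [← phase_mul_comm hz']
          simp only [mul_assoc]
      _ = z * z' * (pauliX a * z'') * pauliX a' * pauliZ b * pauliZ b' := by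
          rw [e]
          simp only [mul_assoc]
      _ = _ := by
          rw [← phase_mul_comm hz'' (pauliX a), pauliX_add, pauliZ_add]
          simp only [mul_assoc]
  | inv x _ hx =>
    obtain ⟨z, hz, a, b, rfl⟩ := hx
    obtain ⟨z', hz', e⟩ := exists_phase_pauliZ_mul_pauliX b a
    refine ⟨z' * z⁻¹, mul_mem hz' (inv_mem hz), a, b, ?_⟩
    rw [mul_inv_rev, mul_inv_rev, pauliZ_inv, pauliX_inv, e,
      ← phase_mul_comm (inv_mem hz), ← mul_assoc, phase_mul_comm (inv_mem hz) z']

/-- A diagonal Clifford unitary acts by a symmetric matrix: as it conjugates `X_i` to a Pauli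
operator, its phases change by an affine function of the argument under a translation by the
`i`-th unit vector. -/
theorem IsDiagonalClifford.exists_actsBy {U : QubitUnitary ι} (hU : IsDiagonalClifford U) :
    ∃ B : Matrix ι ι (ZMod 2), B.IsSymm ∧ ActsBy U B := by
  obtain ⟨hcl, hdiag⟩ := hU
  obtain ⟨f, hfU⟩ : ∃ f : Bits ι → ℂ, (U : Matrix (Bits ι) (Bits ι) ℂ) = Matrix.diagonal f :=
    ⟨Matrix.diag _, hdiag.diagonal_diag.symm⟩
  have hf : ∀ x, f x * star (f x) = 1 := by
    intro x
    have h1 := Matrix.mem_unitaryGroup_iff.1 U.2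
    rw [hfU, Matrix.star_eq_conjTranspose, Matrix.diagonal_conjTranspose,
      Matrix.diagonal_mul_diagonal] at h1
    have h2 := congrFun (congrFun h1 x) x
    rwa [Matrix.diagonal_apply_eq, Matrix.one_apply_eq] at h2
  have hUf : U = diagUnitary f hf := Subtype.ext hfU
  have hne : ∀ x, f x ≠ 0 := by
    intro x h
    have := hf x
    rw [h, zero_mul] at this
    exact zero_ne_one this
  have hrow : ∀ i, ∃ (k : ℕ) (b : Bits ι), ∀ y,
      f (y + Pi.single i 1) = Complex.I ^ k * (-1) ^ (b ⬝ᵥ y).val * f y := by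
    intro i
    have h1 : pauliX (Pi.single i 1) ∈ pauliGroup ι :=
      Subgroup.subset_closure (Or.inl (Or.inr ⟨i, rfl⟩))
    have h2 : U * pauliX (Pi.single i 1) * U⁻¹ ∈ pauliGroup ι :=
      (Subgroup.mem_normalizer_iff.1 hcl _).1 h1
    obtain ⟨z, hz, a, b, e⟩ := exists_eq_of_mem_pauliGroup h2
    obtain ⟨k, rfl⟩ := exists_phaseI_pow hz
    refine ⟨k, b, fun y => ?_⟩
    have h3 : U * pauliX (Pi.single i 1) = phaseI ι ^ k * (pauliX a * pauliZ b) * U := by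
      rw [← e, inv_mul_cancel_right]
    have h4 := congrArg (fun M : QubitUnitary ι =>
      (M : Matrix (Bits ι) (Bits ι) ℂ) (y + Pi.single i 1) y) h3
    simp only [Submonoid.coe_mul, coe_phaseI_pow, hfU] at h4
    change (_ : ℂ) = (Matrix.diagonal _ * (_ * Matrix.diagonal _) * Matrix.diagonal f :
      Matrix (Bits ι) (Bits ι) ℂ) _ _ at h4
    rw [Matrix.diagonal_mul, Matrix.mul_diagonal, Matrix.diagonal_mul, Matrix.mul_diagonal,
      coe_pauliX, coe_pauliX, Matrix.of_apply, Matrix.of_apply, if_pos rfl, mul_one] at h4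
    by_cases ha : y + Pi.single i 1 = y + a
    · rw [if_pos ha, one_mul] at h4
      exact h4
    · rw [if_neg ha, zero_mul, mul_zero, zero_mul] at h4
      exact absurd h4 (hne _)
  choose k b hb using hrow
  refine ⟨Matrix.of b, ?_, ActsBy.of_single ?_ ?_⟩
  · -- compare the two ways of translating the argument by two unit vectors
    have hsymm : ∀ i j, b i j = b j i := by
      intro i j
      have h1 : ∀ i j, f (0 + Pi.single i 1 + Pi.single j 1) =
          Complex.I ^ k j * (-1) ^ (b j i).val * (Complex.I ^ k i * f 0) := by
        intro i j
        rw [hb j, hb i]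
        simp
      have h2 := h1 i j
      rw [add_right_comm, h1 j i] at h2
      have h3 : (-1 : ℂ) ^ (b i j).val = (-1) ^ (b j i).val := by
        have hI : ∀ n : ℕ, Complex.I ^ n ≠ 0 := fun n => pow_ne_zero _ Complex.I_ne_zero
        have h4 : Complex.I ^ k i * Complex.I ^ k j * f 0 ≠ 0 :=
          mul_ne_zero (mul_ne_zero (hI _) (hI _)) (hne 0)
        apply mul_left_cancel₀ h4
        linear_combination h2
      rcases zmod_two_cases (b i j) with h | h <;> rcases zmod_two_cases (b j i) with h' | h'
      · rw [h, h']
      · rw [h, h', show (1 : ZMod 2).val = 1 from rfl] at h3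
        norm_num at h3
      · rw [h, h', show (1 : ZMod 2).val = 1 from rfl] at h3
        norm_num at h3
      · rw [h, h']
    ext i j
    exact hsymm j i
  · intro v
    rw [hUf]
    exact (commute_diagUnitary _ _ _ _).eq
  · intro i
    rw [hUf]
    exact ⟨_, phaseI_pow_mem _, diagUnitary_mul_pauliX f hf (k i) _ _ (hb i)⟩

end Action

/-! ### Gauge-preserving diagonal circuits -/

section CSS

open scoped Matrix

variable {ρX ρZ ι κ : Type} [Fintype ι] [DecidableEq ι]

/-- The exponent vectors of the `Z`-type gauge operators. -/
def CSSSubsystemCode.gaugeZ (Q : CSSSubsystemCode ρX ρZ ι κ) : Submodule (ZMod 2) (Bits ι) :=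
  Submodule.span (ZMod 2) (Set.range fun a => Q.GZ a)

/-- The exponent vectors of the `Z`-type stabilizers: gauge operators orthogonal to all `X`-type
gauge generators. -/
def CSSSubsystemCode.stabilizerZ (Q : CSSSubsystemCode ρX ρZ ι κ) :
    Submodule (ZMod 2) (Bits ι) where
  carrier := {g | g ∈ Q.gaugeZ ∧ ∀ a, Q.GX a ⬝ᵥ g = 0}
  add_mem' := by
    rintro g g' ⟨h1, h2⟩ ⟨h1', h2'⟩
    exact ⟨add_mem h1 h1', fun a => by rw [dotProduct_add, h2, h2', add_zero]⟩
  zero_mem' := ⟨zero_mem _, fun a => dotProduct_zero _⟩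
  smul_mem' := by
    rintro c g ⟨h1, h2⟩
    exact ⟨Submodule.smul_mem _ c h1, fun a => by rw [dotProduct_smul, h2, smul_zero]⟩

theorem phase_mem_gaugeGroup (Q : CSSSubsystemCode ρX ρZ ι κ) {z : QubitUnitary ι}
    (hz : z ∈ phaseGroup ι) : z ∈ Q.gaugeGroup := by
  obtain ⟨k, rfl⟩ := exists_phaseI_pow hz
  have h : phaseI ι ∈ Q.gaugeGroup := Subgroup.subset_closure (Or.inl (Or.inl rfl))
  exact pow_mem h k

theorem pauliZ_mem_gaugeGroup (Q : CSSSubsystemCode ρX ρZ ι κ) {g : Bits ι}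
    (hg : g ∈ Q.gaugeZ) : pauliZ g ∈ Q.gaugeGroup := by
  induction hg using Submodule.span_induction with
  | mem x hx =>
    obtain ⟨a, rfl⟩ := hx
    exact Subgroup.subset_closure (Or.inr ⟨a, rfl⟩)
  | zero =>
    rw [pauliZ_zero]
    exact one_mem _
  | add x y _ _ hx hy =>
    rw [pauliZ_add]
    exact mul_mem hx hy
  | smul c x _ hx =>
    rcases zmod_two_cases c with rfl | rfl
    · rw [zero_smul, pauliZ_zero]
      exact one_mem _
    · rwa [one_smul]

theorem pauliZ_mem_stabilizerGroup (Q : CSSSubsystemCode ρX ρZ ι κ) {g : Bits ι}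
    (hg : g ∈ Q.stabilizerZ) : pauliZ g ∈ Q.stabilizerGroup := by
  refine Subgroup.mem_inf.2 ⟨?_, pauliZ_mem_gaugeGroup Q hg.1⟩
  rw [CSSSubsystemCode.gaugeGroup, Subgroup.centralizer_closure,
    Subgroup.mem_centralizer_iff]
  rintro h ((rfl | ⟨a, rfl⟩) | ⟨a, rfl⟩)
  · exact phaseI_mul_comm _
  · exact (pauliZ_mul_pauliX_of_dotProduct_eq_zero (hg.2 a)).symm
  · exact (commute_pauliZ _ _).eq

theorem phase_mem_stabilizerGroup (Q : CSSSubsystemCode ρX ρZ ι κ) {z : QubitUnitary ι}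
    (hz : z ∈ phaseGroup ι) : z ∈ Q.stabilizerGroup := by
  refine Subgroup.mem_inf.2 ⟨?_, phase_mem_gaugeGroup Q hz⟩
  rw [Subgroup.mem_centralizer_iff]
  intro h _
  exact (phase_mul_comm hz h).symm

/-- Only the images of the `X`-type gauge generators matter, as `W` commutes with all `Z`-type
Paulis. -/
theorem preserves_of_actsBy (Q : CSSSubsystemCode ρX ρZ ι κ) {W : QubitUnitary ι}
    {B : Matrix ι ι (ZMod 2)} (hW : ActsBy W B) (hB : ∀ a, Q.GX a ᵥ* B ∈ Q.gaugeZ) :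
    Q.Preserves W := by
  have key : ∀ W : QubitUnitary ι, ActsBy W B → ∀ h ∈ Q.gaugeGroup,
      W * h * W⁻¹ ∈ Q.gaugeGroup := by
    intro W hW h hh
    induction hh using Subgroup.closure_induction with
    | mem x hx =>
      rcases hx with (rfl | ⟨a, rfl⟩) | ⟨a, rfl⟩
      · rw [← phaseI_mul_comm, mul_inv_cancel_right]
        exact Subgroup.subset_closure (Or.inl (Or.inl rfl))
      · obtain ⟨z, hz, e⟩ := hW.mul_pauliX (Q.GX a)
        rw [e, mul_inv_cancel_right]
        exact mul_mem (phase_mem_gaugeGroup Q hz) (mul_mem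
          (Subgroup.subset_closure (Or.inl (Or.inr ⟨a, rfl⟩)))
          (pauliZ_mem_gaugeGroup Q (hB a)))
      · rw [hW.commute_pauliZ, mul_inv_cancel_right]
        exact Subgroup.subset_closure (Or.inr ⟨a, rfl⟩)
    | one =>
      rw [mul_one, mul_inv_cancel]
      exact one_mem _
    | mul x y _ _ hx hy =>
      have : W * (x * y) * W⁻¹ = (W * x * W⁻¹) * (W * y * W⁻¹) := by group
      rw [this]
      exact mul_mem hx hy
    | inv x _ hx =>
      have : W * x⁻¹ * W⁻¹ = (W * x * W⁻¹)⁻¹ := by group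
      rw [this]
      exact inv_mem hx
  refine Subgroup.mem_normalizer_iff.2 fun h => ⟨key W hW h, fun hh => ?_⟩
  have := key W⁻¹ hW.inv _ hh
  have e : W⁻¹ * (W * h * W⁻¹) * W⁻¹⁻¹ = h := by group
  rwa [e] at this

variable [Fintype κ]

/-- The actions have to agree on logical `X`-operators up to `Z`-type stabilizers. -/
theorem implementsModPauli_of_actsBy [DecidableEq κ] (Q : CSSSubsystemCode ρX ρZ ι κ)
    {W : QubitUnitary ι} {U : QubitUnitary κ} {B : Matrix ι ι (ZMod 2)} {Λ : Matrix κ κ (ZMod 2)}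
    (hW : ActsBy W B) (hU : ActsBy U Λ) (hQ : Q.Preserves W)
    (h : ∀ u : Bits κ, (u ᵥ* Q.LX) ᵥ* B + (u ᵥ* Λ) ᵥ* Q.LZ ∈ Q.stabilizerZ) :
    Q.ImplementsModPauli W U := by
  refine ⟨hQ, fun u v => ⟨u, u ᵥ* Λ + v, ?_, ?_⟩⟩
  · obtain ⟨z, hz, e⟩ := hU.mul_pauliX u
    have : (pauliX u * pauliZ (u ᵥ* Λ + v))⁻¹ * (U * (pauliX u * pauliZ v) * U⁻¹) = z := by
      rw [inv_mul_eq_iff_eq_mul, ← mul_assoc U, e, mul_assoc _ U, hU.commute_pauliZ,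
        ← mul_assoc, mul_inv_cancel_right, ← phase_mul_comm hz, pauliZ_add]
      simp only [mul_assoc]
    rw [this]
    exact hz
  · obtain ⟨z, hz, e⟩ := hW.mul_pauliX (u ᵥ* Q.LX)
    have : (Q.encodedPauli u (u ᵥ* Λ + v))⁻¹ * (W * Q.encodedPauli u v * W⁻¹) =
        z * pauliZ ((u ᵥ* Q.LX) ᵥ* B + (u ᵥ* Λ) ᵥ* Q.LZ) := by
      rw [CSSSubsystemCode.encodedPauli, CSSSubsystemCode.encodedPauli, inv_mul_eq_iff_eq_mul,
        ← mul_assoc W, e, mul_assoc _ W, hW.commute_pauliZ, ← mul_assoc, mul_inv_cancel_right,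
        ← mul_assoc _ z (pauliZ _), ← phase_mul_comm hz]
      simp only [mul_assoc]
      rw [← pauliZ_add, ← pauliZ_add]
      congr 3
      rw [Matrix.add_vecMul]
      have h2 := add_self_of_zmod_two ((u ᵥ* Λ) ᵥ* Q.LZ)
      calc (u ᵥ* Q.LX) ᵥ* B + v ᵥ* Q.LZ
          = (u ᵥ* Q.LX) ᵥ* B + v ᵥ* Q.LZ + ((u ᵥ* Λ) ᵥ* Q.LZ + (u ᵥ* Λ) ᵥ* Q.LZ) := by
            rw [h2, add_zero]
        _ = _ := by abel
    rw [this]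
    exact mul_mem (phase_mem_stabilizerGroup Q hz) (pauliZ_mem_stabilizerGroup Q (h u))

/-- There is a circuit of code-preserving layers, of depth at most `k`, with logical
action `Λ`. -/
def HasCircuit (Q : CSSSubsystemCode ρX ρZ ι κ) (k : ℕ) (Λ : Matrix κ κ (ZMod 2)) : Prop :=
  ∃ C : List (Layer ι), C.length ≤ k ∧
    (∀ L ∈ C, ∀ a, Q.GX a ᵥ* L.actionMatrix ∈ Q.gaugeZ) ∧
    ∀ u : Bits κ, (u ᵥ* Q.LX) ᵥ* (C.map Layer.actionMatrix).sum + (u ᵥ* Λ) ᵥ* Q.LZ ∈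
      Q.stabilizerZ

theorem HasCircuit.zero (Q : CSSSubsystemCode ρX ρZ ι κ) (k : ℕ) : HasCircuit Q k 0 := by
  refine ⟨[], by simp, by simp, fun u => ?_⟩
  simp

theorem HasCircuit.add {Q : CSSSubsystemCode ρX ρZ ι κ} {k k' : ℕ} {Λ Λ' : Matrix κ κ (ZMod 2)}
    (h : HasCircuit Q k Λ) (h' : HasCircuit Q k' Λ') : HasCircuit Q (k + k') (Λ + Λ') := by
  obtain ⟨C, h1, h2, h3⟩ := h
  obtain ⟨C', h1', h2', h3'⟩ := h'
  refine ⟨C ++ C', by simp; omega, ?_, fun u => ?_⟩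
  · intro L hL
    rcases List.mem_append.1 hL with hL | hL
    · exact h2 L hL
    · exact h2' L hL
  · have h4 := add_mem (h3 u) (h3' u)
    rw [List.map_append, List.sum_append, Matrix.vecMul_add, Matrix.vecMul_add,
      Matrix.add_vecMul]
    convert h4 using 1
    abel

theorem HasCircuit.sum {Q : CSSSubsystemCode ρX ρZ ι κ} {n k : ℕ}
    {Λ : Fin n → Matrix κ κ (ZMod 2)} (h : ∀ t, HasCircuit Q k (Λ t)) :
    HasCircuit Q (n * k) (∑ t, Λ t) := by
  induction n with
  | zero => simpa using HasCircuit.zero Q 0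
  | succ n ih =>
    rw [Fin.sum_univ_castSucc, Nat.succ_mul]
    exact (ih fun t => h t.castSucc).add (h (Fin.last n))

theorem HasCircuit.exists_implementsModPauli [DecidableEq κ] {Q : CSSSubsystemCode ρX ρZ ι κ}
    {k : ℕ} {Λ : Matrix κ κ (ZMod 2)} (h : HasCircuit Q k Λ) {U : QubitUnitary κ} (hU : ActsBy U Λ) :
    ∃ C : List (Layer ι), (∀ L ∈ C, Q.Preserves L.toUnitary) ∧
      Q.ImplementsModPauli (circuitUnitary C) U ∧ C.length ≤ k := by
  obtain ⟨C, h1, h2, h3⟩ := h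
  refine ⟨C, fun L hL => preserves_of_actsBy Q L.actsBy (h2 L hL), ?_, h1⟩
  refine implementsModPauli_of_actsBy Q (actsBy_circuitUnitary C) hU ?_ h3
  refine preserves_of_actsBy Q (actsBy_circuitUnitary C) fun a => ?_
  clear h1 h3
  induction C with
  | nil => simp
  | cons L C ih =>
    rw [List.map_cons, List.sum_cons, Matrix.vecMul_add]
    exact add_mem (h2 L (by simp) a) (ih fun L hL => h2 L (by simp [hL]))

/-- An involution on a set `D` of qubits is performed by one layer: `CZ` on the pairs it swaps
and `S` on its fixed points. -/
theorem exists_layer_of_involutive {τ : ι → ι} (hτ : ∀ i, τ (τ i) = i) (n : ℕ) :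
    ∀ D : Finset ι, D.card = n → (∀ i ∈ D, τ i ∈ D) →
      ∃ L : Layer ι, (∀ g ∈ L.gates, g.support ⊆ D) ∧
        L.actionMatrix = Matrix.of fun i j => if i ∈ D ∧ j = τ i then 1 else 0 := by
  induction n using Nat.strong_induction_on with
  | _ n ih =>
    intro D hDn hD
    rcases D.eq_empty_or_nonempty with rfl | ⟨i, hi⟩
    · refine ⟨⟨[], List.Pairwise.nil⟩, by simp, ?_⟩
      ext i j
      simp [Layer.actionMatrix]
    have extend : ∀ (g : DiagGate ι) (E : Finset ι), E ⊆ D → E.Nonempty → g.support = E →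
        (∀ j ∈ E, τ j ∈ E) →
        (g.actionMatrix = Matrix.of fun i j => if i ∈ E ∧ j = τ i then 1 else 0) →
        ∃ L : Layer ι, (∀ g ∈ L.gates, g.support ⊆ D) ∧
          L.actionMatrix = Matrix.of fun i j => if i ∈ D ∧ j = τ i then 1 else 0 := by
      intro g E hED hE hg hEτ hact
      have hcard : (D \ E).card < n := by
        rw [← hDn]
        exact Finset.card_lt_card (Finset.sdiff_ssubset hED hE)
      obtain ⟨L, h1, h2⟩ := ih _ hcard (D \ E) rfl (by
        intro j hj
        rw [Finset.mem_sdiff] at hj ⊢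
        refine ⟨hD j hj.1, fun h => hj.2 ?_⟩
        have := hEτ _ h
        rwa [hτ] at this)
      refine ⟨⟨g :: L.gates, List.pairwise_cons.2 ⟨?_, L.disjoint⟩⟩, ?_, ?_⟩
      · intro g' hg'
        rw [hg]
        exact Finset.disjoint_of_subset_right (h1 g' hg') Finset.disjoint_sdiff
      · intro g' hg'
        rcases List.mem_cons.1 hg' with rfl | hg'
        · rw [hg]
          exact hED
        · exact (h1 g' hg').trans Finset.sdiff_subset
      · have h3 : (⟨g :: L.gates, List.pairwise_cons.2 ⟨by
            intro g' hg'
            rw [hg]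
            exact Finset.disjoint_of_subset_right (h1 g' hg') Finset.disjoint_sdiff,
            L.disjoint⟩⟩ : Layer ι).actionMatrix = g.actionMatrix + L.actionMatrix := by
          simp [Layer.actionMatrix]
        rw [h3, h2, hact]
        ext a c
        simp only [Matrix.add_apply, Matrix.of_apply, Finset.mem_sdiff]
        by_cases haE : a ∈ E
        · simp [haE, hED haE]
        · simp [haE]
    by_cases hfix : τ i = i
    · refine extend (.S i) {i} (by simpa using hi) (by simp) rfl (by simp [hfix]) ?_
      ext a c
      simp only [DiagGate.actionMatrix, Matrix.of_apply, Finset.mem_singleton,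
        Matrix.single_apply]
      congr 1
      apply propext
      constructor
      · rintro ⟨rfl, rfl⟩
        exact ⟨rfl, hfix.symm⟩
      · rintro ⟨rfl, rfl⟩
        exact ⟨rfl, hfix.symm⟩
    · have hfix' : i ≠ τ i := fun h => hfix h.symm
      refine extend (.CZ i (τ i) hfix') {i, τ i} ?_ (by simp) rfl (by simp [hτ]) ?_
      · intro j hj
        simp only [Finset.mem_insert, Finset.mem_singleton] at hj
        rcases hj with rfl | rfl
        · exact hi
        · exact hD i hi
      · ext a c
        simp only [DiagGate.actionMatrix, Matrix.of_apply, Finset.mem_insert,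
          Finset.mem_singleton, Matrix.single_apply, Matrix.add_apply]
        by_cases ha : a = i
        · subst ha
          simp [hfix, eq_comm]
        · by_cases ha' : a = τ i
          · subst ha'
            simp [hfix', hτ, eq_comm]
          · simp [ha, ha', Ne.symm ha, Ne.symm ha']

end CSS

/-! ### Layers of the SHYPS code given by automorphisms of the simplex code -/

section Simplex

open scoped Matrix

/-- Invertible matrices act on the columns of a simplex generator matrix by permutations. -/
theorem IsSimplexGenerator.exists_perm {r : ℕ} {G : Matrix (Fin r) (Fin (2 ^ r - 1)) (ZMod 2)}
    (hG : IsSimplexGenerator r G) {N : Matrix (Fin r) (Fin r) (ZMod 2)} (hN : IsUnit N) :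
    ∃ σ : Equiv.Perm (Fin (2 ^ r - 1)), ∀ i c, G c (σ i) = (N * G) c i := by
  classical
  obtain ⟨hinj, hne⟩ := hG
  let e : Fin (2 ^ r - 1) → {v : Fin r → ZMod 2 // v ≠ 0} := fun i => ⟨Gᵀ i, hne i⟩
  have he : Function.Bijective e := by
    rw [Fintype.bijective_iff_injective_and_card]
    refine ⟨fun i j h => hinj (congrArg Subtype.val h), ?_⟩
    rw [Fintype.card_subtype_compl]
    simp
  have hex : ∀ i, ∃ j, Gᵀ j = N *ᵥ Gᵀ i := by
    intro i
    have h0 : N *ᵥ Gᵀ i ≠ 0 := fun h => hne i (isUnit_iff_forall_mulVec.1 hN _ h)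
    obtain ⟨j, hj⟩ := he.2 ⟨_, h0⟩
    exact ⟨j, congrArg Subtype.val hj⟩
  choose s hs using hex
  have hsinj : Function.Injective s := by
    intro i j hij
    have h1 : N *ᵥ Gᵀ i = N *ᵥ Gᵀ j := by rw [← hs, ← hs, hij]
    exact hinj (Matrix.mulVec_injective_iff_isUnit.2 hN h1)
  refine ⟨Equiv.ofBijective s (Finite.injective_iff_bijective.1 hsinj), fun i c => ?_⟩
  exact congrFun (hs i) c

/-- The vectors orthogonal to the code are the combinations of the parity checks. -/
theorem IsParityCheck.exists_eq_vecMul {m n r : ℕ} {H : Matrix (Fin m) (Fin n) (ZMod 2)}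
    {G : Matrix (Fin r) (Fin n) (ZMod 2)} (hH : IsParityCheck H G) {v : Fin n → ZMod 2}
    (hv : G *ᵥ v = 0) : ∃ y, v = y ᵥ* H := by
  by_contra hcon
  push Not at hcon
  have hmem : v ∉ LinearMap.range (Matrix.vecMulLinear H) := by
    rintro ⟨y, hy⟩
    exact hcon y hy.symm
  obtain ⟨w, hw, hw'⟩ := exists_dotProduct_of_notMem hmem
  have hHw : H *ᵥ w = 0 := by
    ext i
    have := hw' _ ⟨Pi.single i 1, rfl⟩
    rw [Matrix.vecMulLinear_apply, Matrix.single_one_vecMul, dotProduct_comm] at this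
    exact this
  obtain ⟨a, rfl⟩ := (hH w).1 hHw
  rw [← Matrix.dotProduct_mulVec, hv, dotProduct_zero] at hw
  exact zero_ne_one hw

theorem IsParityCheck.mul_transpose {m n r : ℕ} {H : Matrix (Fin m) (Fin n) (ZMod 2)}
    {G : Matrix (Fin r) (Fin n) (ZMod 2)} (hH : IsParityCheck H G) : H * Gᵀ = 0 := by
  ext i c
  have h := (hH (G c)).2 ⟨Pi.single c 1, by rw [Matrix.single_one_vecMul]; rfl⟩
  exact congrFun h i

/-- The part of a vector on block `β`, as a matrix. -/
def blockMatrix {b α γ : Type} (u : b × (α × γ) → ZMod 2) (β : b) : Matrix α γ (ZMod 2) :=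
  Matrix.of fun i j => u (β, (i, j))

theorem vecMul_one_kronecker_kronecker {b α γ α' γ' : Type} [Fintype b] [DecidableEq b]
    [Fintype α] [Fintype γ] (u : b × (α × γ) → ZMod 2) (A : Matrix α α' (ZMod 2))
    (B : Matrix γ γ' (ZMod 2)) (β : b) :
    blockMatrix (u ᵥ* ((1 : Matrix b b (ZMod 2)) ⊗ₖ (A ⊗ₖ B))) β =
      Aᵀ * blockMatrix u β * B := by
  ext i j
  simp only [blockMatrix, Matrix.of_apply, Matrix.vecMul, dotProduct, Matrix.mul_apply,
    Matrix.kroneckerMap_apply, Matrix.transpose_apply]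
  rw [Fintype.sum_prod_type, Finset.sum_eq_single β]
  · rw [Fintype.sum_prod_type, Finset.sum_comm]
    apply Finset.sum_congr rfl
    intro c _
    rw [Finset.sum_mul]
    apply Finset.sum_congr rfl
    intro a _
    rw [Matrix.one_apply_eq]
    ring
  · intro β' _ hne
    simp [Matrix.one_apply_ne hne]
  · simp

theorem blockMatrix_add {b α γ : Type} (u v : b × (α × γ) → ZMod 2) (β : b) :
    blockMatrix (u + v) β = blockMatrix u β + blockMatrix v β := rfl

variable {m b r : ℕ} {H : Matrix (Fin m) (Fin (2 ^ r - 1)) (ZMod 2)}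
  {G : Matrix (Fin r) (Fin (2 ^ r - 1)) (ZMod 2)} {p : Fin r → Fin (2 ^ r - 1)}

/-- The gauge generators `1 ⊗ H` allow every row of the array to vary in the dual of the code. -/
theorem mem_gaugeZ_of_mul_transpose (hH : IsParityCheck H G)
    {z : Fin b × (Fin (2 ^ r - 1) × Fin (2 ^ r - 1)) → ZMod 2}
    (hz : ∀ β, blockMatrix z β * Gᵀ = 0) : z ∈ ((shypsCode H G p).blocks b).gaugeZ := by
  have hrow : ∀ β k, ∃ y, (fun l => z (β, (k, l))) = y ᵥ* H := by
    intro β k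
    apply hH.exists_eq_vecMul
    ext c
    have := congrFun (congrFun (hz β) k) c
    rw [Matrix.mul_apply] at this
    exact (Finset.sum_congr rfl fun l _ => mul_comm _ _).trans this
  choose y hy using hrow
  have hzy : z = (fun q : Fin b × (Fin (2 ^ r - 1) × Fin m) => y q.1 q.2.1 q.2.2) ᵥ*
      ((shypsCode H G p).blocks b).GZ := by
    funext ⟨β, k, l⟩
    have h1 := vecMul_one_kronecker_kronecker
      (fun q : Fin b × (Fin (2 ^ r - 1) × Fin m) => y q.1 q.2.1 q.2.2)
      (1 : Matrix (Fin (2 ^ r - 1)) (Fin (2 ^ r - 1)) (ZMod 2)) H β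
    have h2 := congrFun (congrFun h1 k) l
    rw [Matrix.transpose_one, Matrix.one_mul] at h2
    refine Eq.trans ?_ h2.symm
    exact congrFun (hy β k) l
  rw [hzy, Matrix.vecMul_eq_sum]
  exact Submodule.sum_mem _ fun q _ =>
    Submodule.smul_mem _ _ (Submodule.subset_span ⟨q, rfl⟩)

theorem mem_stabilizerZ_of_mul_transpose (hH : IsParityCheck H G)
    {z : Fin b × (Fin (2 ^ r - 1) × Fin (2 ^ r - 1)) → ZMod 2}
    (hz : ∀ β, blockMatrix z β * Gᵀ = 0) (hz' : ∀ β, H * blockMatrix z β = 0) :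
    z ∈ ((shypsCode H G p).blocks b).stabilizerZ := by
  refine ⟨mem_gaugeZ_of_mul_transpose hH hz, ?_⟩
  rintro ⟨β, i, j⟩
  change (fun q => ((1 : Matrix (Fin b) (Fin b) (ZMod 2)) ⊗ₖ
    (H ⊗ₖ (1 : Matrix (Fin (2 ^ r - 1)) (Fin (2 ^ r - 1)) (ZMod 2)))) (β, i, j) q) ⬝ᵥ z = 0
  simp only [dotProduct, Matrix.kroneckerMap_apply]
  have h1 := congrFun (congrFun (hz' β) i) j
  rw [Matrix.mul_apply] at h1
  rw [Fintype.sum_prod_type, Finset.sum_eq_single β]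
  · rw [Fintype.sum_prod_type]
    refine Eq.trans (Finset.sum_congr rfl fun k _ => ?_) h1
    rw [Finset.sum_eq_single j]
    · rw [Matrix.one_apply_eq, Matrix.one_apply_eq, mul_one, one_mul]
      rfl
    · intro l _ hl
      rw [Matrix.one_apply_ne hl.symm]
      simp
    · simp
  · intro β' _ hne
    simp [Matrix.one_apply_ne hne.symm]
  · simp

/-- The logical action of a layer which couples block `β` with block `μ β` through the invertible
matrices `N β` and `N (μ β)`. -/
def pairAction (μ : Fin b → Fin b) (N : Fin b → Matrix (Fin r) (Fin r) (ZMod 2)) :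
    Matrix (Fin b × (Fin r × Fin r)) (Fin b × (Fin r × Fin r)) (ZMod 2) :=
  Matrix.of fun q q' =>
    if q'.1 = μ q.1 then N (μ q.1) q.2.2 q'.2.1 * N q.1 q'.2.2 q.2.1 else 0

theorem blockMatrix_vecMul_pairAction {μ : Fin b → Fin b} (hμ : ∀ β, μ (μ β) = β)
    (N : Fin b → Matrix (Fin r) (Fin r) (ZMod 2)) (u : Fin b × (Fin r × Fin r) → ZMod 2)
    (β : Fin b) :
    blockMatrix (u ᵥ* pairAction μ N) β =
      (N β)ᵀ * (blockMatrix u (μ β))ᵀ * (N (μ β))ᵀ := by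
  ext k l
  simp only [blockMatrix, Matrix.of_apply, Matrix.vecMul, dotProduct, Matrix.mul_apply,
    Matrix.transpose_apply, pairAction]
  rw [Fintype.sum_prod_type, Finset.sum_eq_single (μ β)]
  · rw [Fintype.sum_prod_type]
    apply Finset.sum_congr rfl
    intro i _
    rw [Finset.sum_mul]
    apply Finset.sum_congr rfl
    intro j _
    rw [hμ, if_pos rfl]
    ring
  · intro β' _ hne
    apply Finset.sum_eq_zero
    intro q _
    rw [if_neg, mul_zero]
    rintro h
    exact hne (by rw [h, hμ])
  · simp

/-- The layer permutes and exchanges the two tensor factors of the qubit array. With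
`G c (σ i) = (N G) c i` for the permutation `σ` of `N`, it maps
`X`-gauge operators to `Z`-gauge operators since `N` preserves the code, and logical
operators as stated since `P` and `G` are dual to each other. -/
theorem hasCircuit_pairAction (hG : IsSimplexGenerator r G) (hH : IsParityCheck H G)
    (hp : pivotMatrix p * Gᵀ = 1) {μ : Fin b → Fin b} (hμ : ∀ β, μ (μ β) = β)
    {N : Fin b → Matrix (Fin r) (Fin r) (ZMod 2)}
    (hN : ∀ β, (IsUnit (N β) ∧ IsUnit (N (μ β))) ∨ (N β = 0 ∧ N (μ β) = 0)) :
    HasCircuit ((shypsCode H G p).blocks b) 1 (pairAction μ N) := by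
  classical
  have hσ : ∀ β, ∃ σ : Equiv.Perm (Fin (2 ^ r - 1)),
      IsUnit (N β) → ∀ i c, G c (σ i) = (N β * G) c i := by
    intro β
    by_cases h : IsUnit (N β)
    · obtain ⟨σ, hσ⟩ := hG.exists_perm h
      exact ⟨σ, fun _ => hσ⟩
    · exact ⟨1, fun h' => absurd h' h⟩
  choose σ hσ using hσ
  let τ : Fin b × (Fin (2 ^ r - 1) × Fin (2 ^ r - 1)) →
      Fin b × (Fin (2 ^ r - 1) × Fin (2 ^ r - 1)) :=
    fun q => (μ q.1, ((σ (μ q.1)).symm q.2.2, σ q.1 q.2.1))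
  have hτ : ∀ q, τ (τ q) = q := by
    rintro ⟨β, i, j⟩
    simp [τ, hμ]
  let D : Finset (Fin b × (Fin (2 ^ r - 1) × Fin (2 ^ r - 1))) :=
    Finset.univ.filter fun q => IsUnit (N q.1) ∧ IsUnit (N (μ q.1))
  have hD : ∀ q ∈ D, τ q ∈ D := by
    intro q hq
    simp only [D, Finset.mem_filter, Finset.mem_univ, true_and, τ, hμ] at hq ⊢
    exact ⟨hq.2, hq.1⟩
  obtain ⟨L, -, hL⟩ := exists_layer_of_involutive hτ _ D rfl hD
  have hact : ∀ (x : Fin b × (Fin (2 ^ r - 1) × Fin (2 ^ r - 1)) → ZMod 2) q,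
      (x ᵥ* L.actionMatrix) q = if q ∈ D then x (τ q) else 0 := by
    intro x q
    rw [hL, Matrix.vecMul, dotProduct, Finset.sum_eq_single (τ q)]
    · by_cases hq : q ∈ D
      · simp [hq, hD q hq, hτ]
      · have : τ q ∉ D := fun h => hq (by simpa [hτ] using hD _ h)
        simp [hq, this]
    · intro q' _ hne
      have : ¬ q = τ q' := fun h => hne (by rw [h, hτ])
      simp [this]
    · simp
  have hmemD : ∀ β k l, (β, (k, l)) ∈ D ↔ IsUnit (N β) ∧ IsUnit (N (μ β)) := by
    intro β k l
    simp [D]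
  -- the permutation of an invertible matrix, moved from one factor of a sum to the other
  have hmove : ∀ β, IsUnit (N β) → ∀ (x : Fin (2 ^ r - 1) → ZMod 2) c,
      ∑ l, x ((σ β).symm l) * G c l = ∑ l, x l * (N β * G) c l := by
    intro β hβ x c
    rw [← Equiv.sum_comp (σ β)]
    apply Finset.sum_congr rfl
    intro l _
    rw [Equiv.symm_apply_apply, hσ β hβ]
  refine ⟨[L], by simp, ?_, fun u => ?_⟩
  · intro L' hL' a
    rw [List.mem_singleton.1 hL']
    apply mem_gaugeZ_of_mul_transpose hH
    intro β
    ext k c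
    rw [Matrix.mul_apply, Matrix.zero_apply]
    simp only [blockMatrix, Matrix.of_apply, Matrix.transpose_apply, hact, hmemD]
    split_ifs with hβ
    · obtain ⟨β₀, i₀, j₀⟩ := a
      change ∑ l, (1 : Matrix (Fin b) (Fin b) (ZMod 2)) β₀ (μ β) *
        (H i₀ ((σ (μ β)).symm l) * (1 : Matrix (Fin (2 ^ r - 1)) (Fin (2 ^ r - 1)) (ZMod 2))
          j₀ (σ β k)) * G c l = 0
      rw [hmove (μ β) hβ.2 (fun l => (1 : Matrix (Fin b) (Fin b) (ZMod 2)) β₀ (μ β) *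
        (H i₀ l * (1 : Matrix (Fin (2 ^ r - 1)) (Fin (2 ^ r - 1)) (ZMod 2)) j₀ (σ β k)))]
      have h0 : ∑ l, H i₀ l * (N (μ β) * G) c l = 0 := by
        have h1 : (H * (N (μ β) * G)ᵀ) i₀ c = 0 := by
          rw [Matrix.transpose_mul, ← Matrix.mul_assoc, hH.mul_transpose, Matrix.zero_mul,
            Matrix.zero_apply]
        rw [← h1, Matrix.mul_apply]
        rfl
      calc _ = (1 : Matrix (Fin b) (Fin b) (ZMod 2)) β₀ (μ β) *
            (1 : Matrix (Fin (2 ^ r - 1)) (Fin (2 ^ r - 1)) (ZMod 2)) j₀ (σ β k) *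
              ∑ l, H i₀ l * (N (μ β) * G) c l := by
            rw [Finset.mul_sum]
            apply Finset.sum_congr rfl
            intro l _
            ring
        _ = 0 := by rw [h0, mul_zero]
    · simp
  · have hfac : ∀ β, ∃ (Y : Matrix (Fin r) (Fin r) (ZMod 2))
        (R : Matrix (Fin r) (Fin (2 ^ r - 1)) (ZMod 2)), R * Gᵀ = 0 ∧
        blockMatrix ((u ᵥ* ((shypsCode H G p).blocks b).LX) ᵥ* L.actionMatrix +
          (u ᵥ* pairAction μ N) ᵥ* ((shypsCode H G p).blocks b).LZ) β = Gᵀ * Y * R := by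
      intro β
      have hZ : blockMatrix ((u ᵥ* pairAction μ N) ᵥ* ((shypsCode H G p).blocks b).LZ) β =
          Gᵀ * ((N β)ᵀ * (blockMatrix u (μ β))ᵀ * (N (μ β))ᵀ) * pivotMatrix p := by
        rw [← blockMatrix_vecMul_pairAction hμ]
        exact vecMul_one_kronecker_kronecker _ _ _ _
      rcases hN β with hβ | hβ
      · let P' : Matrix (Fin r) (Fin (2 ^ r - 1)) (ZMod 2) :=
          (pivotMatrix p).submatrix id (σ (μ β)).symm
        refine ⟨(N β)ᵀ * (blockMatrix u (μ β))ᵀ, P' + (N (μ β))ᵀ * pivotMatrix p, ?_, ?_⟩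
        · have h1 : P' * Gᵀ = (N (μ β))ᵀ := by
            ext a c
            have h2 := hmove (μ β) hβ.2 (fun l => pivotMatrix p a l) c
            rw [Matrix.mul_apply]
            refine Eq.trans h2 ?_
            have h3 : (pivotMatrix p * (N (μ β) * G)ᵀ) a c = (N (μ β))ᵀ a c := by
              rw [Matrix.transpose_mul, ← Matrix.mul_assoc, hp, Matrix.one_mul]
            rw [← h3, Matrix.mul_apply]
            rfl
          rw [Matrix.add_mul, Matrix.mul_assoc, hp, Matrix.mul_one, h1]
          exact add_self_of_zmod_two _
        · have hX : blockMatrix ((u ᵥ* ((shypsCode H G p).blocks b).LX) ᵥ* L.actionMatrix) β =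
              Gᵀ * (N β)ᵀ * (blockMatrix u (μ β))ᵀ * P' := by
            have h1 : blockMatrix (u ᵥ* ((shypsCode H G p).blocks b).LX) (μ β) =
                (pivotMatrix p)ᵀ * blockMatrix u (μ β) * G :=
              vecMul_one_kronecker_kronecker _ _ _ _
            ext k l
            have h2 := congrFun (congrFun h1 ((σ (μ β)).symm l)) (σ β k)
            simp only [blockMatrix, Matrix.of_apply] at h2
            have h3 : blockMatrix ((u ᵥ* ((shypsCode H G p).blocks b).LX) ᵥ* L.actionMatrix) β
                k l = ((pivotMatrix p)ᵀ * blockMatrix u (μ β) * G)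
                  ((σ (μ β)).symm l) (σ β k) := by
              rw [← h1]
              simp only [blockMatrix, Matrix.of_apply, hact, hmemD]
              rw [if_pos hβ]
            rw [h3, Matrix.mul_apply]
            simp only [hσ β hβ.1]
            have h4 : (((pivotMatrix p)ᵀ * blockMatrix u (μ β)) * (N β * G))ᵀ k
                ((σ (μ β)).symm l) = (Gᵀ * (N β)ᵀ * (blockMatrix u (μ β))ᵀ * P') k l := by
              rw [Matrix.transpose_mul, Matrix.transpose_mul, Matrix.transpose_mul,
                Matrix.transpose_transpose, ← Matrix.mul_assoc]
              rfl
            rw [← h4, Matrix.transpose_apply, Matrix.mul_apply]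
          rw [blockMatrix_add, hX, hZ]
          simp only [Matrix.mul_add, Matrix.mul_assoc]
      · refine ⟨0, 0, Matrix.zero_mul _, ?_⟩
        rw [blockMatrix_add, hZ, hβ.1]
        ext k l
        have hnot : ¬ (IsUnit (N β) ∧ IsUnit (N (μ β))) ∨ r = 0 := by
          by_cases hr : r = 0
          · exact Or.inr hr
          · left
            rintro ⟨h, -⟩
            have : Nonempty (Fin r) := ⟨⟨0, by omega⟩⟩
            rw [hβ.1] at h
            exact not_isUnit_zero h
        rcases hnot with hnot | rfl
        · simp [blockMatrix, hact, hmemD, hnot]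
        · exact k.elim0
    -- in the form `Gᵀ Y R` with `R Gᵀ = 0`, all rows are in the dual of the code, and all columns
    -- in the code
    rw [List.map_singleton, List.sum_singleton]
    apply mem_stabilizerZ_of_mul_transpose hH
    · intro β
      obtain ⟨Y, R, hR, e⟩ := hfac β
      rw [e, Matrix.mul_assoc, hR, Matrix.mul_zero]
    · intro β
      obtain ⟨Y, R, hR, e⟩ := hfac β
      rw [e, ← Matrix.mul_assoc, ← Matrix.mul_assoc, hH.mul_transpose, Matrix.zero_mul,
        Matrix.zero_mul]

end Simplex

/-! ### Edge colourings of complete graphs -/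

/-- A family `μ` of involutions of `X` such that any two distinct points are exchanged by exactly
one of them: an edge colouring of the complete graph on `X`, fixed points of `μ c` being the
points not met by the colour `c`. -/
def IsMatchingFamily {C X : Type} (μ : C → X → X) : Prop :=
  (∀ c x, μ c (μ c x) = x) ∧ ∀ x y, x ≠ y → ∃! c, μ c x = y

theorem IsMatchingFamily.congr {C X C' X' : Type} {μ : C → X → X} (h : IsMatchingFamily μ)
    (e : C' ≃ C) (e' : X' ≃ X) :
    IsMatchingFamily fun c x => e'.symm (μ (e c) (e' x)) := by
  refine ⟨fun c x => by simp [h.1], fun x y hxy => ?_⟩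
  obtain ⟨c, hc, hc'⟩ := h.2 (e' x) (e' y) (fun he => hxy (e'.injective he))
  refine ⟨e.symm c, by simp [hc], fun d hd => ?_⟩
  rw [Equiv.eq_symm_apply]
  exact hc' _ (by rw [← hd]; simp)

theorem isMatchingFamily_sub (A : Type) [AddCommGroup A] :
    IsMatchingFamily fun c x : A => c - x :=
  ⟨fun c x => sub_sub_cancel c x, fun x y _ =>
    ⟨y + x, add_sub_cancel_right y x, fun _ h => sub_eq_iff_eq_add.1 h⟩⟩

/-- If every element is divisible by two in a unique way, the reflection `x ↦ c - x` has the
single fixed point `c / 2`, which can be matched with an additional point. -/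
theorem exists_isMatchingFamily_option (A : Type) [AddCommGroup A] [DecidableEq A] (half : A → A)
    (hhalf : ∀ c x, x + x = c ↔ x = half c) :
    ∃ μ : A → Option A → Option A, IsMatchingFamily μ := by
  refine ⟨fun c x => x.elim (some (half c)) fun x => if x = half c then none else some (c - x),
    ?_, ?_⟩
  · rintro c (_ | x)
    · simp
    · by_cases hx : x = half c
      · simp [hx]
      · have h : ¬ c - x = half c := fun h => hx <| by
          rw [← h]
          have := (hhalf c _).2 h
          have h2 : c = x + x := by
            have h3 : c - x + (c - x) - c + (x + x) = c - c + (x + x) := by rw [this]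
            have h4 : c - x + (c - x) - c + (x + x) = c := by abel
            rw [h4] at h3
            simpa using h3
          rw [h2, add_sub_cancel_right]
        simp [hx, h]
  · rintro (_ | x) (_ | y) hxy
    · exact absurd rfl hxy
    · refine ⟨y + y, ?_, fun d hd => ?_⟩
      · simpa using ((hhalf (y + y) y).1 rfl).symm
      · simp only [Option.elim_none, Option.some.injEq] at hd
        exact ((hhalf d y).2 hd.symm).symm
    · refine ⟨x + x, ?_, fun d hd => ?_⟩
      · simpa using (hhalf (x + x) x).1 rfl
      · simp only [Option.elim_some, ite_eq_left_iff, reduceCtorEq, imp_false, not_not] at hd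
        exact ((hhalf d x).2 hd).symm
    · have hxy' : x ≠ y := fun h => hxy (congrArg some h)
      refine ⟨y + x, ?_, fun d hd => ?_⟩
      · have : ¬ x = half (y + x) := fun h =>
          hxy' (add_right_cancel ((hhalf _ _).2 h))
        simp [this]
      · simp only [Option.elim_some] at hd
        split_ifs at hd
        exact sub_eq_iff_eq_add.1 (Option.some.inj hd)

/-- The complete graph on `b` points has an edge colouring with `b` colours. -/
theorem exists_isMatchingFamily (b : ℕ) :
    ∃ μ : Fin b → Fin b → Fin b, IsMatchingFamily μ := by
  rcases b with _ | k
  · exact ⟨fun c => c.elim0, fun c => c.elim0, fun x => x.elim0⟩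
  · exact ⟨_, isMatchingFamily_sub (Fin (k + 1))⟩

/-- For even `b ≠ 0`, `b - 1` colours suffice. -/
theorem exists_isMatchingFamily_of_even {b : ℕ} (hb : Even b) (hb0 : b ≠ 0) :
    ∃ n, n + 1 = b ∧ ∃ μ : Fin n → Fin b → Fin b, IsMatchingFamily μ := by
  obtain ⟨j, rfl⟩ : ∃ j, b = 2 * j + 1 + 1 := by
    obtain ⟨i, rfl⟩ := hb
    exact ⟨i - 1, by omega⟩
  have h0 : (2 * j + 1 : ZMod (2 * j + 1)) = 0 := by
    have := ZMod.natCast_self (2 * j + 1)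
    push_cast at this
    exact this
  -- modulo `2 j + 1`, the inverse of `2` is `j + 1`
  obtain ⟨μ, hμ⟩ := exists_isMatchingFamily_option (ZMod (2 * j + 1)) (fun c => (j + 1) * c) <| by
    intro c x
    constructor
    · rintro rfl
      linear_combination (-x) * h0
    · rintro rfl
      linear_combination c * h0
  exact ⟨_, rfl, _, hμ.congr (Equiv.refl (Fin (2 * j + 1))) (finSuccEquiv (2 * j + 1))⟩

/-! ### Circuits for all symmetric matrices -/

section Blocks

open scoped Matrix

variable {m b r : ℕ} {H : Matrix (Fin m) (Fin (2 ^ r - 1)) (ZMod 2)}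
  {G : Matrix (Fin r) (Fin (2 ^ r - 1)) (ZMod 2)} {p : Fin r → Fin (2 ^ r - 1)}

/-- The block of `Λ` between two blocks of logical qubits, with indices rearranged such that the
block of `pairAction μ N` at `β`, `μ β` becomes the tensor product of `N β` and `N (μ β)`. -/
def reshuffle (Λ : Matrix (Fin b × (Fin r × Fin r)) (Fin b × (Fin r × Fin r)) (ZMod 2))
    (β β' : Fin b) : Matrix (Fin r × Fin r) (Fin r × Fin r) (ZMod 2) :=
  Matrix.of fun q q' => Λ (β, (q.2, q'.1)) (β', (q'.2, q.1))

/-- Circuits whose layers all use the same involution `μ` of the blocks. -/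
theorem hasCircuit_of_sum_outer (hG : IsSimplexGenerator r G) (hH : IsParityCheck H G)
    (hp : pivotMatrix p * Gᵀ = 1) {μ : Fin b → Fin b} (hμ : ∀ β, μ (μ β) = β) {n : ℕ}
    {N : Fin n → Fin b → Matrix (Fin r) (Fin r) (ZMod 2)}
    (hN : ∀ t β, (IsUnit (N t β) ∧ IsUnit (N t (μ β))) ∨ (N t β = 0 ∧ N t (μ β) = 0))
    {Λ : Matrix (Fin b × (Fin r × Fin r)) (Fin b × (Fin r × Fin r)) (ZMod 2)}
    (hΛ : ∀ β, ∑ t, outer r (N t β) (N t (μ β)) = reshuffle Λ β (μ β))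
    (hΛ' : ∀ q q', q'.1 ≠ μ q.1 → Λ q q' = 0) :
    HasCircuit ((shypsCode H G p).blocks b) n Λ := by
  have h := HasCircuit.sum fun t => hasCircuit_pairAction hG hH hp hμ (hN t)
  rw [mul_one] at h
  convert h
  ext ⟨β, i, j⟩ ⟨β', k, l⟩
  rw [Matrix.sum_apply]
  by_cases hβ : β' = μ β
  · subst hβ
    have h1 := congrFun (congrFun (hΛ β) (l, i)) (j, k)
    rw [Matrix.sum_apply] at h1
    refine Eq.trans h1.symm (Finset.sum_congr rfl fun t _ => ?_)
    rw [outer_apply]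
    simp only [pairAction, Matrix.of_apply, if_true]
    exact mul_comm _ _
  · rw [hΛ' _ _ hβ]
    simp [pairAction, hβ]

/-- The diagonal blocks are symmetric tensors, implemented by squares with `μ = id`. -/
theorem hasCircuit_diagonal_blocks (hG : IsSimplexGenerator r G) (hH : IsParityCheck H G)
    (hp : pivotMatrix p * Gᵀ = 1) {d : ℕ}
    (hd : ∀ W : Matrix (Fin r × Fin r) (Fin r × Fin r) (ZMod 2), W.IsSymm →
      IsSumOfAtMost (unitSquares r) d W)
    {Λ : Matrix (Fin b × (Fin r × Fin r)) (Fin b × (Fin r × Fin r)) (ZMod 2)}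
    (hΛ : Λ.IsSymm) :
    HasCircuit ((shypsCode H G p).blocks b) d
      (Matrix.of fun q q' => if q'.1 = q.1 then Λ q q' else 0) := by
  have hf : ∀ β, ∃ N : Fin d → Matrix (Fin r) (Fin r) (ZMod 2),
      (∀ t, IsUnit (N t) ∨ N t = 0) ∧ ∑ t, outer r (N t) (N t) = reshuffle Λ β β := by
    intro β
    obtain ⟨f, hf, hsum⟩ := (hd (reshuffle Λ β β) (by
      ext q q'
      exact hΛ.apply _ _)).exists_fin
    have hex : ∀ t, ∃ M, (IsUnit M ∨ M = 0) ∧ outer r M M = f t := by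
      intro t
      rcases hf t with ⟨M, hM, hMf⟩ | h0
      · exact ⟨M, Or.inl hM, hMf⟩
      · exact ⟨0, Or.inr rfl, by rw [h0]; simp⟩
    choose N hN hN' using hex
    exact ⟨N, hN, by rw [← hsum]; exact Finset.sum_congr rfl fun t _ => hN' t⟩
  choose N hN hsum using hf
  refine hasCircuit_of_sum_outer hG hH hp (μ := id) (fun _ => rfl) (N := fun t β => N β t)
    (fun t β => (hN β t).imp (fun h => ⟨h, h⟩) fun h => ⟨h, h⟩) (fun β => ?_) fun q q' h => ?_
  · refine (hsum β).trans ?_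
    ext q q'
    simp [reshuffle]
  · simp only [Matrix.of_apply]
    exact if_neg h

/-- The blocks of `Λ` between `β` and `μ β ≠ β` are implemented together. The decomposition of the
block with `β < μ β` determines that of the transposed block. -/
theorem hasCircuit_matched_blocks (hG : IsSimplexGenerator r G) (hH : IsParityCheck H G)
    (hp : pivotMatrix p * Gᵀ = 1) {d : ℕ}
    (hd : ∀ W : Matrix (Fin r × Fin r) (Fin r × Fin r) (ZMod 2),
      IsSumOfAtMost (unitTensors r) d W)
    {μ : Fin b → Fin b} (hμ : ∀ β, μ (μ β) = β)
    {Λ : Matrix (Fin b × (Fin r × Fin r)) (Fin b × (Fin r × Fin r)) (ZMod 2)}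
    (hΛ : Λ.IsSymm) :
    HasCircuit ((shypsCode H G p).blocks b) d
      (Matrix.of fun q q' => if q'.1 = μ q.1 ∧ q.1 ≠ q'.1 then Λ q q' else 0) := by
  have hf : ∀ β, ∃ A B : Fin d → Matrix (Fin r) (Fin r) (ZMod 2),
      (∀ t, (IsUnit (A t) ∧ IsUnit (B t)) ∨ (A t = 0 ∧ B t = 0)) ∧
        ∑ t, outer r (A t) (B t) = reshuffle Λ β (μ β) := by
    intro β
    obtain ⟨f, hf, hsum⟩ := (hd (reshuffle Λ β (μ β))).exists_fin
    have hex : ∀ t, ∃ A B, ((IsUnit A ∧ IsUnit B) ∨ (A = 0 ∧ B = 0)) ∧ outer r A B = f t := by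
      intro t
      rcases hf t with ⟨A, B, hA, hB, hAB⟩ | h0
      · exact ⟨A, B, Or.inl ⟨hA, hB⟩, hAB⟩
      · exact ⟨0, 0, Or.inr ⟨rfl, rfl⟩, by rw [h0]; simp⟩
    choose A B h h' using hex
    exact ⟨A, B, h, by rw [← hsum]; exact Finset.sum_congr rfl fun t _ => h' t⟩
  choose A B hAB hsum using hf
  refine hasCircuit_of_sum_outer hG hH hp hμ
    (N := fun t β => if β < μ β then A β t else if μ β < β then B (μ β) t else 0)
    (fun t β => ?_) (fun β => ?_) fun q q' h => ?_
  · simp only [hμ]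
    rcases lt_trichotomy β (μ β) with h | h | h
    · rw [if_pos h, if_neg h.not_gt, if_pos h]
      exact hAB β t
    · rw [← h]
      simp
    · rw [if_neg h.not_gt, if_pos h, if_pos h]
      exact (hAB (μ β) t).imp And.symm And.symm
  · simp only [hμ]
    rcases lt_trichotomy β (μ β) with h | h | h
    · simp only [if_pos h, if_neg h.not_gt]
      rw [hsum β]
      ext q q'
      simp [reshuffle, h.ne]
    · rw [← h]
      ext q q'
      simp [reshuffle]
    · simp only [if_neg h.not_gt, if_pos h]
      -- the decomposition of the block at `μ β`, `β`, with the two tensor factors exchanged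
      ext ⟨l, i⟩ ⟨j, k⟩
      have h1 := congrFun (congrFun (hsum (μ β)) (j, k)) (l, i)
      rw [Matrix.sum_apply] at h1 ⊢
      simp only [outer_apply] at h1 ⊢
      have h2 : reshuffle Λ (μ β) (μ (μ β)) (j, k) (l, i) = Λ (β, (i, j)) (μ β, (k, l)) := by
        rw [hμ]
        exact hΛ.apply _ _
      rw [h2] at h1
      refine Eq.trans (Finset.sum_congr rfl fun t _ => mul_comm _ _) (h1.trans ?_)
      simp [reshuffle, h.ne']
  · simp only [Matrix.of_apply]
    exact if_neg fun h' => h h'.1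

/-- The diagonal blocks are implemented together, and so are the blocks of each colour of an edge
colouring of the complete graph on the blocks. -/
theorem hasCircuit_of_isSymm (hG : IsSimplexGenerator r G) (hH : IsParityCheck H G)
    (hp : pivotMatrix p * Gᵀ = 1) {d d' n : ℕ}
    (hd : ∀ W : Matrix (Fin r × Fin r) (Fin r × Fin r) (ZMod 2), W.IsSymm →
      IsSumOfAtMost (unitSquares r) d W)
    (hd' : ∀ W : Matrix (Fin r × Fin r) (Fin r × Fin r) (ZMod 2),
      IsSumOfAtMost (unitTensors r) d' W)
    {μ : Fin n → Fin b → Fin b} (hμ : IsMatchingFamily μ)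
    {Λ : Matrix (Fin b × (Fin r × Fin r)) (Fin b × (Fin r × Fin r)) (ZMod 2)}
    (hΛ : Λ.IsSymm) :
    HasCircuit ((shypsCode H G p).blocks b) (d + n * d') Λ := by
  have h := (hasCircuit_diagonal_blocks hG hH hp hd hΛ).add
    (HasCircuit.sum fun c => hasCircuit_matched_blocks hG hH hp hd' (hμ.1 c) hΛ)
  convert h
  ext q q'
  rw [Matrix.add_apply, Matrix.sum_apply]
  simp only [Matrix.of_apply]
  by_cases hq : q.1 = q'.1
  · simp [hq]
  · obtain ⟨c, hc, hc'⟩ := hμ.2 _ _ hq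
    rw [if_neg (Ne.symm hq), zero_add, Finset.sum_eq_single c]
    · rw [if_pos ⟨hc.symm, hq⟩]
    · intro c₁ _ hne
      exact if_neg fun h => hne (hc' _ h.1.symm)
    · simp

end Blocks

theorem mainTheorem10 (r : ℕ) (hr : 3 ≤ r) (b m : ℕ)
    (H : Matrix (Fin m) (Fin (2 ^ r - 1)) (ZMod 2))
    (G : Matrix (Fin r) (Fin (2 ^ r - 1)) (ZMod 2))
    (p : Fin r → Fin (2 ^ r - 1))
    (hG : IsSimplexGenerator r G) (hH : IsParityCheck H G)
    (hp : pivotMatrix p * G.transpose = 1)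
    (U : QubitUnitary (Fin b × (Fin r × Fin r))) (hU : IsDiagonalClifford U) :
    ∃ C : List (Layer (Fin b × (Fin (2 ^ r - 1) × Fin (2 ^ r - 1)))),
      (∀ L ∈ C, ((shypsCode H G p).blocks b).Preserves L.toUnitary) ∧
      ((shypsCode H G p).blocks b).ImplementsModPauli (circuitUnitary C) U ∧
      (Even b → 4 ≤ r →
        (C.length : ℤ) ≤ b * r ^ 2 + (b + 4) * r + (4 * b - 2)) ∧
      (Even b → r = 3 → (C.length : ℤ) ≤ 16 * b + 19) ∧
      (Odd b → 4 ≤ r →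
        (C.length : ℤ) ≤ (b + 1) * r ^ 2 + (b + 5) * r + (4 * b + 2)) ∧
      (Odd b → r = 3 → (C.length : ℤ) ≤ 16 * b + 35) := by
  obtain ⟨Λ, hΛ, hUΛ⟩ := hU.exists_actsBy
  suffices h : ∃ k, HasCircuit ((shypsCode H G p).blocks b) k Λ ∧
      (Even b → 4 ≤ r → (k : ℤ) ≤ b * r ^ 2 + (b + 4) * r + (4 * b - 2)) ∧
      (Even b → r = 3 → (k : ℤ) ≤ 16 * b + 19) ∧
      (Odd b → 4 ≤ r → (k : ℤ) ≤ (b + 1) * r ^ 2 + (b + 5) * r + (4 * b + 2)) ∧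
      (Odd b → r = 3 → (k : ℤ) ≤ 16 * b + 35) by
    obtain ⟨k, hk, h1, h2, h3, h4⟩ := h
    obtain ⟨C, hC, hCU, hlen⟩ := hk.exists_implementsModPauli hUΛ
    have hlen' : (C.length : ℤ) ≤ k := by exact_mod_cast hlen
    exact ⟨C, hC, hCU, fun h h' => hlen'.trans (h1 h h'), fun h h' => hlen'.trans (h2 h h'),
      fun h h' => hlen'.trans (h3 h h'), fun h h' => hlen'.trans (h4 h h')⟩
  have hT : ∀ W, IsSumOfAtMost (unitTensors r) (r ^ 2 + r + 4) W :=
    isSumOfAtMost_unitTensors_of_two_le (by omega)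
  obtain ⟨d, hd, hd4, hd3⟩ : ∃ d : ℕ, (∀ W : Matrix (Fin r × Fin r) (Fin r × Fin r) (ZMod 2),
      W.IsSymm → IsSumOfAtMost (unitSquares r) d W) ∧
      (4 ≤ r → (d : ℤ) = r ^ 2 + 5 * r + 2) ∧ (r = 3 → d = 32) := by
    by_cases h4 : 4 ≤ r
    · exact ⟨r ^ 2 + 5 * r + 2, fun W hW => isSumOfAtMost_unitSquares_of_four_le h4 hW,
        fun _ => by push_cast; ring, fun h => by omega⟩
    · obtain rfl : r = 3 := by omega
      exact ⟨32, fun W hW => isSumOfAtMost_unitSquares_of_three_le le_rfl hW,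
        fun h => by omega, fun _ => rfl⟩
  rcases Nat.even_or_odd b with hb | hb
  · have hodd : ¬ Odd b := Nat.not_odd_iff_even.2 hb
    by_cases hb0 : b = 0
    · subst hb0
      have h0 : Λ = 0 := by
        ext q
        exact q.1.elim0
      exact ⟨0, h0 ▸ HasCircuit.zero _ 0, fun _ h4 => by push_cast; linarith,
        fun _ _ => by norm_num, fun h => absurd h hodd, fun h => absurd h hodd⟩
    · obtain ⟨n, rfl, μ, hμ⟩ := exists_isMatchingFamily_of_even hb hb0
      refine ⟨d + n * (r ^ 2 + r + 4), hasCircuit_of_isSymm hG hH hp hd hT hμ hΛ,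
        fun _ h4 => ?_, fun _ h3 => ?_, fun h => absurd h hodd, fun h => absurd h hodd⟩
      · push_cast
        rw [hd4 h4]
        apply le_of_eq
        ring
      · subst h3
        rw [hd3 rfl]
        push_cast
        linarith
  · have heven : ¬ Even b := Nat.not_even_iff_odd.2 hb
    obtain ⟨μ, hμ⟩ := exists_isMatchingFamily b
    refine ⟨d + b * (r ^ 2 + r + 4), hasCircuit_of_isSymm hG hH hp hd hT hμ hΛ,
      fun h => absurd h heven, fun h => absurd h heven, fun _ h4 => ?_, fun _ h3 => ?_⟩
    · push_cast
      rw [hd4 h4]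
      apply le_of_eq
      ring
    · subst h3
      rw [hd3 rfl]
      push_cast
      linarith
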